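/- Let $h:[0,\infty)\to[0,\infty)$ be measurable with $\alpha:=\int_0^\infty h(t)\,dt<1$. Let $\tau_1,\tau_2,\dots$ be i.i.d. nonnegative random variables with finite mean whose distribution function $F$ has a density $f:[0,\infty)\to[0,\infty)$ (measurable), $F(t)=\int_0^t f(s)\,ds$; in particular $\tau_i>0$ a.s. Put $S_0=0$, $S_i=\tau_1+\dots+\tau_i$, and let $$\mu(t)=\frac{f(t)}{1-\int_0^t f(s)\,ds}$$ be the hazard function of the renewal law (with $\mu(t)=0$ where the denominator vanishes). *Construction.* The renewal process $N_R=\sum_{i\ge0}\delta_{S_i}$ is the process of immigrants. Every individual $v$ (an immigrant or an offspring) carries its own Poisson process $\xi_v$ on $[0,\infty)$ with intensity measure $h(x)\,dx$; the processes $\xi_v$ are mutually independent and independent of $(\tau_i)$. An individual born at time $t$ produces offspring according to $\xi_v$ translated by $t$, i.e. a Poisson process with intensity $h(x-t)\,dx$ on $[t,\infty)$. Let $N_c^{(0)}(\cdot\mid S_i)=\delta_{S_i}$, let $N_c^{(n+1)}(\cdot\mid S_i)$ be the superposition of the offspring processes of all the individuals of $N_c^{(n)}(\cdot\mid S_i)$,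 and put $$N_c^{(n)}=\sum_{i\ge0}N_c^{(n)}(\cdot\mid S_i),\qquad N=\sum_{i\ge0}\sum_{n\ge0}N_c^{(n)}(\cdot\mid S_i).$$ Let $T_0\le T_1\le\cdots$ be the points of $N$ in increasing order, let $D_i=0$ if $T_i$ is a point of $N_R$ and $D_i=1$ otherwise, and put $I(t)=\max\{i: T_i\le t,\ D_i=0\}$ and $I(t-)=\max\{i:T_i<t,\ D_i=0\}$, so that $T_{I(t-)}$ is the last immigrant strictly before $t$. Let $(\mathcal F_t)_{t\ge0}$ be the augmentation by the $\mathbb P$-null sets of the filtration $\mathcal F^0_t=\sigma\big(N_c^{(n)}((a,b]):0\le a\le b\le t,\ n\ge0\big)$. *Claim.* $N$ is a.s. locally finite and simple ($T_i<T_{i+1}$ for all $i$ with $T_i<\infty$, and $N=\sum_{i:\,T_i<\infty}\delta_{T_i}$), almost surely for every $t>0$ there is an immigrant before $t$, the processes $N([0,t])$ and $I(t)$ are $(\mathcal F_t)$-adapted, and $N$ admits the predictable $(\mathcal F_t)$-intensity $$\lambda(t)=\mu\big(t-T_{I(t-)}\big)+\int_{[0,t)}h(t-x)\,N(dx),\qquad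 t\ge0.$$ That is, $\lambda$ is nonnegative and $(\mathcal F_t)$-predictable (hence progressive), a.s. $\int_0^t\lambda(s)\,ds<\infty$ for every $t$, and $N([0,t])-\int_0^t\lambda(s)\,ds$ is an $(\mathcal F_t)$-martingale. Hence $N$ is a renewal Hawkes process with hazard function $\mu$ and offspring density $h$. Moreover, for every $(\mathcal F_t)$-predictable process $C$ with values in $[0,\infty]$, $$\mathbb E\Big[\int_{(0,\infty)}C(u)\,N(du)\Big]=\mathbb E\Big[\int_0^\infty C(u)\Big\{\mu\big(u-T_{I(u-)}\big)+\int_{[0,u)}h(u-x)\,N(dx)\Big\}\,du\Big].$$ -/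

import Mathlib

open MeasureTheory ProbabilityTheory Set
open scoped NNReal ENNReal

noncomputable section

namespace RenewalHawkes

/-- Lebesgue measure on the half-line `[0, ∞)`. -/
def leb : Measure ℝ≥0 := Measure.comap ((↑) : ℝ≥0 → ℝ) volume

/-- Locally finite counting measures on `[0, ∞)`: every bounded Borel set has
finite integer mass. -/
def IsCountingMeasure (ν : Measure ℝ≥0) : Prop :=
  ∀ B : Set ℝ≥0, MeasurableSet B → Bornology.IsBounded B → ∃ k : ℕ, ν B = k

/-- The points of a locally finite counting measure on `[0, ∞)`, in increasing order and repeated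
according to multiplicity. `nthPoint ν j` is the point number `j` (counted from `0`); it is `∞` if
`ν` has at most `j` points. -/
def nthPoint (ν : Measure ℝ≥0) (j : ℕ) : ℝ≥0∞ :=
  ⨅ (x : ℝ≥0) (_ : (j : ℝ≥0∞) < ν (Iic x)), (x : ℝ≥0∞)

/-- `ξ` is a Poisson point process on `[0, ∞)` with intensity measure `Λ`. -/
structure IsPoissonProcess {Ω : Type*} [MeasurableSpace Ω] (P : Measure Ω)
    (ξ : Ω → Measure ℝ≥0) (Λ : Measure ℝ≥0) : Prop where
  measurable : Measurable ξ
  counting : ∀ ω, IsCountingMeasure (ξ ω)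
  law : ∀ B : Set ℝ≥0, MeasurableSet B → Λ B ≠ ⊤ →
    P.map (fun ω => ξ ω B) = (poissonMeasure (Λ B).toNNReal).map (fun k : ℕ => (k : ℝ≥0∞))
  indep : ∀ (k : ℕ) (B : Fin k → Set ℝ≥0), (∀ i, MeasurableSet (B i)) →
    Pairwise (fun i j => Disjoint (B i) (B j)) → iIndepFun (fun i ω => ξ ω (B i)) P

section Intensity

variable {Ω : Type*} [m : MeasurableSpace Ω]

/-- `N` is a simple point process on `[0, ∞)`: it is the counting measure of the random points
`T 0 < T 1 < ⋯`, where `T i = ∞` means that there is no `i`-th point; it is locally finite. -/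
structure IsSimplePointProcess (P : Measure Ω) (N : Ω → Measure ℝ≥0)
    (T : ℕ → Ω → ℝ≥0∞) : Prop where
  measurable_points : ∀ i, Measurable (T i)
  strict : ∀ᵐ ω ∂P, ∀ i, T i ω ≠ ⊤ → T i ω < T (i + 1) ω
  absorbing : ∀ᵐ ω ∂P, ∀ i, T i ω = ⊤ → T (i + 1) ω = ⊤
  measurable : Measurable N
  locallyFinite : ∀ᵐ ω ∂P, IsCountingMeasure (N ω)
  eq_sum : ∀ᵐ ω ∂P, N ω = Measure.sum
    (fun i : {i : ℕ // T i ω ≠ ⊤} => Measure.dirac (T i ω).toNNReal)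

/-- `lam` is an intensity of `N` with respect to `𝓕`: `N` is adapted, and `lam` is a nonnegative
progressive process, a.s. locally integrable, such that `N([0,t]) - ∫₀ᵗ lam(s) ds` is a
martingale. -/
structure IsIntensity (P : Measure Ω) (𝓕 : Filtration ℝ≥0 m) (N : Ω → Measure ℝ≥0)
    (lam : ℝ≥0 → Ω → ℝ≥0∞) : Prop where
  adapted : Adapted 𝓕 (fun t ω => N ω (Iic t))
  progressive : IsStronglyProgressive 𝓕 lam
  locallyIntegrable : ∀ᵐ ω ∂P, ∀ t : ℝ≥0, ∫⁻ s in Iic t, lam s ω ∂leb < ⊤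
  martingale : Martingale
    (fun t ω => (N ω (Iic t)).toReal - (∫⁻ s in Iic t, lam s ω ∂leb).toReal) 𝓕 P

/-- The hazard function `f(t) / (1 - ∫₀ᵗ f(s) ds)` of a density `f` on `[0, ∞)`
(with value `0` where the denominator vanishes). -/
def hazard (f : ℝ≥0 → ℝ≥0) (t : ℝ≥0) : ℝ≥0 :=
  f t / (1 - ∫⁻ s in Iic t, (f s : ℝ≥0∞) ∂leb).toNNReal

/-- `I(t) = max {i : T i ≤ t, D i = 0}`, the index of the last immigrant up to time `t`, where the
mark `D i = 0` means that the `i`-th point is an immigrant. -/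
def lastImmigrant (T : ℕ → Ω → ℝ≥0∞) (D : ℕ → Ω → Fin 2) (t : ℝ≥0) (ω : Ω) : ℕ :=
  sSup {i | T i ω ≤ t ∧ D i ω = 0}

/-- `I(t-) = max {i : T i < t, D i = 0}`, the index of the last immigrant strictly before `t`. -/
def lastImmigrantBefore (T : ℕ → Ω → ℝ≥0∞) (D : ℕ → Ω → Fin 2) (t : ℝ≥0) (ω : Ω) : ℕ :=
  sSup {i | T i ω < t ∧ D i ω = 0}

/-- `λ(t) = μ(t - T_{I(t-)}) + ∫_{[0,t)} h(t - x) N(dx)`. -/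
def hawkesIntensity (μ h : ℝ≥0 → ℝ≥0) (N : Ω → Measure ℝ≥0) (T : ℕ → Ω → ℝ≥0∞)
    (D : ℕ → Ω → Fin 2) (t : ℝ≥0) (ω : Ω) : ℝ≥0∞ :=
  μ ((t : ℝ≥0∞) - T (lastImmigrantBefore T D t ω) ω).toNNReal
    + ∫⁻ x in Iio t, (h (t - x) : ℝ≥0∞) ∂(N ω)

/-- The point process `N` with points `T i` and immigrant/offspring marks `D i` (`0` for
immigrants, `1` for offspring) is a renewal Hawkes process with respect to the filtration `𝓕`,
with renewal density `f` and offspring density `h`. -/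
structure IsRenewalHawkesProcess (P : Measure Ω) (𝓕 : Filtration ℝ≥0 m) (N : Ω → Measure ℝ≥0)
    (T : ℕ → Ω → ℝ≥0∞) (D : ℕ → Ω → Fin 2) (f h : ℝ≥0 → ℝ≥0) : Prop where
  measurable_f : Measurable f
  density : ∫⁻ t, (f t : ℝ≥0∞) ∂leb = 1
  measurable_h : Measurable h
  subcritical : ∫⁻ t, (h t : ℝ≥0∞) ∂leb < 1
  simple : IsSimplePointProcess P N T
  measurable_marks : ∀ i, Measurable (D i)
  immigrant_exists : ∀ᵐ ω ∂P, ∀ t : ℝ≥0, 0 < t → ∃ i, T i ω < t ∧ D i ω = 0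
  adapted_lastImmigrant : Adapted 𝓕 (lastImmigrant T D)
  predictable : IsStronglyPredictable 𝓕 (hawkesIntensity (hazard f) h N T D)
  intensity : IsIntensity P 𝓕 N (hawkesIntensity (hazard f) h N T D)

end Intensity

section Construction

variable {Ω : Type*}

/-- The renewal epochs `S 0 = 0`, `S i = τ₁ + ⋯ + τᵢ` (the waiting times `τ` are indexed
from `0`). -/
def epoch (τ : ℕ → Ω → ℝ≥0) (i : ℕ) (ω : Ω) : ℝ≥0 := ∑ k ∈ Finset.range i, τ k ω

/-- Individuals are labelled by pairs `(i, u)`: `i` is the number of the immigrant from which the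
individual descends, and the list `u` is its line of descent, the most recent birth first
(`(i, j :: u)` is the `j`-th child of `(i, u)`). The process `ξ (i, u)` carries the birth times of
the children of `(i, u)` relative to the birth of `(i, u)`.
`birth τ ξ i u` is the birth time of `(i, u)`, and `∞` if there is no such individual. -/
def birth (τ : ℕ → Ω → ℝ≥0) (ξ : ℕ × List ℕ → Ω → Measure ℝ≥0) (i : ℕ) :
    List ℕ → Ω → ℝ≥0∞
  | [], ω => epoch τ i ω
  | j :: u, ω => birth τ ξ i u ω + nthPoint (ξ (i, u) ω) j

/-- The satellite process `N_s(· ∣ t)` obtained by translating `ν` to a centre at `t`. -/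
def satellite (ν : Measure ℝ≥0) (t : ℝ≥0) : Measure ℝ≥0 := ν.map (fun x => x + t)

open Classical in
/-- The process of `n`-th generation descendants of the `i`-th immigrant: generation `0` is the
immigrant, and generation `n + 1` is the superposition of the satellite processes
of all the individuals of generation `n`. -/
def descendants (τ : ℕ → Ω → ℝ≥0) (ξ : ℕ × List ℕ → Ω → Measure ℝ≥0) (i : ℕ) :
    ℕ → Ω → Measure ℝ≥0
  | 0, ω => Measure.dirac (epoch τ i ω)
  | n + 1, ω => Measure.sum (fun u : List ℕ =>
      if u.length = n ∧ birth τ ξ i u ω ≠ ⊤ then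
        satellite (ξ (i, u) ω) (birth τ ξ i u ω).toNNReal
      else 0)

/-- The complete cluster of the `i`-th immigrant (including the immigrant). -/
def cluster (τ : ℕ → Ω → ℝ≥0) (ξ : ℕ × List ℕ → Ω → Measure ℝ≥0) (i : ℕ) (ω : Ω) :
    Measure ℝ≥0 :=
  Measure.sum (fun n => descendants τ ξ i n ω)

/-- The cluster process `N`: the superposition of the clusters of all immigrants. -/
def clusterProcess (τ : ℕ → Ω → ℝ≥0) (ξ : ℕ × List ℕ → Ω → Measure ℝ≥0) (ω : Ω) :
    Measure ℝ≥0 :=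
  Measure.sum (fun i => cluster τ ξ i ω)

/-- The process of all points of generation `n`; for `n = 0` this is the renewal process. -/
def generation (τ : ℕ → Ω → ℝ≥0) (ξ : ℕ × List ℕ → Ω → Measure ℝ≥0) (n : ℕ) (ω : Ω) :
    Measure ℝ≥0 :=
  Measure.sum (fun i => descendants τ ξ i n ω)

/-- The points `T i` of the cluster process in increasing order. -/
def point (τ : ℕ → Ω → ℝ≥0) (ξ : ℕ × List ℕ → Ω → Measure ℝ≥0) (i : ℕ) (ω : Ω) : ℝ≥0∞ :=
  nthPoint (clusterProcess τ ξ ω) i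

open Classical in
/-- The mark of the `i`-th point: `0` if it is a point of the renewal process (an immigrant), and
`1` otherwise. -/
def mark (τ : ℕ → Ω → ℝ≥0) (ξ : ℕ × List ℕ → Ω → Measure ℝ≥0) (i : ℕ) (ω : Ω) : Fin 2 :=
  if ∃ k, point τ ξ i ω = epoch τ k ω then 0 else 1

/-- The σ-field generated by the counts of points of every generation in the intervals
`(a, b]`, `0 ≤ a ≤ b ≤ t`. -/
@[reducible] def naturalSigma (τ : ℕ → Ω → ℝ≥0) (ξ : ℕ × List ℕ → Ω → Measure ℝ≥0) (t : ℝ≥0) :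
    MeasurableSpace Ω :=
  ⨆ (n : ℕ) (a : ℝ≥0) (b : ℝ≥0) (_ : a ≤ b ∧ b ≤ t),
    MeasurableSpace.comap (fun ω => generation τ ξ n ω (Ioc a b)) inferInstance

/-- The augmentation of the natural filtration by the `P`-null sets: an event belongs to it at time
`t` if it coincides with an event of `naturalSigma τ ξ t` up to a `P`-null set. -/
def augmentedFiltration [m : MeasurableSpace Ω] (P : Measure Ω) (τ : ℕ → Ω → ℝ≥0)
    (ξ : ℕ × List ℕ → Ω → Measure ℝ≥0) : Filtration ℝ≥0 m where
  seq t := m ⊓ eventuallyMeasurableSpace (naturalSigma τ ξ t) (ae P)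
  mono' := by
    intro s t hst
    refine inf_le_inf_left m ?_
    rintro A ⟨B, hB, hAB⟩
    refine ⟨B, ?_, hAB⟩
    have hle : naturalSigma τ ξ s ≤ naturalSigma τ ξ t := by
      refine iSup_mono fun n => iSup_mono fun a => iSup_mono fun b => ?_
      exact iSup_le fun h => le_iSup_of_le ⟨h.1, h.2.trans hst⟩ le_rfl
    exact hle B hB
  le' _ := inf_le_left

end Construction

end RenewalHawkes

end

open RenewalHawkes

noncomputable section

namespace RenewalHawkes

/-! ### Counting measures and their points -/

/-! Label individuals by immigrant number and line of descent, and give birth time `∞` to those that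
are never born. Since `diracTop ⊤ = 0`, the cluster process is a sum of unit masses over all labels,
and its compensator can be computed one individual at a time.

Fix `s`, `r` and an event `A` of the natural σ-field at `s`. Erasing the children of an individual
`l` born after `s` does not change the history up to `s` (`history_update_truncate`). So the
indicator of `A` is a function of everything except `ξ l`, and of the part of `ξ l` seen by time
`s`. Complete independence of the Poisson process separates that part from the births in `(s, r]`,
whose mean, if `l` is born at `b`, is the integral of `h (v - b)` over `v` in `(s, r]`, `v > b`
(`lintegral_offspring`). For a waiting time the analogous erasure (`history_update_truncateWaiting`)
leaves only the information that it has not ended by `s`, and the identity `f x = hazard f x * P(τ ≥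
x)` produces the hazard term (`lintegral_epoch`). Summing over individuals gives
`lintegral_clusterProcess`.

Local finiteness holds in mean: generation `n` of a cluster has mean size at most `(∫ h) ^ n`, and
the renewal function is finite. Birth times are distinct because, given everything else, a
coincidence would put a point of a Poisson process without fixed atoms at a prescribed place. On the
resulting almost sure set (`IsRegular`) the sum over individuals is the Hawkes intensity at every `t
> 0`, since a single renewal interval contains `t`.

The intensity is predictable because its summands are functions of the time elapsed since a stopping
time, switched on strictly after it. The increment identity gives the martingale property. It also
says that the Campbell measure of the process and the measure with density the intensity agree on a
π-system generating the predictable σ-algebra, which gives the formula for predictable integrands.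
-/

/-- The unit mass at `x`, which is zero if `x = ∞`. -/
def diracTop (x : ℝ≥0∞) : Measure ℝ≥0 := if x = ⊤ then 0 else Measure.dirac x.toNNReal

lemma diracTop_top : diracTop ⊤ = 0 := if_pos rfl

lemma diracTop_coe (x : ℝ≥0) : diracTop x = Measure.dirac x := by simp [diracTop]

lemma measurableSet_coe_image {B : Set ℝ≥0} (hB : MeasurableSet B) :
    MeasurableSet ((↑) '' B : Set ℝ≥0∞) :=
  ENNReal.isOpenEmbedding_coe.measurableEmbedding.measurableSet_image.2 hB

lemma diracTop_apply (x : ℝ≥0∞) {B : Set ℝ≥0} (hB : MeasurableSet B) :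
    diracTop x B = ((↑) '' B : Set ℝ≥0∞).indicator 1 x := by
  induction x with
  | top => simp [diracTop_top]
  | coe x =>
    rw [diracTop_coe, Measure.dirac_apply' _ hB]
    by_cases hx : x ∈ B <;> simp [hx]

lemma diracTop_Iic (x : ℝ≥0∞) (a : ℝ≥0) : diracTop x (Iic a) = if x ≤ a then 1 else 0 := by
  induction x with
  | top => simp [diracTop_top]
  | coe x =>
    rw [diracTop_coe, Measure.dirac_apply' _ measurableSet_Iic]
    by_cases hx : x ≤ a <;> simp [hx]

lemma diracTop_Ioc (x : ℝ≥0∞) (a b : ℝ≥0) :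
    diracTop x (Ioc a b) = if (a : ℝ≥0∞) < x ∧ x ≤ b then 1 else 0 := by
  induction x with
  | top => simp [diracTop_top]
  | coe x =>
    rw [diracTop_coe, Measure.dirac_apply' _ measurableSet_Ioc]
    by_cases hx : a < x ∧ x ≤ b <;> simp [hx]

lemma lintegral_diracTop (x : ℝ≥0∞) {g : ℝ≥0 → ℝ≥0∞} (hg : Measurable g) :
    ∫⁻ y, g y ∂diracTop x = if x = ⊤ then 0 else g x.toNNReal := by
  unfold diracTop
  split_ifs
  · simp
  · rw [lintegral_dirac' _ hg]

lemma measurable_diracTop : Measurable diracTop := by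
  refine Measure.measurable_of_measurable_coe _ fun B hB => ?_
  simp_rw [diracTop_apply _ hB]
  exact measurable_one.indicator (measurableSet_coe_image hB)

lemma map_add_diracTop (x : ℝ≥0∞) (b : ℝ≥0) :
    (diracTop x).map (fun y => y + b) = diracTop (b + x) := by
  induction x with
  | top => simp [diracTop_top]
  | coe x =>
    rw [diracTop_coe, Measure.map_dirac' (by fun_prop), ← ENNReal.coe_add, diracTop_coe, add_comm]

lemma nthPoint_le_of_lt {ν : Measure ℝ≥0} {j : ℕ} {x : ℝ≥0} (h : (j : ℝ≥0∞) < ν (Iic x)) :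
    nthPoint ν j ≤ x := iInf₂_le x h

lemma nthPoint_mono (ν : Measure ℝ≥0) : Monotone (nthPoint ν) := by
  intro i j hij
  exact le_iInf₂ fun x hx => nthPoint_le_of_lt (lt_of_le_of_lt (Nat.cast_le.2 hij) hx)

lemma IsCountingMeasure.measure_Iic {ν : Measure ℝ≥0} (hν : IsCountingMeasure ν) (x : ℝ≥0) :
    ∃ k : ℕ, ν (Iic x) = k := hν _ measurableSet_Iic (by
      rw [← Set.Icc_bot]; exact Metric.isBounded_Icc _ _)

/-- The infimum defining `nthPoint` is attained: `ν (Iic x)` is right-continuous in `x` and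
integer-valued, hence constant on some interval to the right of `x`. -/
lemma nthPoint_le_iff {ν : Measure ℝ≥0} (hν : IsCountingMeasure ν) (j : ℕ) (x : ℝ≥0) :
    nthPoint ν j ≤ x ↔ (j : ℝ≥0∞) < ν (Iic x) := by
  refine ⟨fun h => ?_, nthPoint_le_of_lt⟩
  by_contra! hle
  have hx : Iic x = ⋂ n : ℕ, Iic (x + 1 / ((n : ℝ≥0) + 1)) := by
    ext y
    simp only [mem_Iic, mem_iInter]
    refine ⟨fun hy n => hy.trans (by simp), fun hy => ?_⟩
    refine le_of_forall_pos_le_add fun ε hε => ?_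
    obtain ⟨n, hn⟩ := exists_nat_one_div_lt hε
    exact (hy n).trans (by gcongr)
  have hmono : Antitone fun n : ℕ => Iic (x + 1 / ((n : ℝ≥0) + 1)) := by
    intro m n hmn
    refine Iic_subset_Iic.2 ?_
    gcongr
  rw [hx, hmono.measure_iInter (fun _ => measurableSet_Iic.nullMeasurableSet)
    ⟨0, by obtain ⟨k, hk⟩ := hν.measure_Iic (x + 1 / ((0 : ℕ) + 1)); rw [hk]; simp⟩] at hle
  have : ∃ n : ℕ, ν (Iic (x + 1 / ((n : ℝ≥0) + 1))) < ((j + 1 : ℕ) : ℝ≥0∞) := by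
    rw [← iInf_lt_iff]
    exact hle.trans_lt (by exact_mod_cast Nat.lt_succ_self j)
  obtain ⟨n, hn⟩ := this
  have h2 : ((x + 1 / ((n : ℝ≥0) + 1) : ℝ≥0) : ℝ≥0∞) ≤ nthPoint ν j := by
    refine le_iInf₂ fun y hy => ?_
    by_contra! hlt
    have h3 : ν (Iic y) ≤ ν (Iic (x + 1 / ((n : ℝ≥0) + 1))) :=
      measure_mono (Iic_subset_Iic.2 (by exact_mod_cast hlt.le))
    obtain ⟨k, hk⟩ := hν.measure_Iic (x + 1 / ((n : ℝ≥0) + 1))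
    have h4 := hy.trans_le h3
    rw [hk] at hn h4
    have h5 : k < j + 1 := by exact_mod_cast hn
    have h6 : j < k := by exact_mod_cast h4
    omega
  have h7 := h2.trans h
  rw [ENNReal.coe_le_coe] at h7
  have h8 : 0 < 1 / ((n : ℝ≥0) + 1) := by positivity
  exact absurd h7 (not_le.2 (lt_add_of_pos_right _ h8))

lemma measurable_nthPoint (j : ℕ) : Measurable fun ν : Measure ℝ≥0 => nthPoint ν j := by
  refine measurable_of_Iio fun c => ?_
  -- As `ν (Iic x)` increases with `x`, rational levels suffice and the uncountable infimum becomes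
  -- a countable union.
  have : (fun ν : Measure ℝ≥0 => nthPoint ν j) ⁻¹' Iio c =
      ⋃ (q : ℚ) (_ : ((Real.toNNReal q : ℝ≥0) : ℝ≥0∞) < c),
        {ν : Measure ℝ≥0 | (j : ℝ≥0∞) < ν (Iic (Real.toNNReal q))} := by
    ext ν
    simp only [mem_preimage, mem_Iio, mem_iUnion, mem_ofPred_eq, exists_prop]
    constructor
    · intro h
      obtain ⟨x, hx⟩ := iInf_lt_iff.1 h
      obtain ⟨hx1, hx2⟩ := iInf_lt_iff.1 hx
      obtain ⟨r, hr1, hr2⟩ := ENNReal.lt_iff_exists_nnreal_btwn.1 hx2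
      obtain ⟨q, -, hq1, hq2⟩ := (NNReal.lt_iff_exists_rat_btwn _ _).1 (ENNReal.coe_lt_coe.1 hr1)
      exact ⟨q, (ENNReal.coe_lt_coe.2 hq2).trans hr2,
        hx1.trans_le (measure_mono (Iic_subset_Iic.2 hq1.le))⟩
    · rintro ⟨q, hq, hν⟩
      exact (nthPoint_le_of_lt hν).trans_lt hq
  rw [this]
  exact MeasurableSet.iUnion fun q => MeasurableSet.iUnion fun _ =>
    measurableSet_lt measurable_const (Measure.measurable_coe measurableSet_Iic)

lemma tsum_ite_lt (k : ℕ) : ∑' j : ℕ, (if j < k then (1 : ℝ≥0∞) else 0) = k := by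
  rw [tsum_eq_sum (s := Finset.range k)]
  · rw [Finset.sum_congr rfl (g := fun _ => (1 : ℝ≥0∞))]
    · simp
    · intro j hj; simp [Finset.mem_range.1 hj]
  · intro j hj; simpa using hj

/-- A measure on `[0, ∞)` that is finite on bounded intervals is determined by its values on
the intervals `[0, x]`. -/
lemma measure_ext_of_Iic {μ ν : Measure ℝ≥0} (hfin : ∀ x, μ (Iic x) ≠ ⊤)
    (h : ∀ x, μ (Iic x) = ν (Iic x)) : μ = ν := by
  refine Measure.ext_of_generateFrom_of_iUnion (range Iic) (fun n : ℕ => Iic (n : ℝ≥0))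
    ?_ ?_ ?_ ?_ ?_ ?_
  · rw [BorelSpace.measurable_eq (α := ℝ≥0), borel_eq_generateFrom_Iic]
  · rintro _ ⟨a, rfl⟩ _ ⟨b, rfl⟩ -
    exact ⟨a ⊓ b, by simp⟩
  · refine eq_univ_of_forall fun x => ?_
    obtain ⟨n, hn⟩ := exists_nat_ge x
    exact mem_iUnion.2 ⟨n, hn⟩
  · exact fun n => ⟨_, rfl⟩
  · exact fun n => hfin _
  · rintro _ ⟨a, rfl⟩; exact h a

lemma eq_sum_diracTop_nthPoint {ν : Measure ℝ≥0} (hν : IsCountingMeasure ν) :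
    ν = Measure.sum fun j => diracTop (nthPoint ν j) := by
  refine measure_ext_of_Iic (fun x => ?_) fun x => ?_
  · obtain ⟨k, hk⟩ := hν.measure_Iic x
    rw [hk]; simp
  · obtain ⟨k, hk⟩ := hν.measure_Iic x
    rw [Measure.sum_apply _ measurableSet_Iic]
    simp_rw [diracTop_Iic, nthPoint_le_iff hν, hk, Nat.cast_lt]
    exact (tsum_ite_lt k).symm

/-! ### The cluster process as a sum over labels -/

section Births

variable {Ω : Type*} {τ : ℕ → Ω → ℝ≥0} {ξ : ℕ × List ℕ → Ω → Measure ℝ≥0}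

lemma satellite_eq_sum {ν : Measure ℝ≥0} (hν : IsCountingMeasure ν) (b : ℝ≥0) :
    satellite ν b = Measure.sum fun j => diracTop (b + nthPoint ν j) := by
  unfold satellite
  conv_lhs => rw [eq_sum_diracTop_nthPoint hν]
  rw [Measure.map_sum (by fun_prop)]
  simp_rw [map_add_diracTop]

lemma tsum_list_cons {g : List ℕ → ℝ≥0∞} (hg : g [] = 0) :
    ∑' w, g w = ∑' (u : List ℕ) (j : ℕ), g (j :: u) := by
  rw [← ENNReal.tsum_prod (f := fun u j => g (j :: u))]
  refine (Function.Injective.tsum_eq (g := fun q : List ℕ × ℕ => q.2 :: q.1) (f := g) ?_ ?_).symm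
  · rintro ⟨u, j⟩ ⟨u', j'⟩ h
    simp only [List.cons.injEq] at h
    exact Prod.ext h.2 h.1
  · intro w hw
    cases w with
    | nil => exact absurd hg hw
    | cons j u => exact ⟨(u, j), rfl⟩

/-- The `j`-th child of `u` is `j :: u`, so a superposition over parents of length `n` is a sum over
labels of length `n + 1`. The condition that the parent exists disappears: children of an unborn
parent have birth time `∞` and carry no mass. -/
lemma descendants_eq_sum (hξ : ∀ l ω, IsCountingMeasure (ξ l ω)) (i n : ℕ) (ω : Ω) :
    descendants τ ξ i n ω = Measure.sum fun u : List ℕ =>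
      if u.length = n then diracTop (birth τ ξ i u ω) else 0 := by
  ext B hB
  rw [Measure.sum_apply _ hB]
  cases n with
  | zero =>
    rw [tsum_eq_single []]
    · simp [descendants, birth, diracTop_coe]
    · intro u hu
      simp [hu]
  | succ n =>
    rw [descendants, Measure.sum_apply _ hB,
      tsum_list_cons (g := fun w => (if w.length = n + 1 then diracTop (birth τ ξ i w ω) else 0) B)
        (by simp)]
    refine tsum_congr fun u => ?_
    by_cases hu : u.length = n
    · by_cases hb : birth τ ξ i u ω = ⊤
      · simp [hb, birth, diracTop_top]
      · rw [if_pos ⟨hu, hb⟩, satellite_eq_sum (hξ _ _), Measure.sum_apply _ hB]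
        simp [hu, birth, ENNReal.coe_toNNReal hb]
    · simp [hu]

lemma generation_eq_sum (hξ : ∀ l ω, IsCountingMeasure (ξ l ω)) (n : ℕ) (ω : Ω) :
    generation τ ξ n ω = Measure.sum fun v : ℕ × List ℕ =>
      if v.2.length = n then diracTop (birth τ ξ v.1 v.2 ω) else 0 := by
  ext B hB
  rw [generation, Measure.sum_apply _ hB, Measure.sum_apply _ hB, ENNReal.tsum_prod']
  refine tsum_congr fun i => ?_
  rw [descendants_eq_sum hξ, Measure.sum_apply _ hB]

lemma clusterProcess_eq_sum_generation (ω : Ω) :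
    clusterProcess τ ξ ω = Measure.sum fun n => generation τ ξ n ω := by
  ext B hB
  rw [clusterProcess, Measure.sum_apply _ hB, Measure.sum_apply _ hB]
  simp_rw [cluster, generation, Measure.sum_apply _ hB]
  exact ENNReal.tsum_comm

lemma clusterProcess_eq_sum (hξ : ∀ l ω, IsCountingMeasure (ξ l ω)) (ω : Ω) :
    clusterProcess τ ξ ω = Measure.sum fun v : ℕ × List ℕ =>
      diracTop (birth τ ξ v.1 v.2 ω) := by
  ext B hB
  rw [clusterProcess_eq_sum_generation, Measure.sum_apply _ hB, Measure.sum_apply _ hB]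
  simp_rw [generation_eq_sum hξ, Measure.sum_apply _ hB]
  rw [ENNReal.tsum_comm]
  refine tsum_congr fun v => ?_
  rw [tsum_eq_single v.2.length]
  · simp
  · intro n hn
    simp [hn.symm]

end Births

/-! ### Lebesgue measure on the half-line -/

lemma leb_apply {B : Set ℝ≥0} (_ : MeasurableSet B) :
    leb B = volume ((↑) '' B : Set ℝ) :=
  (MeasurableEmbedding.subtype_coe measurableSet_Ici).comap_apply _ _

lemma leb_Ico (a b : ℝ≥0) : leb (Ico a b) = ((b - a : ℝ≥0) : ℝ≥0∞) := by
  rw [leb_apply measurableSet_Ico, NNReal.image_coe_Ico, Real.volume_Ico,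
    ENNReal.ofReal, NNReal.sub_def]

lemma leb_Icc (a b : ℝ≥0) : leb (Icc a b) = ((b - a : ℝ≥0) : ℝ≥0∞) := by
  rw [leb_apply measurableSet_Icc, NNReal.image_coe_Icc, Real.volume_Icc,
    ENNReal.ofReal, NNReal.sub_def]

lemma leb_Iic (b : ℝ≥0) : leb (Iic b) = b := by
  rw [← Icc_bot, leb_Icc]; simp

instance : NullSingletonClass leb := ⟨fun x => by rw [← Icc_self, leb_Icc]; simp⟩

instance : SigmaFinite leb := by
  refine ⟨⟨⟨fun n : ℕ => Iic (n : ℝ≥0), fun _ => trivial, fun n => ?_, ?_⟩⟩⟩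
  · rw [leb_Iic]; simp
  · refine eq_univ_of_forall fun x => ?_
    obtain ⟨n, hn⟩ := exists_nat_ge x
    exact mem_iUnion.2 ⟨n, hn⟩

lemma map_add_leb (b : ℝ≥0) : leb.map (fun x => b + x) = leb.restrict (Ici b) := by
  have h (x : ℝ≥0) : leb.map (fun x => b + x) (Iic x) = leb.restrict (Ici b) (Iic x) := by
    rw [Measure.map_apply (by fun_prop) measurableSet_Iic, Measure.restrict_apply measurableSet_Iic,
      inter_comm, Ici_inter_Iic, leb_Icc]
    by_cases hb : b ≤ x
    · rw [← leb_Iic]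
      congr 1
      ext y
      simp only [mem_preimage, mem_Iic]
      rw [le_tsub_iff_left hb]
    · rw [tsub_eq_zero_of_le (not_le.1 hb).le]
      have : (fun x => b + x) ⁻¹' Iic x = ∅ := by
        ext y
        simp only [mem_preimage, mem_Iic, mem_empty_iff_false, iff_false]
        intro hy
        exact hb (le_trans (by simp) hy)
      simp [this]
  refine measure_ext_of_Iic (fun x => ?_) h
  rw [h, Measure.restrict_apply measurableSet_Iic, inter_comm, Ici_inter_Iic, leb_Icc]
  simp

lemma lintegral_leb_add (b : ℝ≥0) {g : ℝ≥0 → ℝ≥0∞} (hg : Measurable g) :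
    ∫⁻ x, g (b + x) ∂leb = ∫⁻ v in Ici b, g v ∂leb := by
  rw [← map_add_leb, lintegral_map hg (by fun_prop)]

/-! ### Poisson processes -/

lemma lintegral_natCast_poissonMeasure (r : ℝ≥0) :
    ∫⁻ k : ℕ, (k : ℝ≥0∞) ∂poissonMeasure r = r := by
  have h1 : ∑' k : ℕ, poissonMeasure r {k} = 1 := by
    have h := measure_univ (μ := poissonMeasure r)
    rwa [← iUnion_of_singleton, measure_iUnion] at h
    · intro i j hij; simpa using hij
    · intro; simp
  rw [lintegral_countable', tsum_eq_zero_add' ENNReal.summable]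
  simp only [Nat.cast_zero, zero_mul, zero_add]
  calc ∑' k : ℕ, ((k + 1 : ℕ) : ℝ≥0∞) * poissonMeasure r {k + 1}
      = ∑' k : ℕ, r * poissonMeasure r {k} := by
        refine tsum_congr fun k => ?_
        rw [poissonMeasure_singleton, poissonMeasure_singleton, ← ENNReal.ofReal_natCast,
          ← ENNReal.ofReal_coe_nnreal, ← ENNReal.ofReal_mul (by positivity),
          ← ENNReal.ofReal_mul (by positivity), Nat.factorial_succ]
        congr 1
        push_cast
        field_simp
        exact pow_succ' _ _
    _ = r := by rw [ENNReal.tsum_mul_left, h1, mul_one]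

/-- From `exp (-r) ≥ 1 - r` one gets `1 - exp (-r) * (1 + r) ≤ r ^ 2`. The square makes double
points negligible over a fine partition in `IsPoissonProcess.ae_simple`. -/
lemma poissonMeasure_two_le (r : ℝ≥0) :
    poissonMeasure r {k | 2 ≤ k} ≤ (r : ℝ≥0∞) ^ 2 := by
  have hc : {k : ℕ | 2 ≤ k} = ({0, 1} : Set ℕ)ᶜ := by
    ext k; simp only [mem_ofPred_eq, mem_compl_iff, mem_insert_iff, mem_singleton_iff]; omega
  rw [hc, prob_compl_eq_one_sub (by measurability)]
  have h01 : poissonMeasure r {0, 1} = ENNReal.ofReal (Real.exp (-r) * (1 + r)) := by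
    rw [insert_eq, measure_union (by simp) (by measurability), poissonMeasure_singleton,
      poissonMeasure_singleton, ← ENNReal.ofReal_add (by positivity) (by positivity)]
    congr 1
    simp; ring
  rw [h01, ← ENNReal.ofReal_coe_nnreal, ← ENNReal.ofReal_pow (by positivity),
    ← ENNReal.ofReal_one, ← ENNReal.ofReal_sub _ (by positivity)]
  refine ENNReal.ofReal_le_ofReal ?_
  have h1 : 1 - (r : ℝ) ≤ Real.exp (-r) := by
    have := Real.add_one_le_exp (-(r : ℝ)); linarith
  have h2 : (1 - (r : ℝ)) * (1 + r) ≤ Real.exp (-r) * (1 + r) := by gcongr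
  nlinarith

section Poisson

variable {Ω : Type*} [MeasurableSpace Ω] {P : Measure Ω} {ξ : Ω → Measure ℝ≥0} {Λ : Measure ℝ≥0}

lemma IsPoissonProcess.measurable_apply (hξ : IsPoissonProcess P ξ Λ) {B : Set ℝ≥0}
    (hB : MeasurableSet B) : Measurable fun ω => ξ ω B :=
  (Measure.measurable_coe hB).comp hξ.measurable

lemma IsPoissonProcess.lintegral (hξ : IsPoissonProcess P ξ Λ) {B : Set ℝ≥0}
    (hB : MeasurableSet B) (hΛ : Λ B ≠ ⊤) : ∫⁻ ω, ξ ω B ∂P = Λ B := by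
  have h1 : ∫⁻ x, x ∂(P.map fun ω => ξ ω B) = ∫⁻ ω, ξ ω B ∂P :=
    lintegral_map measurable_id (hξ.measurable_apply hB)
  rw [← h1, hξ.law B hB hΛ, lintegral_map (f := fun x => x) measurable_id
    (by fun_prop), lintegral_natCast_poissonMeasure, ENNReal.coe_toNNReal hΛ]

lemma IsPoissonProcess.measure_two_le (hξ : IsPoissonProcess P ξ Λ) {B : Set ℝ≥0}
    (hB : MeasurableSet B) (hΛ : Λ B ≠ ⊤) : P {ω | 2 ≤ ξ ω B} ≤ Λ B ^ 2 := by
  have h1 : P {ω | 2 ≤ ξ ω B} = (P.map fun ω => ξ ω B) (Ici 2) := by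
    rw [Measure.map_apply (hξ.measurable_apply hB) measurableSet_Ici]; rfl
  rw [h1, hξ.law B hB hΛ, Measure.map_apply (by fun_prop) measurableSet_Ici]
  refine le_trans (le_of_eq ?_) ((poissonMeasure_two_le _).trans
    (le_of_eq (by rw [ENNReal.coe_toNNReal hΛ])))
  congr 1
  ext k
  simp only [mem_preimage, mem_Ici, mem_ofPred_eq]
  exact_mod_cast Iff.rfl

lemma IsPoissonProcess.indepFun_finite (hξ : IsPoissonProcess P ξ Λ) {κ : Type*} [Fintype κ]
    {B : κ → Set ℝ≥0} (hB : ∀ i, MeasurableSet (B i)) {S : Set ℝ≥0} (hS : MeasurableSet S)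
    (hBS : ∀ i, Disjoint (B i) S) :
    IndepFun (fun ω i => ξ ω (B i)) (fun ω => ξ ω S) P := by
  classical
  -- The atoms outside `S` of the algebra generated by the `B i` are indexed by the set `J` of those
  -- `i` whose `B i` contains the atom; `none` stands for `S`. They are disjoint, so the defining
  -- independence applies, and `B i` is the union of the atoms with `i ∈ J`.
  let A : Option (Finset κ) → Set ℝ≥0 := fun o =>
    o.elim S fun J => {x | x ∉ S} ∩ ⋂ i, {x | i ∈ J ↔ x ∈ B i}
  have hA : ∀ o, MeasurableSet (A o) := by
    rintro (_ | J)
    · exact hS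
    · refine hS.compl.inter (MeasurableSet.iInter fun i => ?_)
      by_cases hi : i ∈ J
      · simpa [hi] using hB i
      · have : {x | i ∈ J ↔ x ∈ B i} = (B i)ᶜ := by ext x; simp [hi]
        rw [this]
        exact (hB i).compl
  have hdisj : Pairwise fun o o' => Disjoint (A o) (A o') := by
    have hs (J : Finset κ) : Disjoint (A none) (A (some J)) :=
      Set.disjoint_left.2 fun x hx hx' => hx'.1 hx
    rintro (_ | J) (_ | J') h
    · exact absurd rfl h
    · exact hs J'
    · exact (hs J).symm
    · refine Set.disjoint_left.2 fun x hx hx' => h ?_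
      congr 1
      ext i
      have h1 := mem_iInter.1 hx.2 i
      have h2 := mem_iInter.1 hx'.2 i
      exact Iff.trans h1 h2.symm
  let e := Fintype.equivFin (Option (Finset κ))
  have h1 := (hξ.indep _ (fun k => A (e.symm k)) (fun k => hA _)
    (fun i j hij => hdisj fun h => hij (e.symm.injective h))).precomp e.injective
  simp only [Equiv.symm_apply_apply] at h1
  have h2 := h1.indepFun_finset (Finset.univ.erase none) {none}
    (by simp) (fun o => hξ.measurable_apply (hA o))
  have hmem : ∀ J : Finset κ, (some J) ∈ (Finset.univ.erase none : Finset (Option (Finset κ))) :=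
    fun J => by simp
  have hψ : Measurable fun z : ({none} : Finset (Option (Finset κ))) → ℝ≥0∞ =>
    z ⟨none, Finset.mem_singleton_self _⟩ := measurable_pi_apply _
  have h3 := h2.comp
    (φ := fun z i => ∑ J ∈ Finset.univ.filter (fun J : Finset κ => i ∈ J), z ⟨some J, hmem J⟩)
    (by fun_prop) hψ
  convert! h3 using 1
  funext ω i
  simp only [Function.comp]
  rw [← measure_biUnion_finset]
  · congr 1
    ext x
    simp only [mem_iUnion, Finset.mem_filter, Finset.mem_univ, true_and, exists_prop]
    constructor
    · intro hx
      exact ⟨Finset.univ.filter fun k => x ∈ B k, by simpa using hx,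
        Set.disjoint_left.1 (hBS i) hx, mem_iInter.2 fun k => by simp⟩
    · rintro ⟨J, hJ, hx⟩
      exact (mem_iInter.1 hx.2 i).1 hJ
  · exact fun J _ J' _ h => hdisj (by simpa using h)
  · exact fun J _ => hA _

/-- The masses that a Poisson process gives to the sets of an arbitrary family are independent of
the mass of a set disjoint from all of them. -/
lemma IsPoissonProcess.indepFun_family [IsProbabilityMeasure P] (hξ : IsPoissonProcess P ξ Λ)
    {ι : Type*} {B : ι → Set ℝ≥0} (hB : ∀ i, MeasurableSet (B i)) {S : Set ℝ≥0}
    (hS : MeasurableSet S) (hBS : ∀ i, Disjoint (B i) S) :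
    IndepFun (fun ω i => ξ ω (B i)) (fun ω => ξ ω S) P := by
  -- The σ-fields of finite subfamilies form a directed system, and independence passes to the
  -- supremum.
  let mF : Finset ι → MeasurableSpace Ω := fun F =>
    MeasurableSpace.comap (fun ω (i : F) => ξ ω (B i)) inferInstance
  have hm : ∀ F, mF F ≤ ‹MeasurableSpace Ω› := fun F =>
    Measurable.comap_le (f := fun ω (i : F) => ξ ω (B i))
      (measurable_pi_lambda _ fun i => hξ.measurable_apply (hB i))
  have h : Indep (⨆ F, mF F) (MeasurableSpace.comap (fun ω => ξ ω S) inferInstance) P := by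
    refine indep_iSup_of_directed_le (fun F => ?_) hm (hξ.measurable_apply hS).comap_le ?_
    · exact hξ.indepFun_finite (B := fun i : F => B i) (fun i => hB i) hS fun i => hBS i
    · classical
      have hmono : Monotone mF := by
        intro F G hFG
        have : (fun ω (i : F) => ξ ω (B i)) =
          (fun z (i : F) => z ⟨i, hFG i.2⟩) ∘ (fun ω (i : G) => ξ ω (B i)) := rfl
        simp only [mF]
        rw [this, ← MeasurableSpace.comap_comp]
        exact MeasurableSpace.comap_mono
          (measurable_pi_lambda _ fun i => measurable_pi_apply _).comap_le
      exact hmono.directed_le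
  refine indep_of_indep_of_le_left h ?_
  rw [MeasurableSpace.pi, MeasurableSpace.comap_iSup]
  refine iSup_le fun i => le_iSup_of_le {i} ?_
  rw [MeasurableSpace.comap_comp]
  have : ((fun z : ι → ℝ≥0∞ => z i) ∘ fun ω i => ξ ω (B i)) =
    (fun z => z ⟨i, Finset.mem_singleton_self i⟩) ∘
      (fun ω (j : ({i} : Finset ι)) => ξ ω (B j)) := rfl
  rw [this, ← MeasurableSpace.comap_comp]
  exact MeasurableSpace.comap_mono (measurable_pi_apply _).comap_le

/-- Keep those children that are born up to time `s`, if the parent is born at time `b`. -/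
def truncate (b : ℝ≥0∞) (s : ℝ≥0) (q : ℕ → ℝ≥0∞) (j : ℕ) : ℝ≥0∞ :=
  if b + q j ≤ s then q j else ⊤

/-- For finite `c`, the `j`-th truncated entry is at most `c` exactly when more than `j` points lie
in `Iic c ∩ {x | b + x ≤ s}`, a set disjoint from `S`. If `s < b` that set is empty and all entries
are `∞`. -/
lemma IsPoissonProcess.indepFun_truncate [IsProbabilityMeasure P] (hξ : IsPoissonProcess P ξ Λ)
    (b : ℝ≥0∞) (s : ℝ≥0) {S : Set ℝ≥0} (hS : MeasurableSet S) (hbs : ∀ x ∈ S, (s : ℝ≥0∞) < b + x) :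
    IndepFun (fun ω => truncate b s fun j => nthPoint (ξ ω) j) (fun ω => ξ ω S) P := by
  have hmS : MeasurableSet {x : ℝ≥0 | b + x ≤ s} :=
    measurableSet_le (by fun_prop) measurable_const
  have h := hξ.indepFun_family (B := fun c : ℝ≥0 => Iic c ∩ {x : ℝ≥0 | b + x ≤ s})
    (fun c => measurableSet_Iic.inter hmS) hS
    (fun c => Set.disjoint_left.2 fun x hx hx' => absurd hx.2 (not_le.2 (hbs x hx')))
  refine indep_of_indep_of_le_left h ?_
  rw [← measurable_iff_comap_le]
  refine @measurable_pi_lambda _ _ _ (_) _ _ fun j => ?_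
  refine @measurable_of_Iic ℝ≥0∞ Ω _ _ _ (_) _ _ inferInstance _ fun c => ?_
  induction c with
  | top => simp
  | coe c =>
    refine ⟨{z | (j : ℝ≥0∞) < z c}, measurableSet_lt measurable_const (measurable_pi_apply _), ?_⟩
    ext ω
    simp only [mem_preimage, mem_ofPred_eq, mem_Iic, truncate]
    have key : (if b + nthPoint (ξ ω) j ≤ s then nthPoint (ξ ω) j else ⊤) ≤ (c : ℝ≥0∞) ↔
        b + nthPoint (ξ ω) j ≤ s ∧ nthPoint (ξ ω) j ≤ c := by
      split_ifs with h <;> simp [h]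
    rw [key]
    by_cases hb : b ≤ s
    · lift b to ℝ≥0 using ne_top_of_le_ne_top ENNReal.coe_ne_top hb
      have h1 : Iic c ∩ {x : ℝ≥0 | (b : ℝ≥0∞) + x ≤ s} = Iic (min c (s - b)) := by
        ext x
        simp only [mem_inter_iff, mem_Iic, mem_ofPred_eq, le_min_iff]
        rw [le_tsub_iff_left (by exact_mod_cast hb)]
        norm_cast
      have h2 : (b : ℝ≥0∞) + nthPoint (ξ ω) j ≤ s ↔ nthPoint (ξ ω) j ≤ (s - b : ℝ≥0) := by
        rw [ENNReal.coe_sub, ENNReal.le_sub_iff_add_le_left ENNReal.coe_ne_top hb]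
      rw [h1, ← nthPoint_le_iff (hξ.counting ω), h2, ENNReal.coe_min, le_min_iff, and_comm]
    · have h1 : Iic c ∩ {x : ℝ≥0 | b + x ≤ s} = ∅ := by
        ext x
        simp only [mem_inter_iff, mem_ofPred_eq, mem_empty_iff_false, iff_false, not_and]
        exact fun _ hx => hb (le_trans (by simp) hx)
      rw [h1]
      simp only [measure_empty, not_lt_zero, false_iff, not_and]
      exact fun hx => absurd (le_self_add.trans hx) hb

lemma measure_singleton_eq_tsum {ν : Measure ℝ≥0} (hν : IsCountingMeasure ν) (x : ℝ≥0) :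
    ν {x} = ∑' j, if nthPoint ν j = x then 1 else 0 := by
  conv_lhs => rw [eq_sum_diracTop_nthPoint hν]
  rw [Measure.sum_apply _ (measurableSet_singleton x)]
  refine tsum_congr fun j => ?_
  rw [diracTop_apply _ (measurableSet_singleton x)]
  simp [indicator_apply]

lemma IsPoissonProcess.nthPoint_ne [IsProbabilityMeasure P] (hξ : IsPoissonProcess P ξ Λ)
    (x : ℝ≥0) (hx : Λ {x} = 0) (j : ℕ) : P {ω | nthPoint (ξ ω) j = x} = 0 := by
  have h0 : ∫⁻ ω, ξ ω {x} ∂P = 0 := by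
    rw [hξ.lintegral (measurableSet_singleton x) (by simp [hx]), hx]
  rw [lintegral_eq_zero_iff (hξ.measurable_apply (measurableSet_singleton x))] at h0
  refine measure_mono_null (fun ω hω => ?_) h0
  simp only [mem_ofPred_eq] at hω
  simp only [mem_compl_iff, mem_ofPred_eq, Pi.zero_apply]
  rw [measure_singleton_eq_tsum (hξ.counting ω)]
  intro h
  have := ENNReal.tsum_eq_zero.1 h j
  simp [hω] at this

/-- A Poisson process with absolutely continuous finite intensity has no multiple points. -/
lemma IsPoissonProcess.ae_simple [IsProbabilityMeasure P] {h : ℝ≥0 → ℝ≥0∞}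
    (hfin : ∫⁻ t, h t ∂leb ≠ ⊤) (hξ : IsPoissonProcess P ξ (leb.withDensity h)) :
    ∀ᵐ ω ∂P, ∀ i j, i ≠ j → nthPoint (ξ ω) i ≠ ⊤ → nthPoint (ξ ω) i ≠ nthPoint (ξ ω) j := by
  rw [ae_iff]
  set D := {ω | ¬ ∀ i j, i ≠ j → nthPoint (ξ ω) i ≠ ⊤ → nthPoint (ξ ω) i ≠ nthPoint (ξ ω) j}
  set Λ := leb.withDensity h
  have hΛfin : Λ univ ≠ ⊤ := by rwa [withDensity_apply _ MeasurableSet.univ, setLIntegral_univ]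
  have hΛB (B : Set ℝ≥0) : Λ B ≠ ⊤ := ne_top_of_le_ne_top hΛfin (measure_mono (subset_univ _))
  -- Cut the half-line into intervals of length `1 / n`, each of intensity at most `ε`. A multiple
  -- point puts two points into one interval, with probability at most `Λ (I k) ^ 2 ≤ ε * Λ (I k)`;
  -- then sum over `k`.
  have key : ∀ ε : ℝ≥0, 0 < ε → P D ≤ ε * Λ univ := by
    intro ε hε
    obtain ⟨δ, hδ, hδ'⟩ := exists_pos_setLIntegral_lt_of_measure_lt hfin
      (ε := ε) (by exact_mod_cast hε.ne')
    obtain ⟨n, hn⟩ := ENNReal.exists_inv_nat_lt hδ.ne'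
    have hn0 : n ≠ 0 := by
      rintro rfl
      simp at hn
    let I : ℕ → Set ℝ≥0 := fun k => Ico ((k : ℝ≥0) / n) ((k + 1 : ℝ≥0) / n)
    have hI : ∀ k, MeasurableSet (I k) := fun k => measurableSet_Ico
    have hdisj : Pairwise fun k k' => Disjoint (I k) (I k') := by
      have : ∀ k k' x, x ∈ I k → x ∈ I k' → k ≤ k' := by
        intro k k' x hx hx'
        have h1 := hx.1.trans_lt hx'.2
        have hn' : (0 : ℝ≥0) < n := by positivity
        rw [div_lt_div_iff_of_pos_right hn'] at h1
        have h2 : k < k' + 1 := by exact_mod_cast h1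
        omega
      exact fun k k' hne => Set.disjoint_left.2 fun x hx hx' =>
        hne (le_antisymm (this _ _ x hx hx') (this _ _ x hx' hx))
    have hsmall : ∀ k, Λ (I k) ≤ ε := by
      intro k
      rw [withDensity_apply _ (hI k)]
      refine (hδ' _ ?_).le
      rw [leb_Ico, ← NNReal.sub_div, add_tsub_cancel_left, one_div, ENNReal.coe_inv (by positivity)]
      simpa using hn
    have hsub : D ⊆ ⋃ k, {ω | 2 ≤ ξ ω (I k)} := by
      intro ω hω
      simp only [D, mem_ofPred_eq, not_forall, not_not] at hω
      obtain ⟨i, j, hij, hi, he⟩ := hω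
      obtain ⟨x, hx⟩ : ∃ x : ℝ≥0, (x : ℝ≥0∞) = nthPoint (ξ ω) i := ⟨_, ENNReal.coe_toNNReal hi⟩
      refine mem_iUnion.2 ⟨⌊x * n⌋₊, ?_⟩
      have hn' : (0 : ℝ≥0) < n := by positivity
      have hxI : x ∈ I ⌊x * n⌋₊ := by
        refine ⟨?_, ?_⟩
        · rw [div_le_iff₀ hn']; exact Nat.floor_le (by positivity)
        · rw [lt_div_iff₀ hn']; exact Nat.lt_floor_add_one _
      refine le_trans ?_ (measure_mono (singleton_subset_iff.2 hxI))
      rw [measure_singleton_eq_tsum (hξ.counting ω)]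
      refine le_trans ?_ (ENNReal.sum_le_tsum {i, j})
      rw [Finset.sum_pair hij, if_pos hx.symm, if_pos (he ▸ hx.symm)]
      norm_num
    calc P D ≤ ∑' k, P {ω | 2 ≤ ξ ω (I k)} := (measure_mono hsub).trans (measure_iUnion_le _)
      _ ≤ ∑' k, ε * Λ (I k) := by
        refine ENNReal.tsum_le_tsum fun k => (hξ.measure_two_le (hI k) (hΛB _)).trans ?_
        rw [sq]
        gcongr
        exact hsmall k
      _ = ε * Λ (⋃ k, I k) := by rw [ENNReal.tsum_mul_left, measure_iUnion hdisj hI]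
      _ ≤ ε * Λ univ := by gcongr; exact subset_univ _
  by_contra hne
  by_cases h0 : Λ univ = 0
  · exact hne (le_antisymm ((key 1 one_pos).trans (by simp [h0])) zero_le)
  -- With this value of `ε` the bound reads `P D ≤ P D / 2`.
  · have h1 : P D / (Λ univ) / 2 ≠ 0 := by
      simp [hne, hΛfin]
    have h1' : P D / (Λ univ) / 2 ≠ ⊤ :=
      ENNReal.div_ne_top (ENNReal.div_ne_top (measure_ne_top _ _) h0) (by simp)
    have h2 := key (P D / (Λ univ) / 2).toNNReal (ENNReal.toNNReal_pos h1 h1')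
    rw [ENNReal.coe_toNNReal h1'] at h2
    have h3 : P D / Λ univ / 2 * Λ univ = P D / 2 := by
      rw [div_eq_mul_inv, div_eq_mul_inv, div_eq_mul_inv, mul_right_comm _ _ (Λ univ),
        mul_assoc (P D), ENNReal.inv_mul_cancel h0 hΛfin, mul_one]
    rw [h3] at h2
    exact absurd h2 (not_le.2 (ENNReal.half_lt_self hne (measure_ne_top _ _)))

end Poisson

/-! ### Birth times as functions of the waiting times and of the relative birth times -/

/-- The birth time of `(i, u)` as a function of the waiting times `t` and of the times `p` between
the birth of an individual and the births of its children. -/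
def birthOf (t : ℕ → ℝ≥0) (p : ℕ × List ℕ → ℕ → ℝ≥0∞) (i : ℕ) : List ℕ → ℝ≥0∞
  | [] => ((∑ k ∈ Finset.range i, t k : ℝ≥0) : ℝ≥0∞)
  | j :: u => birthOf t p i u + p (i, u) j

lemma birth_eq_birthOf {Ω : Type*} (τ : ℕ → Ω → ℝ≥0) (ξ : ℕ × List ℕ → Ω → Measure ℝ≥0) (i : ℕ)
    (u : List ℕ) (ω : Ω) :
    birth τ ξ i u ω = birthOf (fun k => τ k ω) (fun l j => nthPoint (ξ l ω) j) i u := by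
  induction u with
  | nil => rfl
  | cons j u ih => rw [birth, birthOf, ih]

lemma measurable_birthOf (i : ℕ) (u : List ℕ) :
    Measurable fun y : (ℕ → ℝ≥0) × (ℕ × List ℕ → ℕ → ℝ≥0∞) => birthOf y.1 y.2 i u := by
  induction u with
  | nil => simp only [birthOf]; fun_prop
  | cons j u ih => simp only [birthOf]; fun_prop

/-- The birth time of `u` involves only the offspring processes of its proper ancestors, whose lists
are strictly shorter than `u`; the list of `l` is too long for that. -/
lemma birthOf_update_children (t : ℕ → ℝ≥0) (p : ℕ × List ℕ → ℕ → ℝ≥0∞) (l : ℕ × List ℕ)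
    (q : ℕ → ℝ≥0∞) (i : ℕ) {u : List ℕ} (hu : u.length ≤ l.2.length) :
    birthOf t (Function.update p l q) i u = birthOf t p i u := by
  induction u with
  | nil => rfl
  | cons j u ih =>
    rw [List.length_cons] at hu
    have hne : (i, u) ≠ l := by
      rintro rfl
      simp only at hu
      omega
    rw [birthOf, birthOf, ih (by omega), Function.update_of_ne hne]

/-- The birth times up to time `s`; later birth times are replaced by `∞`. -/
def history (s : ℝ≥0) (t : ℕ → ℝ≥0) (p : ℕ × List ℕ → ℕ → ℝ≥0∞) (v : ℕ × List ℕ) : ℝ≥0∞ :=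
  if birthOf t p v.1 v.2 ≤ s then birthOf t p v.1 v.2 else ⊤

lemma measurable_history (s : ℝ≥0) :
    Measurable fun y : (ℕ → ℝ≥0) × (ℕ × List ℕ → ℕ → ℝ≥0∞) => history s y.1 y.2 := by
  refine measurable_pi_lambda _ fun v => ?_
  exact Measurable.ite (measurableSet_le (measurable_birthOf _ _) measurable_const)
    (measurable_birthOf _ _) measurable_const

lemma history_congr {s : ℝ≥0} {t t' : ℕ → ℝ≥0} {p p' : ℕ × List ℕ → ℕ → ℝ≥0∞}
    (h : ∀ i u, birthOf t' p' i u = birthOf t p i u ∨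
      (s < birthOf t' p' i u ∧ s < birthOf t p i u)) : history s t' p' = history s t p := by
  funext v
  unfold history
  rcases h v.1 v.2 with h | h
  · rw [h]
  · rw [if_neg (not_le.2 h.1), if_neg (not_le.2 h.2)]

/-- The history up to time `s` does not depend on the children born after time `s`. -/
lemma history_update_truncate (s : ℝ≥0) (t : ℕ → ℝ≥0) (p : ℕ × List ℕ → ℕ → ℝ≥0∞)
    (l : ℕ × List ℕ) :
    history s t (Function.update p l (truncate (birthOf t p l.1 l.2) s (p l))) =
      history s t p := by
  refine history_congr fun i u => ?_
  -- Along a line of descent either nothing has changed so far, or both birth times exceed `s` and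
  -- remain beyond it, since descendants are not born earlier.
  induction u with
  | nil => exact Or.inl rfl
  | cons j u ih =>
    rw [birthOf, birthOf]
    by_cases hl : (i, u) = l
    · subst hl
      rw [birthOf_update_children _ _ _ _ _ le_rfl, Function.update_self, truncate]
      split_ifs with h
      · exact Or.inl rfl
      · exact Or.inr ⟨by simp, not_le.1 h⟩
    · rw [Function.update_of_ne hl]
      rcases ih with h | h
      · exact Or.inl (by rw [h])
      · exact Or.inr ⟨h.1.trans_le le_self_add, h.2.trans_le le_self_add⟩

/-- The waiting time `x` after an epoch at `b`, replaced by `s + 1` if the next epoch is after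
time `s`. -/
def truncateWaiting (b s x : ℝ≥0) : ℝ≥0 := if b + x ≤ s then x else s + 1

/-- The history up to time `s` does not depend on the waiting times that end after time `s`. -/
lemma history_update_truncateWaiting (s : ℝ≥0) (t : ℕ → ℝ≥0) (p : ℕ × List ℕ → ℕ → ℝ≥0∞) (i : ℕ) :
    history s (Function.update t i (truncateWaiting (∑ k ∈ Finset.range i, t k) s (t i))) p =
      history s t p := by
  rw [truncateWaiting]
  split_ifs with h
  · rw [Function.update_eq_self]
  refine history_congr fun k u => ?_
  induction u with
  | nil =>
    simp only [birthOf, ENNReal.coe_lt_coe, ENNReal.coe_inj]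
    by_cases hk : k ≤ i
    · left
      refine Finset.sum_congr rfl fun j hj => Function.update_of_ne ?_ _ _
      have := Finset.mem_range.1 hj
      omega
    · right
      have hsub : Finset.range (i + 1) ⊆ Finset.range k := Finset.range_subset_range.2 (by omega)
      constructor
      · refine lt_of_lt_of_le ?_ (Finset.single_le_sum_of_canonicallyOrdered
          (Finset.mem_range.2 (show i < k by omega)))
        rw [Function.update_self]
        exact lt_add_one s
      · refine lt_of_lt_of_le (not_le.1 h) ?_
        rw [← Finset.sum_range_succ]
        exact Finset.sum_le_sum_of_subset hsub
  | cons j u ih =>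
    rw [birthOf, birthOf]
    rcases ih with h | h
    · exact Or.inl (by rw [h])
    · exact Or.inr ⟨h.1.trans_le le_self_add, h.2.trans_le le_self_add⟩

/-! ### Events of the natural σ-field as events of the history -/

section NaturalSigma

variable {Ω : Type*} {τ : ℕ → Ω → ℝ≥0} {ξ : ℕ × List ℕ → Ω → Measure ℝ≥0}

/-- The history of the cluster process up to time `s`. -/
def historyProcess (τ : ℕ → Ω → ℝ≥0) (ξ : ℕ × List ℕ → Ω → Measure ℝ≥0) (s : ℝ≥0) (ω : Ω) :
    ℕ × List ℕ → ℝ≥0∞ :=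
  history s (fun k => τ k ω) (fun l j => nthPoint (ξ l ω) j)

/-- A count in `(a, b]` with `b ≤ s` depends only on birth times up to `s`, which the history
retains. The inclusion may be strict, because the history also records labels; only this direction
is needed. -/
lemma naturalSigma_le_comap (hξ : ∀ l ω, IsCountingMeasure (ξ l ω)) (s : ℝ≥0) :
    naturalSigma τ ξ s ≤ MeasurableSpace.comap (historyProcess τ ξ s) inferInstance := by
  refine iSup_le fun n => iSup_le fun a => iSup_le fun b => iSup_le fun hab => ?_
  have h : (fun ω => generation τ ξ n ω (Ioc a b)) =
      (fun z : ℕ × List ℕ → ℝ≥0∞ => ∑' v : ℕ × List ℕ,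
        if v.2.length = n ∧ (a < z v ∧ z v ≤ b) then 1 else 0) ∘ historyProcess τ ξ s := by
    funext ω
    rw [generation_eq_sum hξ, Measure.sum_apply _ measurableSet_Ioc]
    refine tsum_congr fun v => ?_
    by_cases hv : v.2.length = n
    · simp only [hv, if_true, diracTop_Ioc, true_and]
      refine if_congr ?_ rfl rfl
      rw [historyProcess, history, birth_eq_birthOf]
      split_ifs with h
      · rfl
      · have h1 : ¬ birthOf (fun k => τ k ω) (fun l j => nthPoint (ξ l ω) j) v.1 v.2 ≤ b :=
          fun h2 => h (h2.trans (by exact_mod_cast hab.2))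
        simp [h1]
    · simp [hv]
  rw [h, ← MeasurableSpace.comap_comp]
  refine MeasurableSpace.comap_mono ?_
  rw [← measurable_iff_comap_le]
  refine Measurable.tsum fun v => ?_
  by_cases hv : v.2.length = n
  · simp only [hv, true_and]
    exact Measurable.ite ((measurableSet_lt measurable_const (measurable_pi_apply v)).inter
      (measurableSet_le (measurable_pi_apply v) measurable_const)) measurable_const measurable_const
  · simp [hv]

end NaturalSigma

/-! ### Freezing and regrouping independent variables -/

section Independence

variable {Ω : Type*} [MeasurableSpace Ω] {P : Measure Ω}

/-- The joint law is a product, so `Y` can be frozen while `Z` is integrated out. This replaces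
conditioning on `Y`. -/
lemma lintegral_comp_of_indepFun [IsProbabilityMeasure P] {α β : Type*} [MeasurableSpace α]
    [MeasurableSpace β] {Y : Ω → α} {Z : Ω → β} (hYZ : IndepFun Y Z P) (hY : Measurable Y)
    (hZ : Measurable Z) {g : α → β → ℝ≥0∞} (hg : Measurable (Function.uncurry g)) :
    ∫⁻ ω, g (Y ω) (Z ω) ∂P = ∫⁻ ω', ∫⁻ ω, g (Y ω') (Z ω) ∂P ∂P := by
  have h1 : ∫⁻ ω, g (Y ω) (Z ω) ∂P =
      ∫⁻ y, Function.uncurry g y ∂(P.map fun ω => (Y ω, Z ω)) :=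
    (lintegral_map hg (hY.prodMk hZ)).symm
  have : IsProbabilityMeasure (P.map Z) := Measure.isProbabilityMeasure_map hZ.aemeasurable
  rw [h1, (indepFun_iff_map_prod_eq_prod_map_map hY.aemeasurable hZ.aemeasurable).1 hYZ,
    lintegral_prod _ hg.aemeasurable, lintegral_map hg.lintegral_prod_right' hY]
  refine lintegral_congr fun ω' => ?_
  exact lintegral_map (hg.comp measurable_prodMk_left) hZ

/-- The product formula is checked on the π-system of events `Z ∈ A, Y ∈ B`. The lemma serves to
separate one source of randomness `X` from all the others. -/
lemma indepFun_prodMk_of_indepFun [IsProbabilityMeasure P] {α β γ : Type*} [MeasurableSpace α]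
    [MeasurableSpace β] [MeasurableSpace γ] {X : Ω → α} {Y : Ω → β} {Z : Ω → γ}
    (hXY : IndepFun X Y P) (hZ : IndepFun Z (fun ω => (X ω, Y ω)) P) (hXm : Measurable X)
    (hYm : Measurable Y) (hZm : Measurable Z) : IndepFun (fun ω => (Z ω, Y ω)) X P := by
  refine IndepSets.indep (p1 := {s | ∃ A B, MeasurableSet A ∧ MeasurableSet B ∧
      s = Z ⁻¹' A ∩ Y ⁻¹' B}) (p2 := {s | ∃ C, MeasurableSet C ∧ s = X ⁻¹' C})
      (hZm.prodMk hYm).comap_le hXm.comap_le ?_ ?_ ?_ ?_ ?_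
  · rintro _ ⟨A, B, hA, hB, rfl⟩ _ ⟨A', B', hA', hB', rfl⟩ -
    refine ⟨A ∩ A', B ∩ B', hA.inter hA', hB.inter hB', ?_⟩
    rw [preimage_inter, preimage_inter, inter_inter_inter_comm]
  · rintro _ ⟨A, hA, rfl⟩ _ ⟨A', hA', rfl⟩ -
    exact ⟨A ∩ A', hA.inter hA', rfl⟩
  · rw [← generateFrom_prod, MeasurableSpace.comap_generateFrom]
    congr 1
    ext s
    constructor
    · rintro ⟨_, ⟨A, hA, B, hB, rfl⟩, rfl⟩
      exact ⟨A, B, hA, hB, rfl⟩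
    · rintro ⟨A, B, hA, hB, rfl⟩
      exact ⟨A ×ˢ B, ⟨A, hA, B, hB, rfl⟩, rfl⟩
  · refine le_antisymm ?_ (MeasurableSpace.generateFrom_le ?_)
    · rintro _ ⟨C, hC, rfl⟩
      exact MeasurableSpace.measurableSet_generateFrom ⟨C, hC, rfl⟩
    · rintro _ ⟨C, hC, rfl⟩
      exact ⟨C, hC, rfl⟩
  · rw [IndepSets_iff]
    rintro _ _ ⟨A, B, hA, hB, rfl⟩ ⟨C, hC, rfl⟩
    have e1 := (indepFun_iff_measure_inter_preimage_eq_mul.1 hZ) A (C ×ˢ B) hA (hC.prod hB)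
    have e2 := (indepFun_iff_measure_inter_preimage_eq_mul.1 hZ) A (univ ×ˢ B) hA
      (MeasurableSet.univ.prod hB)
    have e3 := (indepFun_iff_measure_inter_preimage_eq_mul.1 hXY) C B hC hB
    have p1 : (fun ω => (X ω, Y ω)) ⁻¹' C ×ˢ B = X ⁻¹' C ∩ Y ⁻¹' B := rfl
    have p2 : (fun ω => (X ω, Y ω)) ⁻¹' univ ×ˢ B = Y ⁻¹' B := by ext; simp
    rw [p1, e3] at e1
    rw [p2] at e2
    rw [inter_assoc, inter_comm (Y ⁻¹' B), e1, e2]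
    ring

lemma indepFun_update {ι β : Type*} [DecidableEq ι] [MeasurableSpace β]
    {X : ι → Ω → β} (hX : iIndepFun X P) (hXm : ∀ i, Measurable (X i)) (i : ι) (c : β) :
    IndepFun (X i) (fun ω => Function.update (fun j => X j ω) i c) P := by
  have h := indep_iSup_of_disjoint (fun j => (hXm j).comap_le) hX
    (S := {i}) (T := {i}ᶜ) disjoint_compl_right
  refine indep_of_indep_of_le_left (indep_of_indep_of_le_right h ?_) (by simp)
  rw [MeasurableSpace.pi, MeasurableSpace.comap_iSup]
  refine iSup_le fun j => ?_
  rw [MeasurableSpace.comap_comp]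
  by_cases hj : j = i
  · subst hj
    have : ((fun b : ι → β => b j) ∘ fun ω => Function.update (fun j => X j ω) j c) =
      fun _ => c := by funext ω; simp
    rw [this, MeasurableSpace.comap_const]
    exact bot_le
  · have : ((fun b : ι → β => b j) ∘ fun ω => Function.update (fun j => X j ω) i c) = X j := by
      funext ω; simp [hj]
    rw [this]
    exact le_iSup₂_of_le j hj le_rfl

end Independence

/-! ### The mean number of children and of immigrants in an interval, given the past -/

/-- `φ(v - b)` after time `b`, and `0` up to time `b`. -/
def shifted (φ : ℝ≥0 → ℝ≥0∞) (b : ℝ≥0∞) (v : ℝ≥0) : ℝ≥0∞ :=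
  if b < v then φ (v - b.toNNReal) else 0

lemma measurable_shifted {φ : ℝ≥0 → ℝ≥0∞} (hφ : Measurable φ) :
    Measurable fun y : ℝ≥0∞ × ℝ≥0 => shifted φ y.1 y.2 :=
  Measurable.ite (measurableSet_lt (by fun_prop) (by fun_prop)) (by fun_prop) measurable_const

lemma measurableSet_shift (b : ℝ≥0∞) (s r : ℝ≥0) :
    MeasurableSet {x : ℝ≥0 | s < b + x ∧ b + x ≤ r} :=
  MeasurableSet.inter (s₁ := {x : ℝ≥0 | (s : ℝ≥0∞) < b + x}) (s₂ := {x : ℝ≥0 | b + x ≤ r})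
    (measurableSet_lt (by fun_prop) (by fun_prop)) (measurableSet_le (by fun_prop) (by fun_prop))

/-- Substitute `v = b + x`. The image is `[b, ∞)`, whereas `shifted` also vanishes at `v = b`; the
strict inequality, wanted for predictability, costs only a null set. -/
lemma setLIntegral_shift {φ : ℝ≥0 → ℝ≥0∞} (hφ : Measurable φ) (b : ℝ≥0∞) (s r : ℝ≥0) :
    ∫⁻ x in {x : ℝ≥0 | s < b + x ∧ b + x ≤ r}, φ x ∂leb =
      ∫⁻ v in Ioc s r, shifted φ b v ∂leb := by
  induction b with
  | top => simp [shifted]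
  | coe b =>
    have hset : {x : ℝ≥0 | (s : ℝ≥0∞) < b + x ∧ (b : ℝ≥0∞) + x ≤ r} =
        (fun x => b + x) ⁻¹' Ioc s r := by
      ext x
      simp only [mem_ofPred_eq, mem_preimage, mem_Ioc]
      norm_cast
    have hg : Measurable ((Ioc s r).indicator fun v => φ (v - b)) :=
      Measurable.indicator (by fun_prop) measurableSet_Ioc
    have hae : ∀ᵐ v ∂leb, v ≠ b := by simp [ae_iff]
    rw [hset, ← lintegral_indicator (measurableSet_Ioc.preimage (by fun_prop))]
    calc ∫⁻ x, ((fun x => b + x) ⁻¹' Ioc s r).indicator φ x ∂leb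
        = ∫⁻ x, (Ioc s r).indicator (fun v => φ (v - b)) (b + x) ∂leb := by
          refine lintegral_congr fun x => ?_
          by_cases hx : b + x ∈ Ioc s r
          · rw [indicator_of_mem hx, indicator_of_mem (by exact hx), add_tsub_cancel_left]
          · rw [indicator_of_notMem hx, indicator_of_notMem (by exact hx)]
      _ = ∫⁻ v in Ici b, (Ioc s r).indicator (fun v => φ (v - b)) v ∂leb := lintegral_leb_add b hg
      _ = _ := by
          rw [← lintegral_indicator measurableSet_Ici, ← lintegral_indicator measurableSet_Ioc]
          refine lintegral_congr_ae ?_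
          filter_upwards [hae] with v hv
          simp only [indicator_apply, mem_Ici, shifted, ENNReal.coe_lt_coe, ENNReal.toNNReal_coe]
          by_cases h1 : b ≤ v
          · simp [h1, lt_of_le_of_ne h1 (Ne.symm hv)]
          · simp [h1, not_lt.2 (not_le.1 h1).le]

section Children

variable {Ω α : Type*} [MeasurableSpace Ω] [MeasurableSpace α] {P : Measure Ω}
  {ξ : Ω → Measure ℝ≥0} {h : ℝ≥0 → ℝ≥0∞} {Y : Ω → α}

lemma measure_shift_eq_tsum {ν : Measure ℝ≥0} (hν : IsCountingMeasure ν) (b : ℝ≥0∞) (s r : ℝ≥0) :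
    ν {x : ℝ≥0 | s < b + x ∧ b + x ≤ r} =
      ∑' j, diracTop (b + nthPoint ν j) (Ioc s r) := by
  classical
  conv_lhs => rw [eq_sum_diracTop_nthPoint hν]
  rw [Measure.sum_apply _ (measurableSet_shift b s r)]
  refine tsum_congr fun j => ?_
  rw [diracTop_apply _ (measurableSet_shift b s r), diracTop_Ioc, indicator_apply]
  refine if_congr ?_ rfl rfl
  constructor
  · rintro ⟨x, hx, hxj⟩
    rwa [← hxj]
  · intro hx
    have hne : nthPoint ν j ≠ ⊤ := by
      intro htop
      rw [htop] at hx
      simp at hx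
    exact ⟨(nthPoint ν j).toNNReal, by simpa [ENNReal.coe_toNNReal hne] using hx,
      ENNReal.coe_toNNReal hne⟩

lemma measurable_diracTop_apply {B : Set ℝ≥0} (hB : MeasurableSet B) :
    Measurable fun x => diracTop x B := (Measure.measurable_coe hB).comp measurable_diracTop

lemma measurable_truncate (s : ℝ≥0) :
    Measurable fun y : ℝ≥0∞ × (ℕ → ℝ≥0∞) => truncate y.1 s y.2 :=
  measurable_pi_lambda _ fun _ =>
    Measurable.ite (measurableSet_le (by fun_prop) measurable_const) (by fun_prop) measurable_const

lemma measurable_points : Measurable fun (ν : Measure ℝ≥0) j => nthPoint ν j :=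
  measurable_pi_lambda _ fun j => measurable_nthPoint j

/-- Given what is known at time `s`, the mean number of children born between `s` and `r` to an
individual born at time `b(Y)` is the integral of the shifted offspring density. -/
lemma IsPoissonProcess.lintegral_children [IsProbabilityMeasure P] (hh : Measurable h)
    (hfin : ∫⁻ t, h t ∂leb ≠ ⊤) (hξ : IsPoissonProcess P ξ (leb.withDensity h))
    (hY : Measurable Y) (hYξ : IndepFun Y ξ P) {b : α → ℝ≥0∞} (hb : Measurable b)
    {φ : α × (ℕ → ℝ≥0∞) → ℝ≥0∞} (hφ : Measurable φ) (s r : ℝ≥0) :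
    ∫⁻ ω, φ (Y ω, truncate (b (Y ω)) s fun j => nthPoint (ξ ω) j) *
        ∑' j, diracTop (b (Y ω) + nthPoint (ξ ω) j) (Ioc s r) ∂P =
      ∫⁻ ω, φ (Y ω, truncate (b (Y ω)) s fun j => nthPoint (ξ ω) j) *
        ∫⁻ v in Ioc s r, shifted h (b (Y ω)) v ∂leb ∂P := by
  have hΛB (B : Set ℝ≥0) : leb.withDensity h B ≠ ⊤ := by
    refine ne_top_of_le_ne_top hfin ((measure_mono (subset_univ B)).trans ?_)
    rw [withDensity_apply _ MeasurableSet.univ, setLIntegral_univ]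
  have m1 : Measurable (Function.uncurry fun (y : α) (ν : Measure ℝ≥0) =>
      φ (y, truncate (b y) s fun j => nthPoint ν j)) := by
    refine hφ.comp (measurable_fst.prodMk ?_)
    exact (measurable_truncate s).comp
      ((hb.comp measurable_fst).prodMk (measurable_points.comp measurable_snd))
  have m2 : Measurable (Function.uncurry fun (y : α) (ν : Measure ℝ≥0) =>
      ∑' j, diracTop (b y + nthPoint ν j) (Ioc s r)) := by
    refine Measurable.tsum fun j => (measurable_diracTop_apply measurableSet_Ioc).comp ?_
    exact (hb.comp measurable_fst).add ((measurable_nthPoint j).comp measurable_snd)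
  have m3 : Measurable (Function.uncurry fun (y : α) (_ : Measure ℝ≥0) =>
      ∫⁻ v in Ioc s r, shifted h (b y) v ∂leb) := by
    have : Measurable fun b : ℝ≥0∞ => ∫⁻ v in Ioc s r, shifted h b v ∂leb :=
      (measurable_shifted hh).lintegral_prod_right'
    exact (this.comp hb).comp measurable_fst
  rw [lintegral_comp_of_indepFun hYξ hY hξ.measurable (g := fun y ν =>
      φ (y, truncate (b y) s fun j => nthPoint ν j) *
        ∑' j, diracTop (b y + nthPoint ν j) (Ioc s r)) (m1.mul m2),
    lintegral_comp_of_indepFun hYξ hY hξ.measurable (g := fun y ν =>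
      φ (y, truncate (b y) s fun j => nthPoint ν j) *
        ∫⁻ v in Ioc s r, shifted h (b y) v ∂leb) (m1.mul m3)]
  refine lintegral_congr fun ω' => ?_
  simp_rw [← measure_shift_eq_tsum (hξ.counting _)]
  -- With `Y` frozen, the first factor sees only children born up to `s` and the second only those
  -- born in `(s, r]`, so the mean of the product factorizes.
  have hind := hξ.indepFun_truncate (b (Y ω')) s (measurableSet_shift (b (Y ω')) s r)
    fun x hx => hx.1
  have hind' := hind.comp (φ := fun q => φ (Y ω', q)) (hφ.comp measurable_prodMk_left)
    measurable_id
  have m4 : Measurable fun ω => φ (Y ω', truncate (b (Y ω')) s fun j => nthPoint (ξ ω) j) :=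
    m1.comp (measurable_const.prodMk hξ.measurable)
  rw [lintegral_mul_eq_lintegral_mul_lintegral_of_indepFun'' m4.aemeasurable
    (hξ.measurable_apply (measurableSet_shift _ s r)).aemeasurable hind',
    lintegral_mul_const _ m4, hξ.lintegral (measurableSet_shift _ s r) (hΛB _),
    withDensity_apply _ (measurableSet_shift _ s r), setLIntegral_shift hh]

/-- A parent born after `r` has no children by time `r`; any other has at most its whole offspring,
of mean `∫ h`. -/
lemma IsPoissonProcess.lintegral_children_le [IsProbabilityMeasure P]
    (hfin : ∫⁻ t, h t ∂leb ≠ ⊤) (hξ : IsPoissonProcess P ξ (leb.withDensity h)) {b : Ω → ℝ≥0∞}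
    (hb : Measurable b) (hbξ : IndepFun b ξ P) (r : ℝ≥0) :
    ∫⁻ ω, ∑' j, diracTop (b ω + nthPoint (ξ ω) j) (Iic r) ∂P ≤
      (∫⁻ t, h t ∂leb) * ∫⁻ ω, diracTop (b ω) (Iic r) ∂P := by
  classical
  have hΛu : leb.withDensity h univ = ∫⁻ t, h t ∂leb := by
    rw [withDensity_apply _ MeasurableSet.univ, setLIntegral_univ]
  have hΛB (B : Set ℝ≥0) : leb.withDensity h B ≠ ⊤ :=
    ne_top_of_le_ne_top hfin ((measure_mono (subset_univ B)).trans hΛu.le)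
  have m2 : Measurable (Function.uncurry fun (y : ℝ≥0∞) (ν : Measure ℝ≥0) =>
      ∑' j, diracTop (y + nthPoint ν j) (Iic r)) := by
    refine Measurable.tsum fun j => (measurable_diracTop_apply measurableSet_Iic).comp ?_
    exact measurable_fst.add ((measurable_nthPoint j).comp measurable_snd)
  rw [lintegral_comp_of_indepFun hbξ hb hξ.measurable (g := fun y ν =>
      ∑' j, diracTop (y + nthPoint ν j) (Iic r)) m2,
    ← lintegral_const_mul (f := fun ω => diracTop (b ω) (Iic r)) _
      ((measurable_diracTop_apply measurableSet_Iic).comp hb)]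
  refine lintegral_mono fun ω' => ?_
  dsimp only
  rw [diracTop_Iic]
  split_ifs with hle
  · rw [mul_one, ← hΛu, ← hξ.lintegral MeasurableSet.univ (hΛB _)]
    refine lintegral_mono fun ω => ?_
    conv_rhs => rw [eq_sum_diracTop_nthPoint (hξ.counting ω)]
    rw [Measure.sum_apply _ MeasurableSet.univ]
    refine ENNReal.tsum_le_tsum fun j => ?_
    rw [diracTop_Iic, diracTop_apply _ MeasurableSet.univ, indicator_apply]
    split_ifs with h1 h2
    · simp
    · refine absurd ?_ h2
      have hne : nthPoint (ξ ω) j ≠ ⊤ := by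
        intro htop
        rw [htop] at h1
        simp at h1
      exact ⟨_, mem_univ _, ENNReal.coe_toNNReal hne⟩
    all_goals simp
  · rw [mul_zero]
    refine le_of_eq ((lintegral_congr fun ω => ?_).trans lintegral_zero)
    refine ENNReal.tsum_eq_zero.2 fun j => ?_
    rw [diracTop_Iic, if_neg]
    exact fun h1 => hle (le_self_add.trans h1)

/-- With `b` and `c` frozen, a child born at `c` would be a point of `ξ` at the fixed place `c - b`,
which an absolutely continuous intensity does not charge. -/
lemma IsPoissonProcess.measure_child_eq [IsProbabilityMeasure P]
    (hξ : IsPoissonProcess P ξ (leb.withDensity h)) {b c : Ω → ℝ≥0∞}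
    (hb : Measurable b) (hc : Measurable c) (hbξ : IndepFun (fun ω => (b ω, c ω)) ξ P) (j : ℕ) :
    ∀ᵐ ω ∂P, c ω ≠ ⊤ → b ω + nthPoint (ξ ω) j ≠ c ω := by
  have hms : MeasurableSet {y : (ℝ≥0∞ × ℝ≥0∞) × ℝ≥0∞ | y.1.2 ≠ ⊤ ∧ y.1.1 + y.2 = y.1.2} :=
    ((measurableSet_singleton _).compl.preimage (by fun_prop : Measurable
      fun y : (ℝ≥0∞ × ℝ≥0∞) × ℝ≥0∞ => y.1.2)).inter
      (measurableSet_eq_fun (by fun_prop) (by fun_prop))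
  have m1 : Measurable (Function.uncurry fun (y : ℝ≥0∞ × ℝ≥0∞) (ν : Measure ℝ≥0) =>
      {y : (ℝ≥0∞ × ℝ≥0∞) × ℝ≥0∞ | y.1.2 ≠ ⊤ ∧ y.1.1 + y.2 = y.1.2}.indicator
        (1 : (ℝ≥0∞ × ℝ≥0∞) × ℝ≥0∞ → ℝ≥0∞) (y, nthPoint ν j)) :=
    (measurable_one.indicator hms).comp
      (measurable_fst.prodMk ((measurable_nthPoint j).comp measurable_snd))
  have key := lintegral_comp_of_indepFun hbξ (hb.prodMk hc) hξ.measurable m1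
  have hzero : ∀ y : ℝ≥0∞ × ℝ≥0∞, ∫⁻ ω,
      {y : (ℝ≥0∞ × ℝ≥0∞) × ℝ≥0∞ | y.1.2 ≠ ⊤ ∧ y.1.1 + y.2 = y.1.2}.indicator
        (1 : (ℝ≥0∞ × ℝ≥0∞) × ℝ≥0∞ → ℝ≥0∞) (y, nthPoint (ξ ω) j) ∂P = 0 := by
    rintro ⟨b, c⟩
    refine (lintegral_congr_ae ?_).trans lintegral_zero
    have hn := hξ.nthPoint_ne (c - b).toNNReal
      (withDensity_absolutelyContinuous _ _ (measure_singleton _)) j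
    have hn' : ∀ᵐ ω ∂P, nthPoint (ξ ω) j ≠ (c - b).toNNReal := by simpa [ae_iff] using hn
    filter_upwards [hn'] with ω hω
    refine indicator_of_notMem ?_ _
    · rintro ⟨h1, h2⟩
      simp only at h1 h2
      have hb : b ≠ ⊤ := by rintro rfl; exact h1 (by rw [← h2]; simp)
      have : c - b = nthPoint (ξ ω) j := by rw [← h2, ENNReal.add_sub_cancel_left hb]
      rw [this, ENNReal.coe_toNNReal] at hω
      · exact hω rfl
      · intro h3
        rw [h3] at h2
        exact h1 (by rw [← h2]; simp)
  simp_rw [hzero, lintegral_zero] at key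
  filter_upwards [(lintegral_eq_zero_iff
    (m1.comp ((hb.prodMk hc).prodMk hξ.measurable))).1 key] with ω hω h1 h2
  refine one_ne_zero (α := ℝ≥0∞) (Eq.trans ?_ hω)
  exact (indicator_of_mem (s := {y : (ℝ≥0∞ × ℝ≥0∞) × ℝ≥0∞ | y.1.2 ≠ ⊤ ∧ y.1.1 + y.2 = y.1.2})
    (a := ((b ω, c ω), nthPoint (ξ ω) j)) ⟨h1, h2⟩ 1).symm

end Children

/-! ### Hazard function and renewal function -/

section Renewal

variable {f : ℝ≥0 → ℝ≥0}

lemma measurable_hazard (hf : Measurable f) : Measurable (hazard f) := by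
  have h : Monotone fun t => ∫⁻ s in Iic t, (f s : ℝ≥0∞) ∂leb :=
    fun s t hst => lintegral_mono_set (Iic_subset_Iic.2 hst)
  have hm := h.measurable
  unfold hazard
  fun_prop

/-- Apart from its infimum, `Z` is covered by countably many null half-lines with rational
endpoints. Applied where the survival function vanishes, this makes the conventional value `0` of
the hazard harmless. -/
lemma measure_eq_zero_of_forall_Ici {ν : Measure ℝ≥0} [NullSingletonClass ν] {Z : Set ℝ≥0}
    (h : ∀ x ∈ Z, ν (Ici x) = 0) : ν Z = 0 := by
  have hsub : Z ⊆ {sInf Z} ∪ ⋃ (q : ℚ) (_ : ν (Ici (Real.toNNReal q)) = 0),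
      Ici (Real.toNNReal q) := by
    intro x hx
    by_cases hxi : x = sInf Z
    · exact Or.inl hxi
    · right
      have hlt : sInf Z < x := lt_of_le_of_ne (csInf_le (OrderBot.bddBelow _) hx) (Ne.symm hxi)
      obtain ⟨z, hz, hzx⟩ := exists_lt_of_csInf_lt ⟨x, hx⟩ hlt
      obtain ⟨q, -, hq1, hq2⟩ := (NNReal.lt_iff_exists_rat_btwn _ _).1 hzx
      refine mem_iUnion₂.2 ⟨q, ?_, hq2.le⟩
      exact measure_mono_null (Ici_subset_Ici.2 hq1.le) (h z hz)
  refine measure_mono_null hsub (measure_union_null (measure_singleton _) ?_)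
  exact measure_iUnion_null fun q => measure_iUnion_null fun hq => hq

instance (g : ℝ≥0 → ℝ≥0∞) : NullSingletonClass (leb.withDensity g) :=
  ⟨fun x => withDensity_absolutelyContinuous _ _ (measure_singleton x)⟩

/-- The defining property of the hazard function. -/
lemma hazard_mul_measure_Ici (hf : Measurable f)
    [IsProbabilityMeasure (leb.withDensity fun t => (f t : ℝ≥0∞))] :
    ∀ᵐ x ∂leb, (hazard f x : ℝ≥0∞) * leb.withDensity (fun t => (f t : ℝ≥0∞)) (Ici x) = f x := by
  set ν := leb.withDensity fun t => (f t : ℝ≥0∞)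
  have hd : ∀ x, 1 - ∫⁻ s in Iic x, (f s : ℝ≥0∞) ∂leb = ν (Ici x) := by
    intro x
    rw [← withDensity_apply _ measurableSet_Iic, ← prob_compl_eq_one_sub measurableSet_Iic,
      compl_Iic]
    exact measure_congr Ioi_ae_eq_Ici
  have hmeas : Measurable fun x => ν (Ici x) :=
    Antitone.measurable fun x y hxy => measure_mono (Ici_subset_Ici.2 hxy)
  have hZ : MeasurableSet {x | ν (Ici x) = 0} := hmeas (measurableSet_singleton 0)
  have h0 : ν {x | ν (Ici x) = 0} = 0 := measure_eq_zero_of_forall_Ici fun x hx => hx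
  have h1 : ∀ᵐ x ∂leb, x ∈ {x | ν (Ici x) = 0} → (f x : ℝ≥0∞) = 0 := by
    rw [withDensity_apply _ hZ, setLIntegral_eq_zero_iff hZ (by fun_prop)] at h0
    exact h0
  filter_upwards [h1] with x hx
  rw [hazard, hd]
  by_cases h : ν (Ici x) = 0
  · rw [h, hx h, mul_zero]
  · have hne : (ν (Ici x)).toNNReal ≠ 0 := by
      rw [ENNReal.toNNReal_ne_zero]; exact ⟨h, measure_ne_top _ _⟩
    nth_rewrite 2 [← ENNReal.coe_toNNReal (measure_ne_top ν (Ici x))]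
    rw [← ENNReal.coe_mul, div_mul_cancel₀ _ hne]

variable {Ω α : Type*} [MeasurableSpace Ω] [MeasurableSpace α] {P : Measure Ω}
  {τ : Ω → ℝ≥0} {Y : Ω → α}

/-- Since `f x = hazard f x * P(τ ≥ x)` almost everywhere, the density of `b + τ` at `v > b` is
`hazard f (v - b)` integrated over the event `v ≤ b + τ`; Tonelli exchanges the integrals. -/
lemma lintegral_waiting [IsProbabilityMeasure P] (hf : Measurable f) (hτ : Measurable τ)
    (hlaw : P.map τ = leb.withDensity fun t => (f t : ℝ≥0∞)) (b s r : ℝ≥0) :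
    ∫⁻ ω, diracTop ((b + τ ω : ℝ≥0)) (Ioc s r) ∂P =
      ∫⁻ ω, ∫⁻ v in Ioc s r, (if v ≤ b + τ ω then
        shifted (fun x => (hazard f x : ℝ≥0∞)) b v else 0) ∂leb ∂P := by
  have : IsProbabilityMeasure (leb.withDensity fun t => (f t : ℝ≥0∞)) :=
    hlaw ▸ Measure.isProbabilityMeasure_map hτ.aemeasurable
  have hμ := measurable_hazard hf
  set μ : ℝ≥0 → ℝ≥0∞ := fun x => (hazard f x : ℝ≥0∞) with hμdef
  have hμ' : Measurable μ := by fun_prop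
  set ν := leb.withDensity fun t => (f t : ℝ≥0∞)
  have hmeas : Measurable fun x => ν (Ici x) :=
    Antitone.measurable fun x y hxy => measure_mono (Ici_subset_Ici.2 hxy)
  have hsh : Measurable (shifted μ b) := (measurable_shifted hμ').comp measurable_prodMk_left
  have hset : MeasurableSet {x : ℝ≥0 | (s : ℝ≥0∞) < b + x ∧ (b : ℝ≥0∞) + x ≤ r} :=
    measurableSet_shift b s r
  calc ∫⁻ ω, diracTop ((b + τ ω : ℝ≥0)) (Ioc s r) ∂P
      = ∫⁻ ω, {x : ℝ≥0 | (s : ℝ≥0∞) < b + x ∧ (b : ℝ≥0∞) + x ≤ r}.indicator 1 (τ ω) ∂P := by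
        refine lintegral_congr fun ω => ?_
        rw [diracTop_Ioc]
        by_cases h : τ ω ∈ {x : ℝ≥0 | (s : ℝ≥0∞) < b + x ∧ (b : ℝ≥0∞) + x ≤ r}
        · rw [indicator_of_mem h, if_pos (by exact_mod_cast h)]
          rfl
        · rw [indicator_of_notMem h, if_neg (by exact_mod_cast h)]
    _ = ν {x : ℝ≥0 | (s : ℝ≥0∞) < b + x ∧ (b : ℝ≥0∞) + x ≤ r} := by
        rw [← hlaw, ← lintegral_map (measurable_one.indicator hset) hτ,
          lintegral_indicator_one hset]
    _ = ∫⁻ x in {x : ℝ≥0 | (s : ℝ≥0∞) < b + x ∧ (b : ℝ≥0∞) + x ≤ r}, μ x * ν (Ici x) ∂leb := by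
        rw [withDensity_apply _ hset]
        refine lintegral_congr_ae (ae_restrict_of_ae ?_)
        filter_upwards [hazard_mul_measure_Ici hf] with x hx
        exact hx.symm
    _ = ∫⁻ v in Ioc s r, shifted (fun x => μ x * ν (Ici x)) b v ∂leb :=
        setLIntegral_shift (hμ'.mul hmeas) b s r
    _ = ∫⁻ v in Ioc s r, ∫⁻ ω, (if v ≤ b + τ ω then shifted μ b v else 0) ∂P ∂leb := by
        refine lintegral_congr fun v => ?_
        have h1 : ∫⁻ ω, (if v ≤ b + τ ω then shifted μ b v else 0) ∂P =
            shifted μ b v * P {ω | v ≤ b + τ ω} := by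
          rw [← lintegral_indicator_const (measurableSet_le (by fun_prop) (by fun_prop))]
          rfl
        rw [h1]
        simp only [shifted, ENNReal.toNNReal_coe, ENNReal.coe_lt_coe]
        split_ifs with hbv
        · congr 1
          rw [← hlaw, Measure.map_apply hτ measurableSet_Ici]
          congr 1
          ext ω
          simp only [mem_preimage, mem_Ici, mem_ofPred_eq, tsub_le_iff_left]
        · simp
    _ = _ := by
        refine lintegral_lintegral_swap ?_
        refine Measurable.aemeasurable (Measurable.ite ?_ (hsh.comp measurable_fst)
          measurable_const)
        exact measurableSet_le (by fun_prop) (by fun_prop)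

/-- Given what is known at time `s`, the probability that the epoch following an epoch at `b(Y)`
lies between `s` and `r` is the mean of the integrated hazard. -/
lemma lintegral_next_epoch [IsProbabilityMeasure P] (hf : Measurable f) (hτ : Measurable τ)
    (hlaw : P.map τ = leb.withDensity fun t => (f t : ℝ≥0∞)) (hY : Measurable Y)
    (hYτ : IndepFun Y τ P) {b : α → ℝ≥0} (hb : Measurable b) {φ : α × ℝ≥0 → ℝ≥0∞}
    (hφ : Measurable φ) (s r : ℝ≥0) :
    ∫⁻ ω, φ (Y ω, truncateWaiting (b (Y ω)) s (τ ω)) *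
        diracTop ((b (Y ω) + τ ω : ℝ≥0)) (Ioc s r) ∂P =
      ∫⁻ ω, φ (Y ω, truncateWaiting (b (Y ω)) s (τ ω)) *
        ∫⁻ v in Ioc s r, (if v ≤ b (Y ω) + τ ω then
          shifted (fun x => (hazard f x : ℝ≥0∞)) (b (Y ω)) v else 0) ∂leb ∂P := by
  have hμ := measurable_hazard hf
  have m1 : Measurable (Function.uncurry fun (y : α) (x : ℝ≥0) =>
      φ (y, truncateWaiting (b y) s x)) := by
    refine hφ.comp (measurable_fst.prodMk ?_)
    exact Measurable.ite (measurableSet_le (by fun_prop) (by fun_prop)) measurable_snd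
      measurable_const
  have m2 : Measurable (Function.uncurry fun (y : α) (x : ℝ≥0) =>
      diracTop ((b y + x : ℝ≥0)) (Ioc s r)) :=
    (measurable_diracTop_apply measurableSet_Ioc).comp (by fun_prop)
  have m3 : Measurable (Function.uncurry fun (y : α) (x : ℝ≥0) =>
      ∫⁻ v in Ioc s r, (if v ≤ b y + x then
          shifted (fun x => (hazard f x : ℝ≥0∞)) (b y) v else 0) ∂leb) := by
    refine Measurable.lintegral_prod_right' (f := fun q : (α × ℝ≥0) × ℝ≥0 =>
      if q.2 ≤ b q.1.1 + q.1.2 then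
          shifted (fun x => (hazard f x : ℝ≥0∞)) (b q.1.1) q.2 else 0) ?_
    refine Measurable.ite (measurableSet_le (by fun_prop) (by fun_prop)) ?_ measurable_const
    exact (measurable_shifted (φ := fun x => (hazard f x : ℝ≥0∞)) (by fun_prop)).comp
      (by fun_prop : Measurable fun q : (α × ℝ≥0) × ℝ≥0 => ((b q.1.1 : ℝ≥0∞), q.2))
  rw [lintegral_comp_of_indepFun hYτ hY hτ (g := fun y x =>
      φ (y, truncateWaiting (b y) s x) * diracTop ((b y + x : ℝ≥0)) (Ioc s r)) (m1.mul m2),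
    lintegral_comp_of_indepFun hYτ hY hτ (g := fun y x =>
      φ (y, truncateWaiting (b y) s x) * ∫⁻ v in Ioc s r, (if v ≤ b y + x then
          shifted (fun x => (hazard f x : ℝ≥0∞)) (b y) v else 0) ∂leb) (m1.mul m3)]
  refine lintegral_congr fun ω' => ?_
  -- Both integrands vanish when `b + τ ≤ s`. Otherwise the truncated waiting time is the constant
  -- `s + 1`, so the factor `φ` no longer depends on `τ`.
  calc _ = ∫⁻ ω, φ (Y ω', s + 1) * diracTop ((b (Y ω') + τ ω : ℝ≥0)) (Ioc s r) ∂P := by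
        refine lintegral_congr fun ω => ?_
        rw [diracTop_Ioc, truncateWaiting]
        split_ifs with h1 h2 h2
        · exact absurd h2.1 (not_lt.2 (by exact_mod_cast h1))
        · simp
        · rfl
        · simp
    _ = ∫⁻ ω, φ (Y ω', s + 1) * ∫⁻ v in Ioc s r, (if v ≤ b (Y ω') + τ ω then
          shifted (fun x => (hazard f x : ℝ≥0∞)) (b (Y ω')) v else 0) ∂leb ∂P := by
        have e2 := lintegral_const_mul (μ := P) (φ (Y ω', s + 1))
          (m2.comp ((measurable_const (a := Y ω')).prodMk hτ))
        have e3 := lintegral_const_mul (μ := P) (φ (Y ω', s + 1))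
          (m3.comp ((measurable_const (a := Y ω')).prodMk hτ))
        refine e2.trans (Eq.trans ?_ e3.symm)
        exact congrArg _ (lintegral_waiting hf hτ hlaw (b (Y ω')) s r)
    _ = _ := by
        refine lintegral_congr fun ω => ?_
        rw [truncateWaiting]
        split_ifs with h1
        · have : ∫⁻ v in Ioc s r, (if v ≤ b (Y ω') + τ ω then
              shifted (fun x => (hazard f x : ℝ≥0∞)) (b (Y ω')) v else 0) ∂leb = 0 := by
            rw [setLIntegral_congr_fun (g := fun _ => 0) measurableSet_Ioc, lintegral_zero]
            intro v hv
            exact if_neg fun h2 => absurd hv.1 (not_lt.2 (h2.trans h1))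
          rw [this, mul_zero, mul_zero]
        · rfl

lemma ae_pos_of_map_eq (hτ : Measurable τ)
    (hlaw : P.map τ = leb.withDensity fun t => (f t : ℝ≥0∞)) : ∀ᵐ ω ∂P, 0 < τ ω := by
  have h : P.map τ {0} = 0 := by rw [hlaw]; exact measure_singleton _
  rw [Measure.map_apply hτ (measurableSet_singleton 0)] at h
  have h2 : ∀ᵐ ω ∂P, τ ω ≠ 0 := by
    rw [ae_iff]
    simp only [ne_eq, not_not]
    exact h
  filter_upwards [h2] with ω hω
  exact pos_iff_ne_zero.2 hω

/-- The renewal function is finite. -/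
lemma tsum_epoch_lt_top [IsProbabilityMeasure P] {τ : ℕ → Ω → ℝ≥0} (hτ : ∀ i, Measurable (τ i))
    (hind : iIndepFun τ P) (hlaw : ∀ i, P.map (τ i) = leb.withDensity fun t => (f t : ℝ≥0∞))
    (r : ℝ≥0) : ∑' i, ∫⁻ ω, diracTop (epoch τ i ω) (Iic r) ∂P < ⊤ := by
  -- Chernoff bound: the indicator of `epoch τ i ≤ r` is at most `exp (r - epoch τ i)`, with mean
  -- `exp r * ρ ^ i`, and `ρ < 1` because waiting times are almost surely positive.
  let e : ℝ≥0 → ℝ≥0∞ := fun x => ENNReal.ofReal (Real.exp (-x))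
  have he : Measurable e := by fun_prop
  set ρ := ∫⁻ x, e x ∂leb.withDensity fun t => (f t : ℝ≥0∞)
  have hρi : ∀ i, ∫⁻ ω, e (τ i ω) ∂P = ρ := fun i => by
    rw [← lintegral_map he (hτ i), hlaw i]
  have hρ : ρ < 1 := by
    rw [← hρi 0]
    refine lt_of_lt_of_eq (lintegral_strict_mono (g := fun _ => 1) (IsProbabilityMeasure.ne_zero P)
      aemeasurable_const ?_ ?_) (by simp)
    · refine ne_top_of_le_ne_top (b := 1) ENNReal.one_ne_top ?_
      refine (lintegral_mono (g := fun _ => 1) fun ω => ?_).trans (by simp)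
      simp only [e]
      rw [ENNReal.ofReal_le_one, Real.exp_le_one_iff]
      simp
    · filter_upwards [ae_pos_of_map_eq (hτ 0) (hlaw 0)] with ω hω
      simp only [e]
      rw [ENNReal.ofReal_lt_one, Real.exp_lt_one_iff]
      simpa using hω
  have hle : ∀ i, ∫⁻ ω, diracTop (epoch τ i ω) (Iic r) ∂P ≤
      ENNReal.ofReal (Real.exp r) * ρ ^ i := by
    intro i
    have hprod : ∫⁻ ω, ∏ k ∈ Finset.range i, e (τ k ω) ∂P = ρ ^ i := by
      rw [lintegral_prod_eq_prod_lintegral_of_indepFun (Finset.range i) (fun k ω => e (τ k ω))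
        (hind.comp (fun _ => e) fun _ => he) fun k => he.comp (hτ k)]
      simp [hρi]
    rw [← hprod, ← lintegral_const_mul (f := fun ω => ∏ k ∈ Finset.range i, e (τ k ω)) _
      (Finset.measurable_fun_prod _ fun k _ => he.comp (hτ k))]
    refine lintegral_mono fun ω => ?_
    rw [diracTop_Iic]
    split_ifs with h
    · simp only [e]
      rw [← ENNReal.ofReal_prod_of_nonneg fun _ _ => (Real.exp_pos _).le, ← Real.exp_sum,
        ← ENNReal.ofReal_mul (Real.exp_pos _).le, ← Real.exp_add, ENNReal.one_le_ofReal,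
        Real.one_le_exp_iff]
      have h' : epoch τ i ω ≤ r := by exact_mod_cast h
      have h2 : ((epoch τ i ω : ℝ≥0) : ℝ) ≤ r := by exact_mod_cast h'
      rw [epoch] at h2
      push_cast at h2
      rw [Finset.sum_neg_distrib]
      linarith
    · exact zero_le
  refine (ENNReal.tsum_le_tsum hle).trans_lt ?_
  rw [ENNReal.tsum_mul_left, ENNReal.tsum_geometric]
  refine ENNReal.mul_lt_top ENNReal.ofReal_lt_top ?_
  rw [ENNReal.inv_lt_top]
  exact tsub_pos_of_lt hρ

end Renewal

/-! ### The cluster model -/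

/-- The assumptions on the waiting times and on the offspring processes. -/
structure IsClusterModel {Ω : Type*} [MeasurableSpace Ω] (P : Measure Ω) (f h : ℝ≥0 → ℝ≥0)
    (τ : ℕ → Ω → ℝ≥0) (ξ : ℕ × List ℕ → Ω → Measure ℝ≥0) : Prop where
  measurable_f : Measurable f
  measurable_h : Measurable h
  subcritical : ∫⁻ t, (h t : ℝ≥0∞) ∂leb < 1
  measurable_waiting : ∀ i, Measurable (τ i)
  indep_waiting : iIndepFun τ P
  law_waiting : ∀ i, P.map (τ i) = leb.withDensity fun t => (f t : ℝ≥0∞)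
  offspring : ∀ l, IsPoissonProcess P (ξ l) (leb.withDensity fun t => (h t : ℝ≥0∞))
  indep_offspring : iIndepFun ξ P
  indep : IndepFun (fun ω i => τ i ω) (fun ω l => ξ l ω) P

lemma tsum_list (g : List ℕ → ℝ≥0∞) :
    ∑' w, g w = g [] + ∑' (u : List ℕ) (j : ℕ), g (j :: u) := by
  classical
  rw [ENNReal.tsum_eq_add_tsum_ite [], tsum_list_cons (by simp)]
  simp

lemma lintegral_tsum_add_tsum {α ι κ : Type*} [Countable ι] [Countable κ] [MeasurableSpace α]
    {μ : Measure α} {X : ι → α → ℝ≥0∞} {Y : κ → α → ℝ≥0∞} (hX : ∀ i, Measurable (X i))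
    (hY : ∀ k, Measurable (Y k)) :
    ∫⁻ a, (∑' i, X i a + ∑' k, Y k a) ∂μ = ∑' i, ∫⁻ a, X i a ∂μ + ∑' k, ∫⁻ a, Y k a ∂μ := by
  rw [lintegral_add_left (Measurable.tsum hX), lintegral_tsum fun i => (hX i).aemeasurable,
    lintegral_tsum fun k => (hY k).aemeasurable]

lemma lintegral_mul_tsum_add_tsum {α ι κ : Type*} [Countable ι] [Countable κ] [MeasurableSpace α]
    {μ : Measure α} {g : α → ℝ≥0∞} {X : ι → α → ℝ≥0∞} {Y : κ → α → ℝ≥0∞} (hg : Measurable g)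
    (hX : ∀ i, Measurable (X i)) (hY : ∀ k, Measurable (Y k)) :
    ∫⁻ a, g a * (∑' i, X i a + ∑' k, Y k a) ∂μ =
      ∑' i, ∫⁻ a, g a * X i a ∂μ + ∑' k, ∫⁻ a, g a * Y k a ∂μ := by
  simp_rw [mul_add, ← ENNReal.tsum_mul_left]
  exact lintegral_tsum_add_tsum (fun i => hg.mul (hX i)) (fun k => hg.mul (hY k))

/-- Everything except the children of the individual `l`. -/
def withoutChildren {Ω : Type*} (τ : ℕ → Ω → ℝ≥0) (ξ : ℕ × List ℕ → Ω → Measure ℝ≥0)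
    (l : ℕ × List ℕ) (ω : Ω) : (ℕ → ℝ≥0) × (ℕ × List ℕ → ℕ → ℝ≥0∞) :=
  (fun k => τ k ω, Function.update (fun l j => nthPoint (ξ l ω) j) l fun j => nthPoint 0 j)

lemma birthOf_withoutChildren {Ω : Type*} {τ : ℕ → Ω → ℝ≥0} {ξ : ℕ × List ℕ → Ω → Measure ℝ≥0}
    (l : ℕ × List ℕ) (i : ℕ) {u : List ℕ} (hu : u.length ≤ l.2.length) (ω : Ω) :
    birthOf (withoutChildren τ ξ l ω).1 (withoutChildren τ ξ l ω).2 i u = birth τ ξ i u ω := by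
  rw [withoutChildren, birthOf_update_children _ _ _ _ _ hu, birth_eq_birthOf]

lemma birthOf_withoutChildren_cons {Ω : Type*} {τ : ℕ → Ω → ℝ≥0}
    {ξ : ℕ × List ℕ → Ω → Measure ℝ≥0} (l : ℕ × List ℕ) (i j : ℕ) {u : List ℕ}
    (hu : u.length ≤ l.2.length) (hne : (i, u) ≠ l) (ω : Ω) :
    birthOf (withoutChildren τ ξ l ω).1 (withoutChildren τ ξ l ω).2 i (j :: u) =
      birth τ ξ i (j :: u) ω := by
  rw [birthOf, birthOf_withoutChildren l i hu, birth]
  simp [withoutChildren, Function.update_of_ne hne]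

namespace IsClusterModel

variable {Ω : Type*} [MeasurableSpace Ω] {P : Measure Ω} {f h : ℝ≥0 → ℝ≥0}
  {τ : ℕ → Ω → ℝ≥0} {ξ : ℕ × List ℕ → Ω → Measure ℝ≥0}

lemma counting (hM : IsClusterModel P f h τ ξ) (l : ℕ × List ℕ) (ω : Ω) :
    IsCountingMeasure (ξ l ω) := (hM.offspring l).counting ω

lemma offspring_ne_top (hM : IsClusterModel P f h τ ξ) : ∫⁻ t, (h t : ℝ≥0∞) ∂leb ≠ ⊤ :=
  (hM.subcritical.trans ENNReal.one_lt_top).ne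

lemma measurable_waitings (hM : IsClusterModel P f h τ ξ) : Measurable fun ω i => τ i ω :=
  measurable_pi_lambda _ hM.measurable_waiting

lemma measurable_offsprings (hM : IsClusterModel P f h τ ξ) : Measurable fun ω l => ξ l ω :=
  measurable_pi_lambda _ fun l => (hM.offspring l).measurable

lemma measurable_offspringPoints (hM : IsClusterModel P f h τ ξ) :
    Measurable fun ω l j => nthPoint (ξ l ω) j :=
  measurable_pi_lambda _ fun l => measurable_points.comp (hM.offspring l).measurable

lemma measurable_birth (hM : IsClusterModel P f h τ ξ) (i : ℕ) (u : List ℕ) :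
    Measurable (birth τ ξ i u) := by
  have : birth τ ξ i u = fun ω =>
      birthOf (fun k => τ k ω) (fun l j => nthPoint (ξ l ω) j) i u :=
    funext fun ω => birth_eq_birthOf τ ξ i u ω
  rw [this]
  exact (measurable_birthOf i u).comp (hM.measurable_waitings.prodMk hM.measurable_offspringPoints)

lemma measurable_epoch (hM : IsClusterModel P f h τ ξ) (i : ℕ) : Measurable (epoch τ i) :=
  Finset.measurable_fun_sum _ fun k _ => hM.measurable_waiting k

lemma measurable_historyProcess (hM : IsClusterModel P f h τ ξ) (s : ℝ≥0) :
    Measurable (historyProcess τ ξ s) :=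
  (measurable_history s).comp (hM.measurable_waitings.prodMk hM.measurable_offspringPoints)

lemma naturalSigma_le (hM : IsClusterModel P f h τ ξ) (s : ℝ≥0) :
    naturalSigma τ ξ s ≤ ‹MeasurableSpace Ω› :=
  (naturalSigma_le_comap hM.counting s).trans (hM.measurable_historyProcess s).comap_le

lemma indepFun_withoutChildren [IsProbabilityMeasure P] (hM : IsClusterModel P f h τ ξ)
    (l : ℕ × List ℕ) : IndepFun (withoutChildren τ ξ l) (ξ l) P := by
  -- The zero measure stands in for the removed process; all its points are `∞`. Thus
  -- `withoutChildren` is a measurable function of the waiting times and the other offspring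
  -- processes.
  have h1 := indepFun_update hM.indep_offspring (fun l => (hM.offspring l).measurable) l 0
  have hm : Measurable fun ω => Function.update (fun l => ξ l ω) l 0 :=
    measurable_update_left.comp hM.measurable_offsprings
  have hu : Measurable fun ν : ℕ × List ℕ → Measure ℝ≥0 => (ν l, Function.update ν l 0) :=
    (measurable_pi_apply l).prodMk measurable_update_left
  have h2 : IndepFun (fun ω i => τ i ω)
      (fun ω => (ξ l ω, Function.update (fun l => ξ l ω) l 0)) P :=
    hM.indep.comp measurable_id hu
  have h3 := indepFun_prodMk_of_indepFun h1 h2 (hM.offspring l).measurable hm hM.measurable_waitings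
  have h4 := h3.comp (φ := fun y : (ℕ → ℝ≥0) × (ℕ × List ℕ → Measure ℝ≥0) =>
    (y.1, fun l j => nthPoint (y.2 l) j)) (ψ := id) (measurable_fst.prodMk
      (measurable_pi_lambda _ fun l => measurable_points.comp
        ((measurable_pi_apply l).comp measurable_snd))) measurable_id
  convert! h4 using 1
  funext ω
  refine Prod.ext rfl ?_
  funext l'
  by_cases hl : l' = l
  · subst hl; simp [withoutChildren]
  · simp [withoutChildren, hl]

lemma measurable_withoutChildren (hM : IsClusterModel P f h τ ξ) (l : ℕ × List ℕ) :
    Measurable (withoutChildren τ ξ l) :=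
  hM.measurable_waitings.prodMk (measurable_update_left.comp hM.measurable_offspringPoints)

/-- The event `A` is read off the history, hence off `withoutChildren` and the children of `(i, u)`
born up to `s`. The birth time of `(i, u)` is itself a function of `withoutChildren`, so
`IsPoissonProcess.lintegral_children` applies. -/
lemma lintegral_offspring [IsProbabilityMeasure P] (hM : IsClusterModel P f h τ ξ) (s r : ℝ≥0)
    {A : Set Ω} (hA : MeasurableSet[naturalSigma τ ξ s] A) (i : ℕ) (u : List ℕ) :
    ∫⁻ ω, A.indicator 1 ω * ∑' j, diracTop (birth τ ξ i (j :: u) ω) (Ioc s r) ∂P =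
      ∫⁻ ω, A.indicator 1 ω *
        ∫⁻ v in Ioc s r, shifted (fun x => h x) (birth τ ξ i u ω) v ∂leb ∂P := by
  obtain ⟨A', hA', rfl⟩ := naturalSigma_le_comap hM.counting s A hA
  have hφ : Measurable fun y : ((ℕ → ℝ≥0) × (ℕ × List ℕ → ℕ → ℝ≥0∞)) × (ℕ → ℝ≥0∞) =>
      A'.indicator (1 : (ℕ × List ℕ → ℝ≥0∞) → ℝ≥0∞)
        (history s y.1.1 (Function.update y.1.2 (i, u) y.2)) := by
    have hu : Measurable fun y : ((ℕ → ℝ≥0) × (ℕ × List ℕ → ℕ → ℝ≥0∞)) × (ℕ → ℝ≥0∞) =>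
        Function.update y.1.2 (i, u) y.2 :=
      measurable_update'.comp ((measurable_snd.comp measurable_fst).prodMk measurable_snd)
    exact (measurable_one.indicator hA').comp ((measurable_history s).comp
      ((measurable_fst.comp measurable_fst).prodMk hu))
  have hh := hM.measurable_h
  have key := (hM.offspring (i, u)).lintegral_children (by fun_prop) hM.offspring_ne_top
    (hM.measurable_withoutChildren (i, u)) (hM.indepFun_withoutChildren (i, u))
    (measurable_birthOf i u) hφ s r
  have e1 (ω : Ω) : history s (withoutChildren τ ξ (i, u) ω).1
      (Function.update (withoutChildren τ ξ (i, u) ω).2 (i, u)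
        (truncate (birth τ ξ i u ω) s fun j => nthPoint (ξ (i, u) ω) j)) =
      historyProcess τ ξ s ω := by
    rw [withoutChildren, Function.update_idem, birth_eq_birthOf]
    exact history_update_truncate s _ (fun l j => nthPoint (ξ l ω) j) (i, u)
  simp only [birthOf_withoutChildren (i, u) i le_rfl, e1] at key
  exact key

/-- Here all offspring processes and all waiting times except the `i`-th are frozen; `epoch τ i`
depends on earlier waiting times only. -/
lemma lintegral_epoch [IsProbabilityMeasure P] (hM : IsClusterModel P f h τ ξ) (s r : ℝ≥0)
    {A : Set Ω} (hA : MeasurableSet[naturalSigma τ ξ s] A) (i : ℕ) :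
    ∫⁻ ω, A.indicator 1 ω * diracTop (epoch τ (i + 1) ω) (Ioc s r) ∂P =
      ∫⁻ ω, A.indicator 1 ω * ∫⁻ v in Ioc s r, (if v ≤ epoch τ (i + 1) ω then
        shifted (fun x => hazard f x) (epoch τ i ω) v else 0) ∂leb ∂P := by
  obtain ⟨A', hA', rfl⟩ := naturalSigma_le_comap hM.counting s A hA
  have hm : Measurable fun ω => Function.update (fun k => τ k ω) i 0 :=
    measurable_update_left.comp hM.measurable_waitings
  have h1 := indepFun_update hM.indep_waiting hM.measurable_waiting i 0
  have hu : Measurable fun t : ℕ → ℝ≥0 => (t i, Function.update t i 0) :=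
    (measurable_pi_apply i).prodMk measurable_update_left
  have hp : Measurable fun (ν : ℕ × List ℕ → Measure ℝ≥0) l j => nthPoint (ν l) j :=
    measurable_pi_lambda _ fun l => measurable_points.comp (measurable_pi_apply l)
  have h2 : IndepFun (fun ω l j => nthPoint (ξ l ω) j)
      (fun ω => (τ i ω, Function.update (fun k => τ k ω) i 0)) P :=
    (hM.indep.comp hu hp).symm
  have h3 := indepFun_prodMk_of_indepFun h1 h2 (hM.measurable_waiting i) hm
    hM.measurable_offspringPoints
  have hφ : Measurable fun y : ((ℕ × List ℕ → ℕ → ℝ≥0∞) × (ℕ → ℝ≥0)) × ℝ≥0 =>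
      A'.indicator (1 : (ℕ × List ℕ → ℝ≥0∞) → ℝ≥0∞)
        (history s (Function.update y.1.2 i y.2) y.1.1) := by
    have hu : Measurable fun y : ((ℕ × List ℕ → ℕ → ℝ≥0∞) × (ℕ → ℝ≥0)) × ℝ≥0 =>
        Function.update y.1.2 i y.2 :=
      measurable_update'.comp ((measurable_snd.comp measurable_fst).prodMk measurable_snd)
    exact (measurable_one.indicator hA').comp ((measurable_history s).comp
      (hu.prodMk (measurable_fst.comp measurable_fst)))
  have key := lintegral_next_epoch hM.measurable_f (hM.measurable_waiting i) (hM.law_waiting i)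
    (hM.measurable_offspringPoints.prodMk hm) h3
    (b := fun y => ∑ k ∈ Finset.range i, y.2 k) (by fun_prop) hφ s r
  have e0 (ω : Ω) : ∑ k ∈ Finset.range i, Function.update (fun k => τ k ω) i 0 k =
      epoch τ i ω := by
    refine Finset.sum_congr rfl fun k hk => ?_
    have := Finset.mem_range.1 hk
    rw [Function.update_of_ne (by omega)]
  have e1 (ω : Ω) : history s (Function.update (Function.update (fun k => τ k ω) i 0) i
      (truncateWaiting (epoch τ i ω) s (τ i ω))) (fun l j => nthPoint (ξ l ω) j) =
      historyProcess τ ξ s ω := by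
    rw [Function.update_idem]
    exact history_update_truncateWaiting s (fun k => τ k ω) _ i
  have e2 (ω : Ω) : epoch τ i ω + τ i ω = epoch τ (i + 1) ω := (Finset.sum_range_succ _ _).symm
  simp only [e0, e1, e2] at key
  exact key

/-- The conditional intensity, written as a sum over all individuals. -/
def sumIntensity (f h : ℝ≥0 → ℝ≥0) (τ : ℕ → Ω → ℝ≥0) (ξ : ℕ × List ℕ → Ω → Measure ℝ≥0)
    (v : ℝ≥0) (ω : Ω) : ℝ≥0∞ :=
  ∑' i, (if v ≤ epoch τ (i + 1) ω then
      shifted (fun x => hazard f x) (epoch τ i ω) v else 0) +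
    ∑' l : ℕ × List ℕ, shifted (fun x => h x) (birth τ ξ l.1 l.2 ω) v

lemma measurable_waitingIntensity (hM : IsClusterModel P f h τ ξ) (i : ℕ) :
    Measurable fun y : Ω × ℝ≥0 => if y.2 ≤ epoch τ (i + 1) y.1 then
      shifted (fun x => hazard f x) (epoch τ i y.1) y.2 else 0 := by
  have h1 := hM.measurable_epoch i
  have h2 := hM.measurable_epoch (i + 1)
  have hf := measurable_hazard hM.measurable_f
  refine Measurable.ite (measurableSet_le (by fun_prop) (by fun_prop)) ?_ measurable_const
  exact (measurable_shifted (φ := fun x => hazard f x) (by fun_prop)).comp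
    (by fun_prop : Measurable fun y : Ω × ℝ≥0 => ((epoch τ i y.1 : ℝ≥0∞), y.2))

lemma measurable_offspringIntensity (hM : IsClusterModel P f h τ ξ) (i : ℕ) (u : List ℕ) :
    Measurable fun y : Ω × ℝ≥0 => shifted (fun x => h x) (birth τ ξ i u y.1) y.2 := by
  have h1 := hM.measurable_birth i u
  have hh := hM.measurable_h
  exact (measurable_shifted (φ := fun x => h x) (by fun_prop)).comp
    (by fun_prop : Measurable fun y : Ω × ℝ≥0 => (birth τ ξ i u y.1, y.2))

/-- Given the past up to time `s`, the mean number of points between `s` and `r` is the mean of the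
integrated intensity. -/
lemma lintegral_clusterProcess [IsProbabilityMeasure P] (hM : IsClusterModel P f h τ ξ) (s r : ℝ≥0)
    {A : Set Ω} (hA : MeasurableSet[naturalSigma τ ξ s] A) :
    ∫⁻ ω, A.indicator 1 ω * clusterProcess τ ξ ω (Ioc s r) ∂P =
      ∫⁻ ω, A.indicator 1 ω * ∫⁻ v in Ioc s r, sumIntensity f h τ ξ v ω ∂leb ∂P := by
  have hAm : Measurable (A.indicator (1 : Ω → ℝ≥0∞)) :=
    measurable_one.indicator (hM.naturalSigma_le s A hA)
  have hd (i : ℕ) (u : List ℕ) : Measurable fun ω => diracTop (birth τ ξ i u ω) (Ioc s r) :=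
    (measurable_diracTop_apply measurableSet_Ioc).comp (hM.measurable_birth i u)
  have hd' (i : ℕ) : Measurable fun ω => diracTop (epoch τ i ω) (Ioc s r) := hd i []
  have hI (i : ℕ) : Measurable fun ω => ∫⁻ v in Ioc s r, (if v ≤ epoch τ (i + 1) ω then
      shifted (fun x => hazard f x) (epoch τ i ω) v else 0) ∂leb :=
    (hM.measurable_waitingIntensity i).lintegral_prod_right'
  have hI' (i : ℕ) (u : List ℕ) : Measurable fun ω => ∫⁻ v in Ioc s r,
      shifted (fun x => h x) (birth τ ξ i u ω) v ∂leb :=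
    (hM.measurable_offspringIntensity i u).lintegral_prod_right'
  have eN (ω : Ω) : clusterProcess τ ξ ω (Ioc s r) =
      ∑' i, diracTop (epoch τ (i + 1) ω) (Ioc s r) +
        ∑' l : ℕ × List ℕ, ∑' j, diracTop (birth τ ξ l.1 (j :: l.2) ω) (Ioc s r) := by
    rw [clusterProcess_eq_sum hM.counting, Measure.sum_apply _ measurableSet_Ioc,
      ENNReal.tsum_prod', ENNReal.tsum_prod' (f := fun l : ℕ × List ℕ =>
        ∑' j, diracTop (birth τ ξ l.1 (j :: l.2) ω) (Ioc s r))]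
    simp_rw [tsum_list fun u => diracTop (birth τ ξ _ u ω) (Ioc s r)]
    rw [ENNReal.tsum_add]
    congr 1
    -- The immigrant at time `0` is never in `(s, r]`; every point counted is a later epoch or a
    -- child.
    rw [tsum_eq_zero_add' ENNReal.summable]
    simp only [birth]
    rw [diracTop_Ioc, if_neg (by simp [epoch]), zero_add]
  have eI (ω : Ω) : ∫⁻ v in Ioc s r, sumIntensity f h τ ξ v ω ∂leb =
      ∑' i, ∫⁻ v in Ioc s r, (if v ≤ epoch τ (i + 1) ω then
        shifted (fun x => hazard f x) (epoch τ i ω) v else 0) ∂leb +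
      ∑' l : ℕ × List ℕ, ∫⁻ v in Ioc s r,
        shifted (fun x => h x) (birth τ ξ l.1 l.2 ω) v ∂leb := by
    have m1 (i : ℕ) := (hM.measurable_waitingIntensity i).comp (measurable_prodMk_left (x := ω))
    have m2 (l : ℕ × List ℕ) :=
      (hM.measurable_offspringIntensity l.1 l.2).comp (measurable_prodMk_left (x := ω))
    exact lintegral_tsum_add_tsum m1 m2
  simp_rw [eN, eI]
  rw [lintegral_mul_tsum_add_tsum hAm (fun i => hd' _) fun l => Measurable.tsum fun j => hd _ _,
    lintegral_mul_tsum_add_tsum hAm (fun i => hI _) fun l => hI' _ _]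
  congr 1
  · exact tsum_congr fun i => hM.lintegral_epoch s r hA i
  · exact tsum_congr fun l => hM.lintegral_offspring s r hA l.1 l.2

end IsClusterModel

/-! ### Regularity of almost all realizations -/

lemma exists_nat_eq_tsum {ι : Type*} {a : ι → ℝ≥0∞} (h01 : ∀ i, a i = 0 ∨ a i = 1)
    (h : ∑' i, a i ≠ ⊤) : ∃ k : ℕ, ∑' i, a i = k := by
  classical
  have hfin := ENNReal.finite_const_le_of_tsum_ne_top h one_ne_zero
  refine ⟨hfin.toFinset.card, ?_⟩
  rw [tsum_eq_sum (s := hfin.toFinset), Finset.card_eq_sum_ones, Nat.cast_sum]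
  · refine Finset.sum_congr rfl fun i hi => ?_
    have hi' : 1 ≤ a i := by simpa using hi
    rcases h01 i with h0 | h1
    · simp [h0] at hi'
    · simpa using h1
  · intro i hi
    have hi' : ¬ 1 ≤ a i := by simpa using hi
    rcases h01 i with h0 | h1
    · exact h0
    · simp [h1] at hi'

lemma diracTop_apply_eq_zero_or_one (x : ℝ≥0∞) {B : Set ℝ≥0} (hB : MeasurableSet B) :
    diracTop x B = 0 ∨ diracTop x B = 1 := by
  classical
  rw [diracTop_apply _ hB, indicator_apply]
  split_ifs <;> simp

/-- The realizations in which the cluster process is locally finite and simple and the epochs are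
strictly increasing. -/
structure IsRegular {Ω : Type*} (τ : ℕ → Ω → ℝ≥0) (ξ : ℕ × List ℕ → Ω → Measure ℝ≥0) (ω : Ω) :
    Prop where
  eq_sum : clusterProcess τ ξ ω =
    Measure.sum fun v : ℕ × List ℕ => diracTop (birth τ ξ v.1 v.2 ω)
  generation_zero : generation τ ξ 0 ω = Measure.sum fun k => diracTop (epoch τ k ω)
  finite : ∀ r, clusterProcess τ ξ ω (Iic r) ≠ ⊤
  birth_ne : ∀ v v' : ℕ × List ℕ, v ≠ v' → birth τ ξ v.1 v.2 ω ≠ ⊤ →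
    birth τ ξ v.1 v.2 ω ≠ birth τ ξ v'.1 v'.2 ω
  epoch_lt : ∀ k, epoch τ k ω < epoch τ (k + 1) ω

/-- The enumeration `b` is left free: labelled birth times serve the computation of means, ordered
points serve predictability. -/
lemma lintegral_Iio_of_eq_sum {ι : Type*} {ν : Measure ℝ≥0} {b : ι → ℝ≥0∞}
    (hν : ν = Measure.sum fun i => diracTop (b i)) {h : ℝ≥0 → ℝ≥0} (hh : Measurable h) (t : ℝ≥0) :
    ∫⁻ x in Iio t, (h (t - x) : ℝ≥0∞) ∂ν = ∑' i, shifted (fun x => h x) (b i) t := by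
  rw [hν, ← lintegral_indicator measurableSet_Iio, lintegral_sum_measure]
  refine tsum_congr fun i => ?_
  rw [lintegral_diracTop _ (Measurable.indicator (by fun_prop) measurableSet_Iio), shifted]
  induction b i with
  | top => simp
  | coe b => simp [indicator_apply]

namespace IsClusterModel

variable {Ω : Type*} [MeasurableSpace Ω] {P : Measure Ω} {f h : ℝ≥0 → ℝ≥0}
  {τ : ℕ → Ω → ℝ≥0} {ξ : ℕ × List ℕ → Ω → Measure ℝ≥0}

lemma indepFun_birth [IsProbabilityMeasure P] (hM : IsClusterModel P f h τ ξ) (i : ℕ)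
    (u : List ℕ) : IndepFun (birth τ ξ i u) (ξ (i, u)) P := by
  have h1 := (hM.indepFun_withoutChildren (i, u)).comp (measurable_birthOf i u) measurable_id
  have h2 : (fun y : (ℕ → ℝ≥0) × (ℕ × List ℕ → ℕ → ℝ≥0∞) => birthOf y.1 y.2 i u) ∘
      withoutChildren τ ξ (i, u) = birth τ ξ i u :=
    funext fun ω => birthOf_withoutChildren (i, u) i le_rfl ω
  rwa [h2] at h1

/-- Births up to `r` in generation `n` of cluster `i` have mean at most `α ^ n` times the
probability that immigrant `i` arrives by `r`. The geometric series in `n` and the renewal function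
both converge. -/
lemma lintegral_clusterProcess_Iic_lt_top [IsProbabilityMeasure P] (hM : IsClusterModel P f h τ ξ)
    (r : ℝ≥0) : ∫⁻ ω, clusterProcess τ ξ ω (Iic r) ∂P < ⊤ := by
  have hd (i : ℕ) (u : List ℕ) : Measurable fun ω => diracTop (birth τ ξ i u ω) (Iic r) :=
    (measurable_diracTop_apply measurableSet_Iic).comp (hM.measurable_birth i u)
  let e : ℕ → List ℕ → ℝ≥0∞ := fun i u => ∫⁻ ω, diracTop (birth τ ξ i u ω) (Iic r) ∂P
  set α := ∫⁻ t, (h t : ℝ≥0∞) ∂leb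
  have hchild (i : ℕ) (u : List ℕ) : ∑' j, e i (j :: u) ≤ α * e i u := by
    refine le_trans (le_of_eq ?_) ((hM.offspring (i, u)).lintegral_children_le hM.offspring_ne_top
      (hM.measurable_birth i u) (hM.indepFun_birth i u) r)
    exact (lintegral_tsum fun j => (hd i (j :: u)).aemeasurable).symm
  let m : ℕ → ℕ → ℝ≥0∞ := fun i n => ∑' u : List ℕ, if u.length = n then e i u else 0
  have hm (i n : ℕ) : m i n ≤ α ^ n * e i [] := by
    induction n with
    | zero =>
      rw [pow_zero, one_mul]
      refine le_of_eq (tsum_eq_single [] fun u hu => ?_)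
      simp [hu]
    | succ n ih =>
      calc m i (n + 1) = ∑' (u : List ℕ) (j : ℕ), if u.length = n then e i (j :: u) else 0 := by
            simp only [m]
            rw [tsum_list_cons (by simp)]
            simp
        _ ≤ ∑' u : List ℕ, α * if u.length = n then e i u else 0 := by
            refine ENNReal.tsum_le_tsum fun u => ?_
            split_ifs
            · exact hchild i u
            · simp
        _ = α * m i n := ENNReal.tsum_mul_left
        _ ≤ α * (α ^ n * e i []) := by gcongr
        _ = α ^ (n + 1) * e i [] := by ring
  have htot (i : ℕ) : ∑' u, e i u = ∑' n, m i n := by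
    rw [ENNReal.tsum_comm]
    refine tsum_congr fun u => ?_
    rw [tsum_eq_single u.length fun n hn => if_neg hn.symm, if_pos rfl]
  have hN : ∫⁻ ω, clusterProcess τ ξ ω (Iic r) ∂P = ∑' i, ∑' u, e i u := by
    simp_rw [clusterProcess_eq_sum hM.counting, Measure.sum_apply _ measurableSet_Iic]
    exact (lintegral_tsum fun v : ℕ × List ℕ => (hd v.1 v.2).aemeasurable).trans
      (ENNReal.tsum_prod' (f := fun v : ℕ × List ℕ => e v.1 v.2))
  rw [hN]
  calc ∑' i, ∑' u, e i u ≤ ∑' i, (1 - α)⁻¹ * e i [] := by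
        refine ENNReal.tsum_le_tsum fun i => ?_
        rw [htot, ← ENNReal.tsum_geometric, ← ENNReal.tsum_mul_right]
        exact ENNReal.tsum_le_tsum fun n => hm i n
    _ = (1 - α)⁻¹ * ∑' i, e i [] := ENNReal.tsum_mul_left
    _ < ⊤ := by
        refine ENNReal.mul_lt_top ?_
          (tsum_epoch_lt_top hM.measurable_waiting hM.indep_waiting hM.law_waiting r)
        rw [ENNReal.inv_lt_top]
        exact tsub_pos_of_lt hM.subcritical

lemma ae_epoch_lt (hM : IsClusterModel P f h τ ξ) :
    ∀ᵐ ω ∂P, ∀ k, epoch τ k ω < epoch τ (k + 1) ω := by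
  rw [ae_all_iff]
  intro k
  filter_upwards [ae_pos_of_map_eq (hM.measurable_waiting k) (hM.law_waiting k)] with ω hω
  rw [epoch, epoch, Finset.sum_range_succ]
  exact lt_add_of_pos_right _ hω

/-- Write the longer label as a child of `u'`. Unless the other individual is a sibling, the length
condition makes its birth time independent of the children of `u'`, and
`IsPoissonProcess.measure_child_eq` excludes a coincidence. Siblings are separated by simplicity of
the Poisson process, immigrants by strict growth of the epochs. -/
lemma ae_birth_ne_of_length_le [IsProbabilityMeasure P] (hM : IsClusterModel P f h τ ξ)
    {v v' : ℕ × List ℕ} (hne : v ≠ v') (hle : v.2.length ≤ v'.2.length) :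
    ∀ᵐ ω ∂P, birth τ ξ v.1 v.2 ω ≠ ⊤ → birth τ ξ v.1 v.2 ω ≠ birth τ ξ v'.1 v'.2 ω := by
  obtain ⟨i', w'⟩ := v'
  obtain ⟨i, w⟩ := v
  simp only at hle ⊢
  cases w' with
  | nil =>
    obtain rfl : w = [] := List.eq_nil_of_length_eq_zero (Nat.le_zero.1 hle)
    filter_upwards [hM.ae_epoch_lt] with ω hω _
    have hmono : StrictMono fun k => epoch τ k ω := strictMono_nat_of_lt_succ hω
    simp only [birth, ne_eq, ENNReal.coe_inj]
    intro heq
    exact hne (by rw [hmono.injective heq])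
  | cons j' u' =>
    have hindep : (∀ ω, birthOf (withoutChildren τ ξ (i', u') ω).1
        (withoutChildren τ ξ (i', u') ω).2 i w = birth τ ξ i w ω) →
        ∀ᵐ ω ∂P, birth τ ξ i w ω ≠ ⊤ → birth τ ξ i w ω ≠ birth τ ξ i' (j' :: u') ω := by
      intro hw
      have h1 := (hM.indepFun_withoutChildren (i', u')).comp
        ((measurable_birthOf i' u').prodMk (measurable_birthOf i w)) measurable_id
      have h2 : (fun y : (ℕ → ℝ≥0) × (ℕ × List ℕ → ℕ → ℝ≥0∞) =>
          (birthOf y.1 y.2 i' u', birthOf y.1 y.2 i w)) ∘ withoutChildren τ ξ (i', u') =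
          fun ω => (birth τ ξ i' u' ω, birth τ ξ i w ω) := by
        funext ω
        exact Prod.ext (birthOf_withoutChildren (i', u') i' le_rfl ω) (hw ω)
      rw [h2] at h1
      filter_upwards [(hM.offspring (i', u')).measure_child_eq (hM.measurable_birth i' u')
        (hM.measurable_birth i w) h1 j'] with ω hω htop heq
      exact hω htop heq.symm
    cases w with
    | nil => exact hindep fun ω => birthOf_withoutChildren (i', u') i (Nat.zero_le _) ω
    | cons j u =>
      have hlen : u.length ≤ u'.length := by simpa using hle
      by_cases hl : (i, u) = (i', u')
      · obtain ⟨rfl, rfl⟩ := Prod.mk.inj hl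
        have hj : j ≠ j' := by rintro rfl; exact hne rfl
        filter_upwards [(hM.offspring (i, u)).ae_simple hM.offspring_ne_top] with ω hω htop heq
        rw [birth, birth] at heq
        rw [birth, ENNReal.add_ne_top] at htop
        exact hω j j' hj htop.2 ((ENNReal.add_right_inj htop.1).1 heq)
      · exact hindep fun ω => birthOf_withoutChildren_cons (i', u') i j hlen hl ω

lemma ae_birth_ne [IsProbabilityMeasure P] (hM : IsClusterModel P f h τ ξ) :
    ∀ᵐ ω ∂P, ∀ v v' : ℕ × List ℕ, v ≠ v' → birth τ ξ v.1 v.2 ω ≠ ⊤ →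
      birth τ ξ v.1 v.2 ω ≠ birth τ ξ v'.1 v'.2 ω := by
  rw [ae_all_iff]
  intro v
  rw [ae_all_iff]
  intro v'
  by_cases hne : v = v'
  · exact Filter.Eventually.of_forall fun ω h => absurd hne h
  rcases le_total v.2.length v'.2.length with hle | hle
  · filter_upwards [hM.ae_birth_ne_of_length_le hne hle] with ω hω _
    exact hω
  · filter_upwards [hM.ae_birth_ne_of_length_le (Ne.symm hne) hle] with ω hω _ htop heq
    exact hω (heq ▸ htop) heq.symm

lemma measurable_clusterProcess (hM : IsClusterModel P f h τ ξ) :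
    Measurable (clusterProcess τ ξ) := by
  refine Measure.measurable_of_measurable_coe _ fun B hB => ?_
  simp_rw [clusterProcess_eq_sum hM.counting, Measure.sum_apply _ hB]
  exact Measurable.tsum fun v =>
    (measurable_diracTop_apply hB).comp (hM.measurable_birth v.1 v.2)

lemma ae_isRegular [IsProbabilityMeasure P] (hM : IsClusterModel P f h τ ξ) :
    ∀ᵐ ω ∂P, IsRegular τ ξ ω := by
  have hfin : ∀ᵐ ω ∂P, ∀ n : ℕ, clusterProcess τ ξ ω (Iic n) < ⊤ := by
    rw [ae_all_iff]
    exact fun n => ae_lt_top ((Measure.measurable_coe measurableSet_Iic).comp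
      hM.measurable_clusterProcess) (hM.lintegral_clusterProcess_Iic_lt_top n).ne
  filter_upwards [hfin, hM.ae_birth_ne, hM.ae_epoch_lt] with ω h1 h2 h3
  refine ⟨clusterProcess_eq_sum hM.counting ω, ?_, fun r => ?_, h2, h3⟩
  · ext B hB
    rw [generation_eq_sum hM.counting, Measure.sum_apply _ hB, Measure.sum_apply _ hB,
      ENNReal.tsum_prod']
    refine tsum_congr fun i => ?_
    rw [tsum_eq_single [] fun u hu => by simp [hu]]
    simp [birth]
  · obtain ⟨n, hn⟩ := exists_nat_ge r
    exact ((measure_mono (Iic_subset_Iic.2 hn)).trans_lt (h1 n)).ne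

end IsClusterModel

/-! ### Pathwise consequences of regularity -/

namespace IsRegular

variable {Ω : Type*} {τ : ℕ → Ω → ℝ≥0} {ξ : ℕ × List ℕ → Ω → Measure ℝ≥0} {ω : Ω}

lemma isCountingMeasure (R : IsRegular τ ξ ω) : IsCountingMeasure (clusterProcess τ ξ ω) := by
  intro B hB hbd
  obtain ⟨r, hr⟩ := hbd.bddAbove
  have hfin : clusterProcess τ ξ ω B ≠ ⊤ :=
    ne_top_of_le_ne_top (R.finite r) (measure_mono fun x hx => hr hx)
  rw [R.eq_sum, Measure.sum_apply _ hB] at hfin ⊢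
  exact exists_nat_eq_tsum (fun v => diracTop_apply_eq_zero_or_one _ hB) hfin

lemma strictMono_epoch (R : IsRegular τ ξ ω) : StrictMono fun k => epoch τ k ω :=
  strictMono_nat_of_lt_succ R.epoch_lt

lemma eq_sum_point (R : IsRegular τ ξ ω) :
    clusterProcess τ ξ ω = Measure.sum fun i => diracTop (point τ ξ i ω) :=
  eq_sum_diracTop_nthPoint R.isCountingMeasure

lemma measure_singleton_le_one (R : IsRegular τ ξ ω) (x : ℝ≥0) :
    clusterProcess τ ξ ω {x} ≤ 1 := by
  classical
  rw [R.eq_sum, Measure.sum_apply _ (measurableSet_singleton x)]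
  by_cases hex : ∃ v : ℕ × List ℕ, birth τ ξ v.1 v.2 ω = x
  · obtain ⟨v, hv⟩ := hex
    rw [tsum_eq_single v]
    · rcases diracTop_apply_eq_zero_or_one (birth τ ξ v.1 v.2 ω) (measurableSet_singleton x)
        with h | h <;> simp [h]
    · intro v' hv'
      rw [diracTop_apply _ (measurableSet_singleton x), indicator_of_notMem]
      rintro ⟨y, rfl, hy⟩
      exact R.birth_ne v v' hv'.symm (by simp [hv]) (by rw [hv, hy])
  · refine le_trans (le_of_eq (ENNReal.tsum_eq_zero.2 fun v => ?_)) zero_le_one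
    rw [diracTop_apply _ (measurableSet_singleton x), indicator_of_notMem]
    rintro ⟨y, rfl, hy⟩
    exact hex ⟨v, hy.symm⟩

lemma one_le_measure_singleton_epoch (R : IsRegular τ ξ ω) (k : ℕ) :
    1 ≤ clusterProcess τ ξ ω {epoch τ k ω} := by
  rw [R.eq_sum, Measure.sum_apply _ (measurableSet_singleton _)]
  refine le_trans ?_ (ENNReal.le_tsum (k, []))
  simp [birth, diracTop_coe]

lemma exists_point_eq_epoch (R : IsRegular τ ξ ω) (k : ℕ) :
    ∃ i, point τ ξ i ω = epoch τ k ω := by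
  by_contra! hne
  have h1 := R.one_le_measure_singleton_epoch k
  rw [measure_singleton_eq_tsum R.isCountingMeasure] at h1
  have h2 : ∀ i, (if nthPoint (clusterProcess τ ξ ω) i = epoch τ k ω then (1 : ℝ≥0∞) else 0) = 0 :=
    fun i => if_neg (hne i)
  simp [h2] at h1

lemma mark_eq_zero_iff (i : ℕ) : mark τ ξ i ω = 0 ↔ ∃ k, point τ ξ i ω = epoch τ k ω := by
  unfold mark
  split_ifs with h <;> simp [h]

lemma point_le_iff (R : IsRegular τ ξ ω) (i : ℕ) (x : ℝ≥0) :
    point τ ξ i ω ≤ x ↔ (i : ℝ≥0∞) < clusterProcess τ ξ ω (Iic x) :=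
  nthPoint_le_iff R.isCountingMeasure i x

lemma point_lt_succ (R : IsRegular τ ξ ω) (i : ℕ) (hi : point τ ξ i ω ≠ ⊤) :
    point τ ξ i ω < point τ ξ (i + 1) ω := by
  refine lt_of_le_of_ne (nthPoint_mono _ (Nat.le_succ i)) fun heq => ?_
  have h1 := R.measure_singleton_le_one (point τ ξ i ω).toNNReal
  rw [measure_singleton_eq_tsum R.isCountingMeasure] at h1
  have h2 := (ENNReal.sum_le_tsum {i, i + 1}).trans h1
  rw [Finset.sum_pair (by omega), ENNReal.coe_toNNReal hi,
    if_pos (show nthPoint (clusterProcess τ ξ ω) i = point τ ξ i ω from rfl),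
    if_pos (show nthPoint (clusterProcess τ ξ ω) (i + 1) = point τ ξ i ω from heq.symm)] at h2
  norm_num at h2

lemma finite_point_lt (R : IsRegular τ ξ ω) (t : ℝ≥0) : {i | point τ ξ i ω ≤ t}.Finite := by
  obtain ⟨k, hk⟩ := R.isCountingMeasure.measure_Iic t
  refine (finite_lt_nat k).subset fun i hi => ?_
  have := (R.point_le_iff i t).1 hi
  rw [hk] at this
  exact_mod_cast this

lemma point_zero (R : IsRegular τ ξ ω) : point τ ξ 0 ω = epoch τ 0 ω := by
  obtain ⟨i, hi⟩ := R.exists_point_eq_epoch 0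
  refine le_antisymm ?_ (by simp [epoch])
  rw [← hi]
  exact nthPoint_mono _ (Nat.zero_le i)

lemma exists_immigrant_lt (R : IsRegular τ ξ ω) {t : ℝ≥0} (ht : 0 < t) :
    ∃ i, point τ ξ i ω < t ∧ mark τ ξ i ω = 0 :=
  ⟨0, by rw [R.point_zero]; simpa [epoch] using ht, (mark_eq_zero_iff 0).2 ⟨0, R.point_zero⟩⟩

/-- The last immigrant strictly before time `t > 0`. -/
lemma exists_lastImmigrantBefore (R : IsRegular τ ξ ω) {t : ℝ≥0} (ht : 0 < t) :
    ∃ k, point τ ξ (lastImmigrantBefore (point τ ξ) (mark τ ξ) t ω) ω = epoch τ k ω ∧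
      epoch τ k ω < t ∧ t ≤ epoch τ (k + 1) ω := by
  set J := lastImmigrantBefore (point τ ξ) (mark τ ξ) t ω with hJ
  have hfin : {i | point τ ξ i ω < t ∧ mark τ ξ i ω = 0}.Finite :=
    (R.finite_point_lt t).subset fun i hi => hi.1.le
  -- The immigrant at `0` makes the index set nonempty and local finiteness bounds it, so `sSup` is
  -- a genuine maximum and not a default value.
  have hmem : J ∈ {i | point τ ξ i ω < t ∧ mark τ ξ i ω = 0} :=
    Nat.sSup_mem (R.exists_immigrant_lt ht) hfin.bddAbove
  obtain ⟨k, hk⟩ := (mark_eq_zero_iff J).1 hmem.2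
  refine ⟨k, hk, ?_, ?_⟩
  · have := hmem.1
    rw [hk] at this
    exact_mod_cast this
  · by_contra! hlt
    obtain ⟨i, hi⟩ := R.exists_point_eq_epoch (k + 1)
    have hi' : i ≤ J := le_csSup hfin.bddAbove
      ⟨by rw [hi]; exact_mod_cast hlt, (mark_eq_zero_iff i).2 ⟨k + 1, hi⟩⟩
    have h1 : point τ ξ i ω ≤ point τ ξ J ω := nthPoint_mono _ hi'
    rw [hi, hk, ENNReal.coe_le_coe] at h1
    exact absurd (R.epoch_lt k) (not_lt.2 h1)

/-- The intervals from one epoch (excluded) to the next (included) are disjoint, and the last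
immigrant before `t` opens the one containing `t`; a single summand survives. -/
lemma hazard_lastImmigrantBefore (R : IsRegular τ ξ ω) (μ : ℝ≥0 → ℝ≥0) {t : ℝ≥0} (ht : 0 < t) :
    (μ ((t : ℝ≥0∞) - point τ ξ (lastImmigrantBefore (point τ ξ) (mark τ ξ) t ω) ω).toNNReal :
      ℝ≥0∞) = ∑' k, if t ≤ epoch τ (k + 1) ω then
        shifted (fun x => μ x) (epoch τ k ω) t else 0 := by
  obtain ⟨k, hk, hkt, htk⟩ := R.exists_lastImmigrantBefore ht
  rw [hk, tsum_eq_single k]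
  · rw [if_pos htk, shifted, if_pos (by exact_mod_cast hkt), ← ENNReal.coe_sub]
    simp
  · intro k' hk'
    rcases lt_or_gt_of_ne hk' with hlt | hlt
    · refine if_neg (not_le.2 (lt_of_le_of_lt ?_ hkt))
      exact R.strictMono_epoch.monotone hlt
    · have : ¬ ((epoch τ k' ω : ℝ≥0∞) < t) := by
        rw [not_lt, ENNReal.coe_le_coe]
        exact htk.trans (R.strictMono_epoch.monotone hlt)
      rw [shifted, if_neg this, ite_self]

lemma epoch_le_iff (R : IsRegular τ ξ ω) (k : ℕ) (r : ℝ≥0) :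
    epoch τ k ω ≤ r ↔ (k : ℝ≥0∞) < generation τ ξ 0 ω (Iic r) := by
  rw [R.generation_zero, Measure.sum_apply _ measurableSet_Iic]
  simp_rw [diracTop_Iic, ENNReal.coe_le_coe]
  constructor
  · intro hk
    have h1 : ∑ j ∈ Finset.range (k + 1), (if epoch τ j ω ≤ r then (1 : ℝ≥0∞) else 0) =
        ((k + 1 : ℕ) : ℝ≥0∞) := by
      rw [Finset.sum_congr rfl (g := fun _ => (1 : ℝ≥0∞))]
      · simp
      · intro j hj
        refine if_pos (le_trans (R.strictMono_epoch.monotone ?_) hk)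
        exact Nat.lt_succ_iff.1 (Finset.mem_range.1 hj)
    refine lt_of_lt_of_le ?_ (ENNReal.sum_le_tsum (Finset.range (k + 1)))
    rw [h1]
    exact_mod_cast Nat.lt_succ_self k
  · intro hlt
    by_contra hk
    refine absurd hlt (not_lt.2 ?_)
    rw [← tsum_ite_lt k]
    refine ENNReal.tsum_le_tsum fun j => ?_
    by_cases hj : j < k
    · rw [if_pos hj]; split_ifs <;> simp
    · rw [if_neg fun h => hk ((R.strictMono_epoch.monotone (not_lt.1 hj)).trans h)]
      simp

lemma measure_singleton_zero (R : IsRegular τ ξ ω) : clusterProcess τ ξ ω {0} = 1 := by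
  refine le_antisymm (R.measure_singleton_le_one 0) ?_
  simpa [epoch] using R.one_le_measure_singleton_epoch 0

lemma generation_zero_singleton_zero (R : IsRegular τ ξ ω) : generation τ ξ 0 ω {0} = 1 := by
  rw [R.generation_zero, Measure.sum_apply _ (measurableSet_singleton 0), tsum_eq_single 0]
  · have h0 : epoch τ 0 ω = 0 := by simp [epoch]
    rw [h0, diracTop_coe]
    simp
  · intro k hk
    have := R.strictMono_epoch (Nat.pos_of_ne_zero hk)
    rw [diracTop_coe, Measure.dirac_apply' _ (measurableSet_singleton 0), indicator_of_notMem]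
    simp only [mem_singleton_iff]
    exact (lt_of_le_of_lt (zero_le) this).ne'

end IsRegular

lemma measure_Iic_eq (ν : Measure ℝ≥0) (t : ℝ≥0) : ν (Iic t) = ν {0} + ν (Ioc 0 t) := by
  rw [← measure_union (by simp) measurableSet_Ioc]
  congr 1
  ext x
  simp only [mem_Iic, mem_union, mem_singleton_iff, mem_Ioc]
  constructor
  · intro hx
    rcases eq_or_ne x 0 with h | h
    · exact Or.inl h
    · exact Or.inr ⟨pos_iff_ne_zero.2 h, hx⟩
  · rintro (rfl | h)
    · exact zero_le
    · exact h.2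

/-! ### Adapted and predictable processes -/

lemma measurable_sSup_nat {α : Type*} {mα : MeasurableSpace α} {S : α → Set ℕ}
    (hS : ∀ i, MeasurableSet {x | i ∈ S x}) : Measurable fun x => sSup (S x) := by
  refine measurable_to_countable' fun n => ?_
  -- On `ℕ`, `sSup` takes the value `0` on empty and on unbounded sets; these two cases form the
  -- second half of the union.
  have h : (fun x => sSup (S x)) ⁻¹' {n} =
      ({x | n ∈ S x} ∩ ⋂ (i : ℕ) (_ : n < i), {x | i ∈ S x}ᶜ) ∪
      ({_x | n = 0} ∩ ((⋂ i : ℕ, {x | i ∈ S x}ᶜ) ∪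
        ⋂ k : ℕ, ⋃ (i : ℕ) (_ : k < i), {x | i ∈ S x})) := by
    ext x
    simp only [mem_preimage, mem_singleton_iff, mem_union, mem_inter_iff, mem_ofPred_eq, mem_iInter,
      mem_compl_iff, mem_iUnion, exists_prop]
    by_cases he : S x = ∅
    · simp [he, eq_comm]
    by_cases hb : BddAbove (S x)
    · have hmem := Nat.sSup_mem (nonempty_iff_ne_empty.2 he) hb
      have hle : ∀ i ∈ S x, i ≤ sSup (S x) := fun i hi => le_csSup hb hi
      constructor
      · rintro rfl
        exact Or.inl ⟨hmem, fun i hi hi' => absurd (hle i hi') (not_le.2 hi)⟩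
      · rintro (⟨h1, h2⟩ | ⟨-, h | h⟩)
        · refine le_antisymm ?_ (hle n h1)
          by_contra! hlt
          exact h2 _ hlt hmem
        · exact absurd hmem (h _)
        · obtain ⟨i, hi, hi'⟩ := h (sSup (S x))
          exact absurd (hle i hi') (not_le.2 hi)
    · have hub : ∀ k, ∃ i, k < i ∧ i ∈ S x := by
        intro k
        by_contra! hk
        exact hb ⟨k, fun i hi => not_lt.1 fun hlt => hk i hlt hi⟩
      rw [Nat.sSup_of_not_bddAbove hb]
      constructor
      · rintro rfl
        exact Or.inr ⟨rfl, Or.inr hub⟩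
      · rintro (⟨-, h2⟩ | ⟨h, -⟩)
        · obtain ⟨i, hi, hi'⟩ := hub n
          exact absurd hi' (h2 i hi)
        · exact h.symm
  rw [h]
  refine ((hS n).inter (MeasurableSet.iInter fun i => MeasurableSet.iInter fun _ =>
    (hS i).compl)).union ((MeasurableSet.const _).inter (MeasurableSet.union ?_ ?_))
  · exact MeasurableSet.iInter fun i => (hS i).compl
  · exact MeasurableSet.iInter fun k => MeasurableSet.iUnion fun i => MeasurableSet.iUnion fun _ =>
      hS i

/-- Up to time `t` only `min σ t` and `min ρ t` are observable, and on `σ ≤ t`, `ρ ≤ t` they decide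
equality. -/
lemma measurableSet_eq_of_le {α : Type*} {mα : MeasurableSpace α} {t : ℝ≥0} {σ ρ : α → ℝ≥0∞}
    (hσ : ∀ r ≤ t, MeasurableSet {x | σ x ≤ r}) (hρ : ∀ r ≤ t, MeasurableSet {x | ρ x ≤ r}) :
    MeasurableSet {x | σ x ≤ t ∧ σ x = ρ x} := by
  have key : ∀ {σ : α → ℝ≥0∞}, (∀ r ≤ t, MeasurableSet {x | σ x ≤ r}) →
      Measurable fun x => min (σ x) t := by
    intro σ hσ
    refine measurable_of_Iic fun c => ?_
    by_cases hc : (t : ℝ≥0∞) ≤ c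
    · have : (fun x => min (σ x) t) ⁻¹' Iic c = univ := by ext x; simp [hc]
      rw [this]
      exact MeasurableSet.univ
    · lift c to ℝ≥0 using (ne_top_of_lt (not_le.1 hc))
      have : (fun x => min (σ x) t) ⁻¹' Iic (c : ℝ≥0∞) = {x | σ x ≤ c} := by
        ext x
        simp only [mem_preimage, mem_Iic, min_le_iff, hc, or_false, mem_ofPred_eq]
      rw [this]
      exact hσ c (by exact_mod_cast (not_le.1 hc).le)
  have h : {x | σ x ≤ t ∧ σ x = ρ x} =
      {x | σ x ≤ t} ∩ {x | ρ x ≤ t} ∩ {x | min (σ x) t = min (ρ x) t} := by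
    ext x
    simp only [mem_ofPred_eq, mem_inter_iff]
    constructor
    · rintro ⟨h1, h2⟩
      exact ⟨⟨h1, h2 ▸ h1⟩, by rw [h2]⟩
    · rintro ⟨⟨h1, h2⟩, h3⟩
      rw [min_eq_left h1, min_eq_left h2] at h3
      exact ⟨h1, h3⟩
  rw [h]
  exact ((hσ t le_rfl).inter (hρ t le_rfl)).inter (measurableSet_eq_fun (key hσ) (key hρ))

/-- Only `min σ T` enters, and only on the event `σ < T`; nothing about `σ` after `T` is required.
-/
lemma measurable_shifted_of_lt {α : Type*} {mα : MeasurableSpace α} {φ : ℝ≥0 → ℝ≥0∞}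
    (hφ : Measurable φ) {T : α → ℝ≥0} (hT : Measurable T) {σ : α → ℝ≥0∞}
    (hσ : ∀ c : ℝ≥0∞, MeasurableSet {x | σ x < T x ∧ σ x < c}) :
    Measurable fun x => shifted φ (σ x) (T x) := by
  have hmin : Measurable fun x => min (σ x) (T x) := by
    refine measurable_of_Iio fun c => ?_
    have : (fun x => min (σ x) (T x)) ⁻¹' Iio c =
        {x | (T x : ℝ≥0∞) < c} ∪ {x | σ x < T x ∧ σ x < c} := by
      ext x
      simp only [mem_preimage, mem_Iio, min_lt_iff, mem_union, mem_ofPred_eq]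
      constructor
      · rintro (h | h)
        · by_cases hT : (T x : ℝ≥0∞) < c
          · exact Or.inl hT
          · exact Or.inr ⟨h.trans_le (not_lt.1 hT), h⟩
        · exact Or.inl h
      · rintro (h | h)
        · exact Or.inr h
        · exact Or.inl h.2
    rw [this]
    exact (measurableSet_lt (by fun_prop) measurable_const).union (hσ c)
  have heq : (fun x => shifted φ (σ x) (T x)) = fun x =>
      if σ x < T x ∧ σ x < ⊤ then φ (T x - (min (σ x) (T x)).toNNReal) else 0 := by
    funext x
    rw [shifted]
    by_cases h : σ x < T x
    · rw [if_pos h, if_pos ⟨h, h.trans ENNReal.coe_lt_top⟩, min_eq_left h.le]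
    · rw [if_neg h, if_neg fun h' => h h'.1]
  rw [heq]
  exact Measurable.ite (hσ ⊤) (hφ.comp (by fun_prop)) measurable_const

section Predictable

variable {Ω : Type*} {m : MeasurableSpace Ω} {𝓕 : Filtration ℝ≥0 m}

lemma measurable_fst_predictable : Measurable[𝓕.predictable] (Prod.fst : ℝ≥0 × Ω → ℝ≥0) := by
  refine @measurable_of_Ioi ℝ≥0 (ℝ≥0 × Ω) _ _ _ (_) _ _ inferInstance _ fun c => ?_
  rw [← prod_univ]
  exact measurableSet_predictable_Ioi_prod MeasurableSet.univ

lemma measurableSet_univ_prod_predictable {A : Set Ω} (hA : MeasurableSet[𝓕 0] A) :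
    MeasurableSet[𝓕.predictable] ((univ : Set ℝ≥0) ×ˢ A) := by
  have h : (univ : Set ℝ≥0) ×ˢ A = {⊥} ×ˢ A ∪ Ioi ⊥ ×ˢ A := by
    rw [← union_prod]
    congr 1
    ext x
    simp only [mem_univ, mem_union, mem_singleton_iff, mem_Ioi, true_iff]
    exact eq_or_ne x ⊥ |>.imp id bot_lt_iff_ne_bot.2
  rw [h]
  exact (measurableSet_predictable_singleton_bot_prod hA).union
    (measurableSet_predictable_Ioi_prod hA)

/-- A rational `q` fits between `σ` and the smaller of the time and `c`, which exhibits the set as a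
countable union of rectangles `(q, ∞) × {σ ≤ q}`. For `c = ⊤` it is the stochastic interval `(σ,
∞)`. -/
lemma measurableSet_lt_predictable {σ : Ω → ℝ≥0∞}
    (hσ : ∀ r : ℝ≥0, MeasurableSet[𝓕 r] {ω | σ ω ≤ r}) (c : ℝ≥0∞) :
    MeasurableSet[𝓕.predictable] {y : ℝ≥0 × Ω | σ y.2 < y.1 ∧ σ y.2 < c} := by
  have h : {y : ℝ≥0 × Ω | σ y.2 < y.1 ∧ σ y.2 < c} =
      ⋃ (q : ℚ) (_ : ((Real.toNNReal q : ℝ≥0) : ℝ≥0∞) < c),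
        Ioi (Real.toNNReal q) ×ˢ {ω | σ ω ≤ Real.toNNReal q} := by
    ext ⟨t, ω⟩
    simp only [mem_ofPred_eq, mem_iUnion, mem_prod, mem_Ioi, exists_prop]
    constructor
    · intro h
      obtain ⟨q, -, h1, h2⟩ := ENNReal.lt_iff_exists_rat_btwn.1 (lt_min h.1 h.2)
      exact ⟨q, h2.trans_le (min_le_right _ _),
        ENNReal.coe_lt_coe.1 (h2.trans_le (min_le_left _ _)), h1.le⟩
    · rintro ⟨q, h1, h2, h3⟩
      exact ⟨h3.trans_lt (ENNReal.coe_lt_coe.2 h2), h3.trans_lt h1⟩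
  rw [h]
  exact MeasurableSet.iUnion fun q => MeasurableSet.iUnion fun _ =>
    measurableSet_predictable_Ioi_prod (hσ _)

lemma measurable_shifted_predictable {φ : ℝ≥0 → ℝ≥0∞} (hφ : Measurable φ) {σ : Ω → ℝ≥0∞}
    (hσ : ∀ r : ℝ≥0, MeasurableSet[𝓕 r] {ω | σ ω ≤ r}) :
    Measurable[𝓕.predictable] fun y : ℝ≥0 × Ω => shifted φ (σ y.2) y.1 :=
  measurable_shifted_of_lt (mα := 𝓕.predictable) hφ measurable_fst_predictable
    (σ := fun y : ℝ≥0 × Ω => σ y.2) (measurableSet_lt_predictable hσ)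

/-- A measurable process that is indistinguishable from a predictable process is predictable, if
the filtration contains the null sets. -/
lemma measurable_predictable_of_ae_eq {P : Measure Ω}
    (hnull : ∀ A, MeasurableSet A → P A = 0 → MeasurableSet[𝓕 0] A) {u u' : ℝ≥0 × Ω → ℝ≥0∞}
    (hu : Measurable u) (hu' : Measurable[𝓕.predictable] u')
    (huu' : ∀ᵐ ω ∂P, ∀ t, u (t, ω) = u' (t, ω)) : Measurable[𝓕.predictable] u := by
  obtain ⟨Z, hZsub, hZ, hZ0⟩ := exists_measurable_superset_of_null (ae_iff.1 huu')
  have huZ : MeasurableSet[𝓕.predictable] ((univ : Set ℝ≥0) ×ˢ Z) :=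
    measurableSet_univ_prod_predictable (hnull Z hZ hZ0)
  -- Over `Z` every measurable set is predictable, since every measurable subset of `Z` is null and
  -- so belongs to `𝓕 0`.
  have key : ∀ E : Set (ℝ≥0 × Ω), MeasurableSet E →
      MeasurableSet[𝓕.predictable] ((univ : Set ℝ≥0) ×ˢ Z ∩ E) := by
    intro E hE
    rw [← generateFrom_prod] at hE
    induction E, hE using MeasurableSpace.generateFrom_induction with
    | hC E hE _ =>
      obtain ⟨B, hB, A, hA, rfl⟩ := hE
      have h1 : (univ : Set ℝ≥0) ×ˢ Z ∩ B ×ˢ A = Prod.fst ⁻¹' B ∩ univ ×ˢ (Z ∩ A) := by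
        ext ⟨t, ω⟩
        simp only [mem_inter_iff, mem_prod, mem_univ, true_and, mem_preimage]
        tauto
      rw [h1]
      exact (measurable_fst_predictable hB).inter (measurableSet_univ_prod_predictable
        (hnull _ (hZ.inter hA) (measure_mono_null inter_subset_left hZ0)))
    | empty => simp
    | compl E _ ih =>
      have h1 : (univ : Set ℝ≥0) ×ˢ Z ∩ Eᶜ = univ ×ˢ Z \ (univ ×ˢ Z ∩ E) := by
        rw [sdiff_self_inter, sdiff_eq]
      rw [h1]
      exact huZ.diff ih
    | iUnion E _ ih =>
      rw [inter_iUnion]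
      exact MeasurableSet.iUnion ih
  intro B hB
  have h1 : u ⁻¹' B = (univ ×ˢ Z ∩ u ⁻¹' B) ∪ (u' ⁻¹' B \ univ ×ˢ Z) := by
    ext ⟨t, ω⟩
    simp only [mem_preimage, mem_union, mem_inter_iff, mem_prod, mem_univ, true_and, mem_sdiff]
    by_cases hω : ω ∈ Z
    · simp [hω]
    · have : u (t, ω) = u' (t, ω) := by
        by_contra hne
        exact hω (hZsub fun h => hne (h t))
      simp [hω, this]
  rw [h1]
  exact (key _ (hu hB)).union ((hu' hB).diff huZ)

end Predictable

lemma measurable_uncurry_swap {α β : Type*} [MeasurableSpace α] [MeasurableSpace β]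
    {u : α → β → ℝ≥0∞} (hu : Measurable fun y : α × β => u y.1 y.2) :
    Measurable fun y : β × α => u y.2 y.1 :=
  hu.comp measurable_swap

lemma measurable_hazard_add {Ω : Type*} [MeasurableSpace Ω] {φ : ℝ≥0 → ℝ≥0} (hφ : Measurable φ)
    {T : ℕ → Ω → ℝ≥0∞} (hT : ∀ i, Measurable (T i)) {J : ℝ≥0 → Ω → ℕ}
    (hJ : Measurable fun y : ℝ≥0 × Ω => J y.1 y.2) {Z : ℝ≥0 × Ω → ℝ≥0∞} (hZ : Measurable Z) :
    Measurable fun y : ℝ≥0 × Ω =>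
      (φ ((y.1 : ℝ≥0∞) - T (J y.1 y.2) y.2).toNNReal : ℝ≥0∞) + Z y := by
  have hp : Measurable fun y : ℕ × Ω => T y.1 y.2 := measurable_from_prod_countable_right hT
  have hpJ : Measurable fun y : ℝ≥0 × Ω => T (J y.1 y.2) y.2 :=
    hp.comp (hJ.prodMk measurable_snd)
  have hsub : Measurable fun y : ℝ≥0 × Ω => (y.1 : ℝ≥0∞) - T (J y.1 y.2) y.2 :=
    (measurable_coe_nnreal_ennreal.comp measurable_fst).sub hpJ
  exact (hφ.comp hsub.ennreal_toNNReal).coe_nnreal_ennreal.add hZ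

lemma measurable_ite_zero {α : Type*} {mα : MeasurableSpace α} {p : α → Prop} [DecidablePred p]
    (hp : MeasurableSet {a | p a}) {X : α → ℝ≥0∞} (hX : Measurable X) :
    Measurable fun a => if p a then X a else 0 :=
  Measurable.ite hp hX measurable_const

lemma measurable_one_add_tsum {α : Type*} {mα : MeasurableSpace α} {X : ℕ → α → ℝ≥0∞}
    (hX : ∀ i, Measurable (X i)) : Measurable fun a => 1 + ∑' i, X i a :=
  (Measurable.tsum hX).const_add 1

lemma measurableSet_lt_one_add {α : Type*} {mα : MeasurableSpace α} {X : α → ℝ≥0∞}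
    (hX : Measurable X) (c : ℝ≥0∞) : MeasurableSet {a | c < 1 + X a} :=
  measurableSet_lt measurable_const (hX.const_add 1)

lemma measurable_add_tsum_add_tsum {α ι κ : Type*} [Countable ι] [Countable κ]
    {mα : MeasurableSpace α} {X : ι → α → ℝ≥0∞} {Y : κ → α → ℝ≥0∞} (hX : ∀ i, Measurable (X i))
    (hY : ∀ k, Measurable (Y k)) {Z : α → ℝ≥0∞} (hZ : Measurable Z) :
    Measurable fun a => Z a + (∑' i, X i a + ∑' k, Y k a) :=
  hZ.add ((Measurable.tsum hX).add (Measurable.tsum hY))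

lemma measurable_generation_Ioc {Ω : Type*} {τ : ℕ → Ω → ℝ≥0}
    {ξ : ℕ × List ℕ → Ω → Measure ℝ≥0} (n : ℕ) (t : ℝ≥0) :
    Measurable[naturalSigma τ ξ t] fun ω => generation τ ξ n ω (Ioc 0 t) := by
  rw [measurable_iff_comap_le]
  exact le_iSup_of_le n (le_iSup_of_le 0 (le_iSup_of_le t (le_iSup_of_le ⟨zero_le, le_rfl⟩ le_rfl)))

/-! ### The augmented filtration -/

section Augmented

variable {Ω : Type*} [m : MeasurableSpace Ω] {P : Measure Ω} {τ : ℕ → Ω → ℝ≥0}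
  {ξ : ℕ × List ℕ → Ω → Measure ℝ≥0}

lemma measurableSet_augmentedFiltration_iff {t : ℝ≥0} {A : Set Ω} :
    MeasurableSet[augmentedFiltration P τ ξ t] A ↔
      MeasurableSet A ∧ ∃ B, MeasurableSet[naturalSigma τ ξ t] B ∧ A =ᵐ[P] B := by
  exact MeasurableSpace.measurableSet_inf

lemma measurableSet_augmentedFiltration_congr {t : ℝ≥0} {A B : Set Ω} (hA : MeasurableSet A)
    (hB : MeasurableSet[augmentedFiltration P τ ξ t] B) (hAB : A =ᵐ[P] B) :
    MeasurableSet[augmentedFiltration P τ ξ t] A := by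
  obtain ⟨-, B', hB', hBB'⟩ := measurableSet_augmentedFiltration_iff.1 hB
  exact measurableSet_augmentedFiltration_iff.2 ⟨hA, B', hB', hAB.trans hBB'⟩

lemma measurableSet_augmentedFiltration_of_null (t : ℝ≥0) {A : Set Ω} (hA : MeasurableSet A)
    (h0 : P A = 0) : MeasurableSet[augmentedFiltration P τ ξ t] A :=
  measurableSet_augmentedFiltration_congr hA
    (@MeasurableSet.empty _ (augmentedFiltration P τ ξ t)) (ae_eq_empty.2 h0)

lemma measurable_augmentedFiltration_of_ae_eq {β : Type*} [MeasurableSpace β] {t : ℝ≥0}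
    {u u' : Ω → β} (hu : Measurable u) (hu' : Measurable[naturalSigma τ ξ t] u')
    (h : u =ᵐ[P] u') : Measurable[augmentedFiltration P τ ξ t] u := by
  intro B hB
  exact measurableSet_augmentedFiltration_iff.2 ⟨hu hB, u' ⁻¹' B, hu' hB, h.preimage B⟩

end Augmented

namespace IsClusterModel

variable {Ω : Type*} [m : MeasurableSpace Ω] {P : Measure Ω} {f h : ℝ≥0 → ℝ≥0}
  {τ : ℕ → Ω → ℝ≥0} {ξ : ℕ × List ℕ → Ω → Measure ℝ≥0}

lemma measurable_clusterProcess_Iic (hM : IsClusterModel P f h τ ξ) (t : ℝ≥0) :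
    Measurable fun ω => clusterProcess τ ξ ω (Iic t) :=
  (Measure.measurable_coe measurableSet_Iic).comp hM.measurable_clusterProcess

lemma measurable_point (hM : IsClusterModel P f h τ ξ) (i : ℕ) : Measurable (point τ ξ i) :=
  (measurable_nthPoint i).comp hM.measurable_clusterProcess

lemma measurableSet_mark (hM : IsClusterModel P f h τ ξ) (i : ℕ) :
    MeasurableSet {ω | mark τ ξ i ω = 0} := by
  simp_rw [IsRegular.mark_eq_zero_iff]
  rw [ofPred_exists]
  exact MeasurableSet.iUnion fun k =>
    measurableSet_eq_fun (hM.measurable_point i) (hM.measurable_epoch k).coe_nnreal_ennreal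

lemma measurable_mark (hM : IsClusterModel P f h τ ξ) (i : ℕ) : Measurable (mark τ ξ i) := by
  refine measurable_to_countable' fun d => ?_
  have h0 : mark τ ξ i ⁻¹' {0} = {ω | mark τ ξ i ω = 0} := rfl
  have h1 : mark τ ξ i ⁻¹' {1} = {ω | mark τ ξ i ω = 0}ᶜ := by
    ext ω
    simp only [mem_preimage, mem_singleton_iff, mem_compl_iff, mem_ofPred_eq]
    omega
  fin_cases d
  · exact h0 ▸ hM.measurableSet_mark i
  · exact h1 ▸ (hM.measurableSet_mark i).compl

lemma adapted_clusterProcess [IsProbabilityMeasure P] (hM : IsClusterModel P f h τ ξ) (t : ℝ≥0) :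
    Measurable[augmentedFiltration P τ ξ t] fun ω => clusterProcess τ ξ ω (Iic t) := by
  -- The intervals `(a, b]` miss the origin, which almost surely carries exactly one point; hence
  -- the summand `1`.
  have hu' : Measurable[naturalSigma τ ξ t] fun ω => 1 + ∑' n, generation τ ξ n ω (Ioc 0 t) :=
    measurable_one_add_tsum (mα := naturalSigma τ ξ t) fun n => measurable_generation_Ioc n t
  refine measurable_augmentedFiltration_of_ae_eq (hM.measurable_clusterProcess_Iic t) hu' ?_
  filter_upwards [hM.ae_isRegular] with ω R
  rw [measure_Iic_eq, R.measure_singleton_zero, clusterProcess_eq_sum_generation,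
    Measure.sum_apply _ measurableSet_Ioc]

lemma measurableSet_point_le [IsProbabilityMeasure P] (hM : IsClusterModel P f h τ ξ) (i : ℕ)
    (r : ℝ≥0) : MeasurableSet[augmentedFiltration P τ ξ r] {ω | point τ ξ i ω ≤ r} := by
  refine measurableSet_augmentedFiltration_congr
    (measurableSet_le (hM.measurable_point i) measurable_const)
    (hM.adapted_clusterProcess r (measurableSet_Ioi (a := (i : ℝ≥0∞)))) ?_
  rw [Filter.eventuallyEq_set]
  filter_upwards [hM.ae_isRegular] with ω R
  exact R.point_le_iff i r

lemma measurableSet_epoch_le [IsProbabilityMeasure P] (hM : IsClusterModel P f h τ ξ) (k : ℕ)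
    (r : ℝ≥0) :
    MeasurableSet[augmentedFiltration P τ ξ r] {ω | (epoch τ k ω : ℝ≥0∞) ≤ r} := by
  have hmE := hM.measurable_epoch k
  refine measurableSet_augmentedFiltration_iff.2
    ⟨measurableSet_le (by fun_prop) measurable_const,
      {ω | (k : ℝ≥0∞) < 1 + generation τ ξ 0 ω (Ioc 0 r)},
      measurableSet_lt_one_add (mα := naturalSigma τ ξ r) (measurable_generation_Ioc 0 r) k, ?_⟩
  rw [Filter.eventuallyEq_set]
  filter_upwards [hM.ae_isRegular] with ω R
  rw [← R.generation_zero_singleton_zero, ← measure_Iic_eq, ← R.epoch_le_iff, ENNReal.coe_le_coe]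

/-- The ordered points and the epochs are stopping times, so whether a point that has occurred by
`t` is an immigrant is known at `t`. -/
lemma adapted_lastImmigrant [IsProbabilityMeasure P] (hM : IsClusterModel P f h τ ξ) (t : ℝ≥0) :
    Measurable[augmentedFiltration P τ ξ t] (lastImmigrant (point τ ξ) (mark τ ξ) t) := by
  refine measurable_sSup_nat (mα := augmentedFiltration P τ ξ t) fun i => ?_
  have h : {ω | i ∈ {i | point τ ξ i ω ≤ t ∧ mark τ ξ i ω = 0}} =
      ⋃ k, {ω | point τ ξ i ω ≤ t ∧ point τ ξ i ω = epoch τ k ω} := by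
    ext ω
    simp only [mem_ofPred_eq, IsRegular.mark_eq_zero_iff, mem_iUnion, exists_and_left]
  rw [h]
  refine MeasurableSet.iUnion fun k => measurableSet_eq_of_le (fun r hr => ?_) fun r hr => ?_
  · exact (augmentedFiltration P τ ξ).mono hr _ (hM.measurableSet_point_le i r)
  · exact (augmentedFiltration P τ ξ).mono hr _ (hM.measurableSet_epoch_le k r)

lemma measurable_lastImmigrantBefore (hM : IsClusterModel P f h τ ξ) :
    Measurable fun y : ℝ≥0 × Ω => lastImmigrantBefore (point τ ξ) (mark τ ξ) y.1 y.2 := by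
  refine measurable_sSup_nat (S := fun y : ℝ≥0 × Ω =>
    {i | point τ ξ i y.2 < y.1 ∧ mark τ ξ i y.2 = 0}) fun i => ?_
  have h1 : MeasurableSet {y : ℝ≥0 × Ω | point τ ξ i y.2 < y.1} :=
    measurableSet_lt ((hM.measurable_point i).comp measurable_snd)
      (measurable_coe_nnreal_ennreal.comp measurable_fst)
  have h2 : MeasurableSet {y : ℝ≥0 × Ω | mark τ ξ i y.2 = 0} :=
    (hM.measurableSet_mark i).preimage measurable_snd
  exact h1.inter h2

lemma measurable_lintegral_Iio_clusterProcess (hM : IsClusterModel P f h τ ξ) :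
    Measurable fun y : ℝ≥0 × Ω =>
      ∫⁻ x in Iio y.1, (h (y.1 - x) : ℝ≥0∞) ∂(clusterProcess τ ξ y.2) := by
  have hsum (y : ℝ≥0 × Ω) : ∫⁻ x in Iio y.1, (h (y.1 - x) : ℝ≥0∞) ∂(clusterProcess τ ξ y.2) =
      ∑' v : ℕ × List ℕ, shifted (fun x => h x) (birth τ ξ v.1 v.2 y.2) y.1 :=
    lintegral_Iio_of_eq_sum (clusterProcess_eq_sum hM.counting y.2) hM.measurable_h y.1
  simp_rw [hsum]
  exact Measurable.tsum fun v => measurable_uncurry_swap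
    (u := fun ω t => shifted (fun x => h x) (birth τ ξ v.1 v.2 ω) t)
    (hM.measurable_offspringIntensity v.1 v.2)

lemma measurable_hawkesIntensity (hM : IsClusterModel P f h τ ξ) :
    Measurable fun y : ℝ≥0 × Ω => hawkesIntensity (hazard f) h (clusterProcess τ ξ) (point τ ξ)
      (mark τ ξ) y.1 y.2 :=
  measurable_hazard_add (measurable_hazard hM.measurable_f) hM.measurable_point
    hM.measurable_lastImmigrantBefore hM.measurable_lintegral_Iio_clusterProcess

lemma ae_hawkesIntensity_eq [IsProbabilityMeasure P] (hM : IsClusterModel P f h τ ξ) :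
    ∀ᵐ ω ∂P, ∀ t : ℝ≥0, 0 < t →
      hawkesIntensity (hazard f) h (clusterProcess τ ξ) (point τ ξ) (mark τ ξ) t ω =
        sumIntensity f h τ ξ t ω := by
  filter_upwards [hM.ae_isRegular] with ω R t ht
  rw [hawkesIntensity, sumIntensity, R.hazard_lastImmigrantBefore _ ht,
    lintegral_Iio_of_eq_sum R.eq_sum hM.measurable_h]

lemma measurable_hawkesIntensity_predictable [IsProbabilityMeasure P]
    (hM : IsClusterModel P f h τ ξ) :
    Measurable[(augmentedFiltration P τ ξ).predictable] fun y : ℝ≥0 × Ω =>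
      hawkesIntensity (hazard f) h (clusterProcess τ ξ) (point τ ξ) (mark τ ξ) y.1 y.2 := by
  have hμ := measurable_hazard hM.measurable_f
  have hh := hM.measurable_h
  set 𝓕 := augmentedFiltration P τ ξ
  have m1 (k : ℕ) : Measurable[𝓕.predictable] fun y : ℝ≥0 × Ω =>
      if y.1 ≤ epoch τ (k + 1) y.2 then
        shifted (fun x => hazard f x) (epoch τ k y.2) y.1 else 0 := by
    refine measurable_ite_zero (mα := 𝓕.predictable) ?_
      (measurable_shifted_predictable (φ := fun x => hazard f x) (by fun_prop)
        (hM.measurableSet_epoch_le k))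
    have hset := measurableSet_lt_predictable (hM.measurableSet_epoch_le (k + 1)) ⊤
    convert! hset.compl using 1
    ext y
    simp
  -- Ordered points replace labelled individuals: the filtration sees counts per generation but no
  -- labels, so a labelled birth time need not be a stopping time.
  have m2 (i : ℕ) : Measurable[𝓕.predictable] fun y : ℝ≥0 × Ω =>
      shifted (fun x => h x) (point τ ξ i y.2) y.1 :=
    measurable_shifted_predictable (φ := fun x => h x) (by fun_prop) (hM.measurableSet_point_le i)
  -- At `t = 0` truncated subtraction makes the intensity equal to `hazard f 0`, while both sums
  -- vanish; this term restores the value.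
  have m0 : Measurable[𝓕.predictable] fun y : ℝ≥0 × Ω =>
      ({0} : Set ℝ≥0).indicator (fun _ => (hazard f 0 : ℝ≥0∞)) y.1 :=
    (measurable_const.indicator (measurableSet_singleton 0)).comp measurable_fst_predictable
  refine measurable_predictable_of_ae_eq
    (fun A => measurableSet_augmentedFiltration_of_null 0) hM.measurable_hawkesIntensity
    (measurable_add_tsum_add_tsum (mα := 𝓕.predictable) m1 m2 m0) ?_
  filter_upwards [hM.ae_isRegular] with ω R t
  rcases eq_or_ne t 0 with rfl | ht
  · simp [hawkesIntensity, shifted]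
  · rw [hawkesIntensity, R.hazard_lastImmigrantBefore _ (pos_iff_ne_zero.2 ht),
      lintegral_Iio_of_eq_sum R.eq_sum_point hM.measurable_h]
    simp [ht]

end IsClusterModel

/-! ### Measures on the predictable `σ`-algebra and compensators -/

section General

variable {Ω : Type*} {m : MeasurableSpace Ω} {𝓕 : Filtration ℝ≥0 m}

lemma predictable_le_prod : 𝓕.predictable ≤ (inferInstance : MeasurableSpace (ℝ≥0 × Ω)) :=
  measurableSpace_le_predictable_of_measurableSet
    (fun A hA => (measurableSet_singleton _).prod (𝓕.le _ A hA))
    fun i A hA => measurableSet_Ioi.prod (𝓕.le i A hA)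

/-- The left-open rectangles that generate the predictable `σ`-algebra. -/
def predictableRectangles (𝓕 : Filtration ℝ≥0 m) : Set (Set (ℝ≥0 × Ω)) :=
  {E | ∃ A, MeasurableSet[𝓕 0] A ∧ E = {0} ×ˢ A} ∪
    {E | ∃ s r A, MeasurableSet[𝓕 s] A ∧ E = Ioc s r ×ˢ A}

lemma isPiSystem_predictableRectangles : IsPiSystem (predictableRectangles 𝓕) := by
  rintro _ (⟨A, hA, rfl⟩ | ⟨s, r, A, hA, rfl⟩) _ (⟨A', hA', rfl⟩ | ⟨s', r', A', hA', rfl⟩) hne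
  · exact Or.inl ⟨A ∩ A', hA.inter hA', by rw [prod_inter_prod, inter_self]⟩
  · obtain ⟨⟨t, ω⟩, ⟨h1, -⟩, h2, -⟩ := hne
    simp only [mem_singleton_iff] at h1
    subst h1
    simp at h2
  · obtain ⟨⟨t, ω⟩, ⟨h2, -⟩, h1, -⟩ := hne
    simp only [mem_singleton_iff] at h1
    subst h1
    simp at h2
  · exact Or.inr ⟨s ⊔ s', r ⊓ r', A ∩ A', (𝓕.mono le_sup_left A hA).inter
      (𝓕.mono le_sup_right A' hA'), by rw [prod_inter_prod, Ioc_inter_Ioc]⟩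

lemma predictable_eq_generateFrom :
    𝓕.predictable = MeasurableSpace.generateFrom (predictableRectangles 𝓕) := by
  refine le_antisymm (measurableSpace_le_predictable_of_measurableSet (fun A hA => ?_)
    fun i A hA => ?_) (MeasurableSpace.generateFrom_le ?_)
  · exact MeasurableSpace.measurableSet_generateFrom (Or.inl ⟨A, hA, rfl⟩)
  · have h : Ioi i ×ˢ A = ⋃ n : ℕ, Ioc i (n : ℝ≥0) ×ˢ A := by
      ext ⟨t, ω⟩
      simp only [mem_prod, mem_Ioi, mem_iUnion, mem_Ioc]
      constructor
      · rintro ⟨h1, h2⟩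
        obtain ⟨n, hn⟩ := exists_nat_ge t
        exact ⟨n, ⟨h1, hn⟩, h2⟩
      · rintro ⟨n, ⟨h1, -⟩, h2⟩
        exact ⟨h1, h2⟩
    rw [h]
    exact MeasurableSet.iUnion fun n =>
      MeasurableSpace.measurableSet_generateFrom (Or.inr ⟨i, n, A, hA, rfl⟩)
  · rintro _ (⟨A, hA, rfl⟩ | ⟨s, r, A, hA, rfl⟩)
    · exact measurableSet_predictable_singleton_bot_prod hA
    · exact measurableSet_predictable_Ioc_prod s r hA

/-- Two measures that agree on the left-open rectangles integrate predictable processes in the same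
way. -/
lemma lintegral_eq_of_predictable {μ₁ μ₂ : Measure (ℝ≥0 × Ω)}
    (h₁ : μ₁ ({0} ×ˢ univ) = 0) (h₂ : μ₂ ({0} ×ˢ univ) = 0)
    (hfin : ∀ r, μ₁ (Ioc 0 r ×ˢ univ) < ⊤)
    (heq : ∀ s r A, MeasurableSet[𝓕 s] A → μ₁ (Ioc s r ×ˢ A) = μ₂ (Ioc s r ×ˢ A))
    {C : ℝ≥0 × Ω → ℝ≥0∞} (hC : Measurable[𝓕.predictable] C) :
    ∫⁻ y, C y ∂μ₁ = ∫⁻ y, C y ∂μ₂ := by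
  have hle := predictable_le_prod (𝓕 := 𝓕)
  have hmeas : ∀ E ∈ predictableRectangles 𝓕, MeasurableSet[𝓕.predictable] E := by
    intro E hE
    rw [predictable_eq_generateFrom]
    exact MeasurableSpace.measurableSet_generateFrom hE
  let B : ℕ → Set (ℝ≥0 × Ω) := fun n => n.casesOn ({0} ×ˢ univ) fun k => Ioc 0 (k : ℝ≥0) ×ˢ univ
  have hB : ∀ n, B n ∈ predictableRectangles 𝓕 := by
    rintro (_ | k)
    · exact Or.inl ⟨univ, MeasurableSet.univ, rfl⟩
    · exact Or.inr ⟨0, k, univ, MeasurableSet.univ, rfl⟩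
  have htrim : μ₁.trim hle = μ₂.trim hle := by
    refine @Measure.ext_of_generateFrom_of_iUnion (ℝ≥0 × Ω) 𝓕.predictable (μ₁.trim hle)
      (μ₂.trim hle) (predictableRectangles 𝓕) B predictable_eq_generateFrom
      isPiSystem_predictableRectangles ?_ hB ?_ ?_
    · refine eq_univ_of_forall fun y => mem_iUnion.2 ?_
      rcases eq_or_ne y.1 0 with hy | hy
      · exact ⟨0, hy, mem_univ _⟩
      · obtain ⟨n, hn⟩ := exists_nat_ge y.1
        exact ⟨n + 1, ⟨pos_iff_ne_zero.2 hy, hn⟩, mem_univ _⟩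
    · intro n
      rw [trim_measurableSet_eq hle (hmeas _ (hB n))]
      rcases n with _ | k
      · exact h₁ ▸ ENNReal.zero_ne_top
      · exact (hfin k).ne
    · intro E hE
      rw [trim_measurableSet_eq hle (hmeas _ hE), trim_measurableSet_eq hle (hmeas _ hE)]
      rcases hE with ⟨A, -, rfl⟩ | ⟨s, r, A, hA, rfl⟩
      · rw [measure_mono_null (prod_mono le_rfl (subset_univ A)) h₁,
          measure_mono_null (prod_mono le_rfl (subset_univ A)) h₂]
      · exact heq s r A hA
  rw [← lintegral_trim hle hC, ← lintegral_trim hle hC, htrim]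

/-- The crosswise sums avoid subtraction in `ℝ≥0∞`. With finite means they give equal integrals of
the differences over each `A`, which characterizes the conditional expectation. -/
lemma martingale_of_lintegral_eq {P : Measure Ω} [IsProbabilityMeasure P]
    {U V : ℝ≥0 → Ω → ℝ≥0∞} (hU : ∀ t, Measurable[𝓕 t] (U t)) (hV : ∀ t, Measurable[𝓕 t] (V t))
    (hUfin : ∀ t, ∫⁻ ω, U t ω ∂P < ⊤) (hVfin : ∀ t, ∫⁻ ω, V t ω ∂P < ⊤)
    (h : ∀ s r, s ≤ r → ∀ A, MeasurableSet[𝓕 s] A →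
      ∫⁻ ω in A, U r ω ∂P + ∫⁻ ω in A, V s ω ∂P = ∫⁻ ω in A, V r ω ∂P + ∫⁻ ω in A, U s ω ∂P) :
    Martingale (fun t ω => (U t ω).toReal - (V t ω).toReal) 𝓕 P := by
  have hUm (t : ℝ≥0) : Measurable (U t) := (hU t).mono (𝓕.le t) le_rfl
  have hVm (t : ℝ≥0) : Measurable (V t) := (hV t).mono (𝓕.le t) le_rfl
  have iU (t : ℝ≥0) : Integrable (fun ω => (U t ω).toReal) P :=
    integrable_toReal_of_lintegral_ne_top (hUm t).aemeasurable (hUfin t).ne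
  have iV (t : ℝ≥0) : Integrable (fun ω => (V t ω).toReal) P :=
    integrable_toReal_of_lintegral_ne_top (hVm t).aemeasurable (hVfin t).ne
  have mX (t : ℝ≥0) : StronglyMeasurable[𝓕 t] fun ω => (U t ω).toReal - (V t ω).toReal :=
    ((hU t).ennreal_toReal.sub (hV t).ennreal_toReal).stronglyMeasurable
  have sU (t : ℝ≥0) (A : Set Ω) : ∫ ω in A, (U t ω).toReal ∂P = (∫⁻ ω in A, U t ω ∂P).toReal :=
    integral_toReal (hUm t).aemeasurable (ae_restrict_of_ae (ae_lt_top (hUm t) (hUfin t).ne))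
  have sV (t : ℝ≥0) (A : Set Ω) : ∫ ω in A, (V t ω).toReal ∂P = (∫⁻ ω in A, V t ω ∂P).toReal :=
    integral_toReal (hVm t).aemeasurable (ae_restrict_of_ae (ae_lt_top (hVm t) (hVfin t).ne))
  have fU (t : ℝ≥0) (A : Set Ω) : ∫⁻ ω in A, U t ω ∂P ≠ ⊤ :=
    ((setLIntegral_le_lintegral A _).trans_lt (hUfin t)).ne
  have fV (t : ℝ≥0) (A : Set Ω) : ∫⁻ ω in A, V t ω ∂P ≠ ⊤ :=
    ((setLIntegral_le_lintegral A _).trans_lt (hVfin t)).ne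
  refine ⟨mX, fun s r hsr => ?_⟩
  refine (ae_eq_condExp_of_forall_setIntegral_eq (𝓕.le s) ((iU r).sub (iV r))
    (fun A _ _ => ((iU s).sub (iV s)).integrableOn) (fun A hA _ => ?_)
    (mX s).aestronglyMeasurable).symm
  simp only [Pi.sub_apply]
  rw [integral_sub (iU s).integrableOn (iV s).integrableOn,
    integral_sub (iU r).integrableOn (iV r).integrableOn, sU, sU, sV, sV]
  have key := congrArg ENNReal.toReal (h s r hsr A hA)
  rw [ENNReal.toReal_add (fU r A) (fV s A), ENNReal.toReal_add (fV r A) (fU s A)] at key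
  linarith

lemma measurable_lintegral_Iic_of_isStronglyProgressive {u : ℝ≥0 → Ω → ℝ≥0∞}
    (hu : IsStronglyProgressive 𝓕 u) (t : ℝ≥0) :
    Measurable[𝓕 t] fun ω => ∫⁻ s in Iic t, u s ω ∂leb := by
  have h1 (ω : Ω) : ∫⁻ s in Iic t, u s ω ∂leb =
      ∫⁻ p : Iic t, u p ω ∂(leb.comap Subtype.val) :=
    (lintegral_subtype_comap measurableSet_Iic _).symm
  simp_rw [h1]
  have : IsFiniteMeasure (leb.comap (Subtype.val : Iic t → ℝ≥0)) := by
    refine ⟨?_⟩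
    rw [(MeasurableEmbedding.subtype_coe measurableSet_Iic).comap_apply, image_univ,
      Subtype.range_coe, leb_Iic]
    exact ENNReal.coe_lt_top
  have h2 := (hu t).measurable
  exact @Measurable.lintegral_prod_left' (Iic t) Ω _ (𝓕 t) (leb.comap Subtype.val) _ _ h2

end General

/-! ### The intensity of the cluster process -/

lemma lintegral_indicator_one_mul {α : Type*} [MeasurableSpace α] {μ : Measure α} {A : Set α}
    (hA : MeasurableSet A) (g : α → ℝ≥0∞) :
    ∫⁻ a, A.indicator 1 a * g a ∂μ = ∫⁻ a in A, g a ∂μ := by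
  rw [← lintegral_indicator hA]
  refine lintegral_congr fun a => ?_
  by_cases ha : a ∈ A <;> simp [ha]

lemma lintegral_Ioi_of_eq_sum {ι : Type*} {ν : Measure ℝ≥0} {b : ι → ℝ≥0∞}
    (hν : ν = Measure.sum fun i => diracTop (b i)) {g : ℝ≥0 → ℝ≥0∞} (hg : Measurable g) :
    ∫⁻ x in Ioi 0, g x ∂ν =
      ∑' i, {x : ℝ≥0∞ | x ≠ ⊤ ∧ 0 < x}.indicator (fun x => g x.toNNReal) (b i) := by
  rw [hν, ← lintegral_indicator measurableSet_Ioi, lintegral_sum_measure]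
  refine tsum_congr fun i => ?_
  rw [lintegral_diracTop _ (hg.indicator measurableSet_Ioi)]
  induction b i with
  | top => simp
  | coe x => by_cases hx : 0 < x <;> simp [hx]

lemma setLIntegral_leb_Iic_eq (g : ℝ≥0 → ℝ≥0∞) {s r : ℝ≥0} (hsr : s ≤ r) :
    ∫⁻ v in Iic r, g v ∂leb = ∫⁻ v in Iic s, g v ∂leb + ∫⁻ v in Ioc s r, g v ∂leb := by
  rw [← Iic_union_Ioc_eq_Iic hsr, lintegral_union measurableSet_Ioc]
  exact disjoint_left.2 fun v hv hv' => not_lt.2 hv hv'.1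

lemma setLIntegral_leb_Iic_zero (g : ℝ≥0 → ℝ≥0∞) : ∫⁻ v in Iic 0, g v ∂leb = 0 :=
  setLIntegral_measure_zero _ _ (by simp [leb_Iic])

lemma lintegral_prod_withDensity {Ω : Type*} [MeasurableSpace Ω] {P : Measure Ω} [SFinite P]
    {u C : ℝ≥0 × Ω → ℝ≥0∞} (hu : Measurable u) (hC : Measurable C) :
    ∫⁻ y, C y ∂(leb.prod P).withDensity u = ∫⁻ ω, ∫⁻ t, C (t, ω) * u (t, ω) ∂leb ∂P := by
  rw [lintegral_withDensity_eq_lintegral_mul _ hu hC,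
    lintegral_prod_symm _ (hu.mul hC).aemeasurable]
  simp only [Pi.mul_apply, mul_comm]

lemma lintegral_indicator_prod {Ω : Type*} {ν : Measure ℝ≥0} {I : Set ℝ≥0} (hI : MeasurableSet I)
    (A : Set Ω) (u : ℝ≥0 → ℝ≥0∞) (ω : Ω) :
    ∫⁻ t, (I ×ˢ A).indicator 1 (t, ω) * u t ∂ν = A.indicator 1 ω * ∫⁻ t in I, u t ∂ν := by
  rw [← lintegral_indicator hI]
  by_cases hω : ω ∈ A
  · simp only [hω, indicator_of_mem, Pi.one_apply, one_mul]
    refine lintegral_congr fun t => ?_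
    by_cases ht : t ∈ I <;> simp [ht, hω]
  · simp [hω]

namespace IsClusterModel

variable {Ω : Type*} [m : MeasurableSpace Ω] {P : Measure Ω} {f h : ℝ≥0 → ℝ≥0}
  {τ : ℕ → Ω → ℝ≥0} {ξ : ℕ × List ℕ → Ω → Measure ℝ≥0}

/-- The intensity of the cluster process. -/
abbrev intensity (f h : ℝ≥0 → ℝ≥0) (τ : ℕ → Ω → ℝ≥0) (ξ : ℕ × List ℕ → Ω → Measure ℝ≥0) :
    ℝ≥0 → Ω → ℝ≥0∞ :=
  hawkesIntensity (hazard f) h (clusterProcess τ ξ) (point τ ξ) (mark τ ξ)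

/-- An event of the augmented σ-field differs from a natural one by a null set, and almost surely
the two forms of the intensity agree at all positive times, hence on `(s, r]`. -/
lemma lintegral_clusterProcess_augmented [IsProbabilityMeasure P] (hM : IsClusterModel P f h τ ξ)
    (s r : ℝ≥0) {A : Set Ω} (hA : MeasurableSet[augmentedFiltration P τ ξ s] A) :
    ∫⁻ ω in A, clusterProcess τ ξ ω (Ioc s r) ∂P =
      ∫⁻ ω in A, ∫⁻ v in Ioc s r, intensity f h τ ξ v ω ∂leb ∂P := by
  obtain ⟨hAm, B, hB, hAB⟩ := measurableSet_augmentedFiltration_iff.1 hA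
  have hBm := hM.naturalSigma_le s B hB
  have key := hM.lintegral_clusterProcess s r hB
  rw [lintegral_indicator_one_mul hBm, lintegral_indicator_one_mul hBm] at key
  rw [Measure.restrict_congr_set hAB, key]
  refine lintegral_congr_ae (ae_restrict_of_ae ?_)
  filter_upwards [hM.ae_hawkesIntensity_eq] with ω hω
  exact (setLIntegral_congr_fun measurableSet_Ioc fun v hv =>
    hω v (zero_le.trans_lt hv.1)).symm

/-- Taking `s = 0` and the sure event, the mean integrated intensity is the mean number of points in
`(0, t]`. -/
lemma lintegral_intensity_Iic_lt_top [IsProbabilityMeasure P] (hM : IsClusterModel P f h τ ξ)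
    (t : ℝ≥0) : ∫⁻ ω, ∫⁻ v in Iic t, intensity f h τ ξ v ω ∂leb ∂P < ⊤ := by
  have h1 := hM.lintegral_clusterProcess_augmented 0 t MeasurableSet.univ
  rw [Measure.restrict_univ] at h1
  have h2 (ω : Ω) : ∫⁻ v in Iic t, intensity f h τ ξ v ω ∂leb =
      ∫⁻ v in Ioc 0 t, intensity f h τ ξ v ω ∂leb := by
    rw [setLIntegral_leb_Iic_eq _ (zero_le : 0 ≤ t), setLIntegral_leb_Iic_zero, zero_add]
  simp_rw [h2]
  rw [← h1]
  exact (lintegral_mono fun ω => measure_mono Ioc_subset_Iic_self).trans_lt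
    (hM.lintegral_clusterProcess_Iic_lt_top t)

lemma isStronglyPredictable_intensity [IsProbabilityMeasure P] (hM : IsClusterModel P f h τ ξ) :
    IsStronglyPredictable (augmentedFiltration P τ ξ) (intensity f h τ ξ) :=
  hM.measurable_hawkesIntensity_predictable.stronglyMeasurable

lemma isIntensity [IsProbabilityMeasure P] (hM : IsClusterModel P f h τ ξ) :
    IsIntensity P (augmentedFiltration P τ ξ) (clusterProcess τ ξ) (intensity f h τ ξ) where
  adapted := hM.adapted_clusterProcess
  progressive := hM.isStronglyPredictable_intensity.isStronglyProgressive
  locallyIntegrable := by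
    have h1 : ∀ᵐ ω ∂P, ∀ n : ℕ, ∫⁻ v in Iic (n : ℝ≥0), intensity f h τ ξ v ω ∂leb < ⊤ := by
      rw [ae_all_iff]
      intro n
      refine ae_lt_top ?_ (hM.lintegral_intensity_Iic_lt_top n).ne
      exact (measurable_lintegral_Iic_of_isStronglyProgressive
        hM.isStronglyPredictable_intensity.isStronglyProgressive n).mono
        ((augmentedFiltration P τ ξ).le n) le_rfl
    filter_upwards [h1] with ω hω t
    obtain ⟨n, hn⟩ := exists_nat_ge t
    exact (lintegral_mono_set (Iic_subset_Iic.2 hn)).trans_lt (hω n)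
  martingale := by
    have hV := measurable_lintegral_Iic_of_isStronglyProgressive
      hM.isStronglyPredictable_intensity.isStronglyProgressive
    refine martingale_of_lintegral_eq (U := fun t ω => clusterProcess τ ξ ω (Iic t))
      hM.adapted_clusterProcess hV hM.lintegral_clusterProcess_Iic_lt_top
      hM.lintegral_intensity_Iic_lt_top fun s r hsr A hA => ?_
    have hN (ω : Ω) : clusterProcess τ ξ ω (Iic r) =
        clusterProcess τ ξ ω (Iic s) + clusterProcess τ ξ ω (Ioc s r) := by
      rw [← Iic_union_Ioc_eq_Iic hsr, measure_union _ measurableSet_Ioc]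
      exact disjoint_left.2 fun v hv hv' => not_lt.2 hv hv'.1
    simp_rw [hN, setLIntegral_leb_Iic_eq _ hsr]
    rw [lintegral_add_left (hM.measurable_clusterProcess_Iic s), lintegral_add_left
      ((hV s).mono ((augmentedFiltration P τ ξ).le s) le_rfl),
      hM.lintegral_clusterProcess_augmented s r hA]
    ring

/-- The measure that counts the points `t > 0` of the cluster process. -/
def campbellMeasure (P : Measure Ω) (τ : ℕ → Ω → ℝ≥0) (ξ : ℕ × List ℕ → Ω → Measure ℝ≥0) :
    Measure (ℝ≥0 × Ω) :=
  Measure.sum fun v : ℕ × List ℕ =>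
    (P.restrict {ω | birth τ ξ v.1 v.2 ω ≠ ⊤ ∧ 0 < birth τ ξ v.1 v.2 ω}).map
      fun ω => ((birth τ ξ v.1 v.2 ω).toNNReal, ω)

/-- The measure is a countable sum of images of `P`, one for each individual, so the formula holds
term by term. -/
lemma lintegral_campbellMeasure (hM : IsClusterModel P f h τ ξ) {C : ℝ≥0 × Ω → ℝ≥0∞}
    (hC : Measurable C) :
    ∫⁻ y, C y ∂campbellMeasure P τ ξ =
      ∫⁻ ω, ∫⁻ t in Ioi 0, C (t, ω) ∂(clusterProcess τ ξ ω) ∂P := by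
  have hS (v : ℕ × List ℕ) :
      MeasurableSet {ω | birth τ ξ v.1 v.2 ω ≠ ⊤ ∧ 0 < birth τ ξ v.1 v.2 ω} := by
    have hb := hM.measurable_birth v.1 v.2
    exact (measurableSet_eq_fun hb measurable_const).compl.inter
      (measurableSet_lt measurable_const hb)
  have hm (v : ℕ × List ℕ) : Measurable fun ω => ((birth τ ξ v.1 v.2 ω).toNNReal, ω) :=
    (hM.measurable_birth v.1 v.2).ennreal_toNNReal.prodMk measurable_id
  have e1 (ω : Ω) : ∫⁻ t in Ioi 0, C (t, ω) ∂(clusterProcess τ ξ ω) =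
      ∑' v : ℕ × List ℕ, {ω | birth τ ξ v.1 v.2 ω ≠ ⊤ ∧ 0 < birth τ ξ v.1 v.2 ω}.indicator
        (fun ω => C ((birth τ ξ v.1 v.2 ω).toNNReal, ω)) ω :=
    lintegral_Ioi_of_eq_sum (clusterProcess_eq_sum hM.counting ω) (g := fun t => C (t, ω))
      (hC.comp measurable_prodMk_right)
  simp_rw [e1]
  rw [campbellMeasure, lintegral_sum_measure]
  refine Eq.trans (tsum_congr fun v => ?_)
    (lintegral_tsum fun v => ((hC.comp (hm v)).indicator (hS v)).aemeasurable).symm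
  rw [lintegral_map hC (hm v), lintegral_indicator (hS v)]
  rfl

lemma campbellMeasure_prod (hM : IsClusterModel P f h τ ξ) {I : Set ℝ≥0} (hI : MeasurableSet I)
    {A : Set Ω} (hA : MeasurableSet A) :
    campbellMeasure P τ ξ (I ×ˢ A) = ∫⁻ ω in A, clusterProcess τ ξ ω (I ∩ Ioi 0) ∂P := by
  rw [← lintegral_indicator_one (hI.prod hA),
    hM.lintegral_campbellMeasure (measurable_one.indicator (hI.prod hA)),
    ← lintegral_indicator_one_mul hA]
  refine lintegral_congr fun ω => ?_
  have key := lintegral_indicator_prod (ν := (clusterProcess τ ξ ω).restrict (Ioi 0)) hI A 1 ω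
  simpa [Measure.restrict_restrict hI] using key

lemma withDensity_intensity_prod [IsProbabilityMeasure P] (hM : IsClusterModel P f h τ ξ)
    {I : Set ℝ≥0} (hI : MeasurableSet I) {A : Set Ω} (hA : MeasurableSet A) :
    (leb.prod P).withDensity (fun y => intensity f h τ ξ y.1 y.2) (I ×ˢ A) =
      ∫⁻ ω in A, ∫⁻ t in I, intensity f h τ ξ t ω ∂leb ∂P := by
  rw [← lintegral_indicator_one (hI.prod hA), lintegral_prod_withDensity
    hM.measurable_hawkesIntensity (measurable_one.indicator (hI.prod hA)),
    ← lintegral_indicator_one_mul hA]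
  exact lintegral_congr fun ω =>
    lintegral_indicator_prod hI A (fun t => intensity f h τ ξ t ω) ω

/-- The mean of the integral of a predictable process with respect to the cluster process. -/
lemma lintegral_predictable [IsProbabilityMeasure P] (hM : IsClusterModel P f h τ ξ)
    {C : ℝ≥0 → Ω → ℝ≥0∞} (hC : IsStronglyPredictable (augmentedFiltration P τ ξ) C) :
    ∫⁻ ω, ∫⁻ t in Ioi 0, C t ω ∂(clusterProcess τ ξ ω) ∂P =
      ∫⁻ ω, ∫⁻ t, C t ω * intensity f h τ ξ t ω ∂leb ∂P := by
  have hCm : Measurable[(augmentedFiltration P τ ξ).predictable] fun y : ℝ≥0 × Ω => C y.1 y.2 :=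
    hC.measurable
  have hCm' : Measurable fun y : ℝ≥0 × Ω => C y.1 y.2 := hCm.mono predictable_le_prod le_rfl
  have hI (s r : ℝ≥0) : Ioc s r ∩ Ioi 0 = Ioc s r :=
    inter_eq_left.2 fun t ht => zero_le.trans_lt ht.1
  -- Both sides are integrals of `C` over `ℝ≥0 × Ω`, so only the two measures have to be compared,
  -- on predictable rectangles, where `lintegral_clusterProcess_augmented` applies.
  rw [← hM.lintegral_campbellMeasure hCm',
    ← lintegral_prod_withDensity hM.measurable_hawkesIntensity hCm']
  refine lintegral_eq_of_predictable ?_ ?_ (fun r => ?_) (fun s r A hA => ?_) hCm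
  · rw [hM.campbellMeasure_prod (measurableSet_singleton 0) MeasurableSet.univ]
    simp
  · rw [hM.withDensity_intensity_prod (measurableSet_singleton 0) MeasurableSet.univ]
    simp
  · rw [hM.campbellMeasure_prod measurableSet_Ioc MeasurableSet.univ, Measure.restrict_univ]
    exact (lintegral_mono fun ω => measure_mono
      (inter_subset_left.trans Ioc_subset_Iic_self)).trans_lt
      (hM.lintegral_clusterProcess_Iic_lt_top r)
  · have hAm := (augmentedFiltration P τ ξ).le s A hA
    rw [hM.campbellMeasure_prod measurableSet_Ioc hAm,
      hM.withDensity_intensity_prod measurableSet_Ioc hAm, hI]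
    exact hM.lintegral_clusterProcess_augmented s r hA

lemma isSimplePointProcess [IsProbabilityMeasure P] (hM : IsClusterModel P f h τ ξ) :
    IsSimplePointProcess P (clusterProcess τ ξ) (point τ ξ) where
  measurable_points := hM.measurable_point
  strict := hM.ae_isRegular.mono fun _ R i hi => R.point_lt_succ i hi
  absorbing := ae_of_all _ fun ω i hi => top_le_iff.1 (hi ▸ nthPoint_mono _ (Nat.le_succ i))
  measurable := hM.measurable_clusterProcess
  locallyFinite := hM.ae_isRegular.mono fun _ R => R.isCountingMeasure
  eq_sum := by
    filter_upwards [hM.ae_isRegular] with ω R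
    conv_lhs => rw [R.eq_sum_point]
    ext B hB
    rw [Measure.sum_apply _ hB, Measure.sum_apply _ hB,
      ← tsum_subtype_eq_of_support_subset (s := {i | point τ ξ i ω ≠ ⊤})]
    · refine tsum_congr fun i => ?_
      rw [diracTop, if_neg i.2]
    · intro i hi htop
      refine hi ?_
      simp [htop, diracTop_top]

lemma lintegral_density [IsProbabilityMeasure P] (hM : IsClusterModel P f h τ ξ) :
    ∫⁻ t, (f t : ℝ≥0∞) ∂leb = 1 := by
  have h1 : P.map (τ 0) univ = 1 := by
    rw [Measure.map_apply (hM.measurable_waiting 0) MeasurableSet.univ, preimage_univ, measure_univ]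
  rwa [hM.law_waiting 0, withDensity_apply _ MeasurableSet.univ, Measure.restrict_univ] at h1

lemma isRenewalHawkesProcess [IsProbabilityMeasure P] (hM : IsClusterModel P f h τ ξ) :
    IsRenewalHawkesProcess P (augmentedFiltration P τ ξ) (clusterProcess τ ξ) (point τ ξ)
      (mark τ ξ) f h where
  measurable_f := hM.measurable_f
  density := hM.lintegral_density
  measurable_h := hM.measurable_h
  subcritical := hM.subcritical
  simple := hM.isSimplePointProcess
  measurable_marks := hM.measurable_mark
  immigrant_exists := hM.ae_isRegular.mono fun _ R _ ht => R.exists_immigrant_lt ht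
  adapted_lastImmigrant := hM.adapted_lastImmigrant
  predictable := hM.isStronglyPredictable_intensity
  intensity := hM.isIntensity

end IsClusterModel

end RenewalHawkes

end

theorem mainTheorem2 {Ω : Type*} [m : MeasurableSpace Ω] (P : Measure Ω) [IsProbabilityMeasure P]
    (f h : ℝ≥0 → ℝ≥0) (hf : Measurable f) (hh : Measurable h)
    (hsub : ∫⁻ t, (h t : ℝ≥0∞) ∂leb < 1)
    (τ : ℕ → Ω → ℝ≥0) (hτ_meas : ∀ i, Measurable (τ i)) (hτ_indep : iIndepFun τ P)
    (hτ_law : ∀ i, P.map (τ i) = leb.withDensity (fun t => (f t : ℝ≥0∞)))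
    (hτ_mean : ∀ i, ∫⁻ ω, (τ i ω : ℝ≥0∞) ∂P < ⊤)
    (ξ : ℕ × List ℕ → Ω → Measure ℝ≥0)
    (hξ_law : ∀ l, IsPoissonProcess P (ξ l)
      (leb.withDensity (fun t => (h t : ℝ≥0∞))))
    (hξ_indep : iIndepFun ξ P)
    (hτξ_indep : IndepFun (fun ω i => τ i ω) (fun ω l => ξ l ω) P) :
    IsRenewalHawkesProcess P (augmentedFiltration P τ ξ)
      (clusterProcess τ ξ) (point τ ξ) (mark τ ξ) f h ∧
    ∀ C : ℝ≥0 → Ω → ℝ≥0∞,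
      IsStronglyPredictable (augmentedFiltration P τ ξ) C →
      ∫⁻ ω, ∫⁻ t in Ioi 0, C t ω ∂(clusterProcess τ ξ ω) ∂P =
      ∫⁻ ω, ∫⁻ t, C t ω * hawkesIntensity (hazard f) h
        (clusterProcess τ ξ) (point τ ξ) (mark τ ξ) t ω
        ∂leb ∂P := by
  have hM : IsClusterModel P f h τ ξ :=
    ⟨hf, hh, hsub, hτ_meas, hτ_indep, hτ_law, hξ_law, hξ_indep, hτξ_indep⟩
  exact ⟨hM.isRenewalHawkesProcess, fun C hC => hM.lintegral_predictable hC⟩
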